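/- **Conventions.** Fix $Q\in\mathbb{C}$ with $0<|Q|<1$ and put $q=Q^6$. Write $(a;q)_k=\prod_{i=0}^{k-1}(1-aq^i)$, $(a;q)_\infty=\prod_{i\ge0}(1-aq^i)$, $(a;p,q)_\infty=\prod_{i,j\ge0}(1-p^iq^ja)$, $\Theta(a;q)=(a;q)_\infty(qa^{-1};q)_\infty$, $\Gamma(a;p,q)=(pqa^{-1};p,q)_\infty/(a;p,q)_\infty$ and ${}_1\varphi_1\left({0\atop b};q,z\right)=\sum_{k\ge0}\frac{(-1)^kq^{k(k-1)/2}z^k}{(b;q)_k(q;q)_k}$. **Birational action.** Let $\alpha_0,\alpha_1,\alpha_2,\gamma$ be parameters with $\alpha_0\alpha_1\alpha_2=Q$, let $\tau_i,\overline\tau_i$ ($i\in\mathbb{Z}/3\mathbb{Z}$) be variables, and put $a_i=\alpha_i^6$, $c=\gamma^6$, $u_i=Q^{-2}\gamma^{-4}\alpha_i^6$, $u_i^{1/2}=Q^{-1}\gamma^{-2}\alpha_i^3$, $v_i=Q^2\gamma^4\alpha_i^6$, $v_i^{1/2}=Q\gamma^2\alpha_i^3$. Define field automorphisms (listing only what is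 not fixed) by $$s_i(\alpha_i)=\alpha_i^{-1},\quad s_i(\alpha_{i\pm1})=\alpha_{i\pm1}\alpha_i,\quad s_i(\tau_i)=\frac{u_i\tau_{i+1}\overline\tau_{i-1}+\overline\tau_{i+1}\tau_{i-1}}{u_i^{1/2}\,\overline\tau_i},\quad s_i(\overline\tau_i)=\frac{v_i\overline\tau_{i+1}\tau_{i-1}+\tau_{i+1}\overline\tau_{i-1}}{v_i^{1/2}\,\tau_i},$$ $$\pi(\alpha_i)=\alpha_{i+1},\quad \pi(\tau_i)=\tau_{i+1},\quad \pi(\overline\tau_i)=\overline\tau_{i+1},\qquad r(\gamma)=Q^{-1}\gamma^{-1},\quad r(\tau_i)=\overline\tau_i,\quad r(\overline\tau_i)=\tau_i,$$ $$w_0(\gamma)=\gamma^{-1},\qquad w_0(\overline\tau_i)=\frac{\alpha_{i+1}^2\left(\overline\tau_i\tau_{i+1}\tau_{i+2}+u_{i-1}\tau_i\overline\tau_{i+1}\tau_{i+2}+u_{i+1}^{-1}\tau_i\tau_{i+1}\overline\tau_{i+2}\right)}{\alpha_{i+2}^2\,\overline\tau_{i+1}\overline\tau_{i+2}},$$ and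 the translations $T_1=\pi s_2s_1$, $T_2=s_1\pi s_2$, $T_3=s_2s_1\pi$, $T_4=rw_0$. On $(\alpha_0,\alpha_1,\alpha_2,\gamma)$ they act by $T_1:(Q\alpha_0,Q^{-1}\alpha_1,\alpha_2,\gamma)$, $T_2:(\alpha_0,Q\alpha_1,Q^{-1}\alpha_2,\gamma)$, $T_3:(Q^{-1}\alpha_0,\alpha_1,Q\alpha_2,\gamma)$, $T_4:(\alpha_0,\alpha_1,\alpha_2,Q\gamma)$. **Hypergeometric $\tau$ functions.** Let $\alpha_1=Q/(\alpha_0\alpha_2)$, and let $\Omega$ be a set of parameters $(\alpha_0,\alpha_2)\in(\mathbb{C}^\times)^2$, stable under $(\alpha_0,\alpha_2)\mapsto(Q^n\alpha_0,Q^{-m}\alpha_2)$ for $n,m\in\mathbb{Z}$, and generic in the sense that $a_i^2\notin q^{2\mathbb{Z}}$ and $\alpha_i/\alpha_{i+1}\notin Q^{\mathbb{Z}}$ for $i\in\mathbb{Z}/3\mathbb{Z}$ on $\Omega$. For a function $g$ on $\Omega$ write $g^{n,m}=g(Q^n\alpha_0,Q^{-m}\alpha_2)$; call $g$ periodic if $g^{n,m}$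 has period one in $n$ and in $m$. A family of functions $\tau_N$ on $\Omega$ ($N\in\mathbb{Z}$) is called a family of hypergeometric $\tau$ functions (for $\gamma=1$) if $\tau_N=0$ for $N<0$ and it is consistent with $\langle T_1,T_2,T_3,T_4\rangle$: for every $N$ and every point of $\Omega$, if the values $$\gamma=Q^N,\quad(\tau_0,\tau_1,\tau_2)=(\tau_N^{-1,0},\tau_N^{0,0},\tau_N^{0,1}),\quad(\overline\tau_0,\overline\tau_1,\overline\tau_2)=(\tau_{N+1}^{-1,0},\tau_{N+1}^{0,0},\tau_{N+1}^{0,1})$$ are inserted for the parameter $\gamma$ and the variables, then applying $T_i^{\pm1}$ ($i=1,2,3,4$) has the same effect as transforming $(\alpha_0,\alpha_2,N)$ by $T_i^{\pm1}$ (with $N\mapsto N\pm1$ for $T_4^{\pm1}$), whenever all the $\tau_i,\overline\tau_i$ (for $T_4$: all the $\tau_i$; for $T_4^{-1}$: all the $\overline\tau_i$) are nonzero there. **Explicit functions.** For periodic $A,B$ put $$F_{n,m}=\frac{A^{n,m}}{(a_2^{-2}q^{2m+2};q^2)_\infty}\,{}_1\varphi_1\left({0\atop a_2^2q^{-2m}};q^2,a_2^2a_0^2q^{2n-2m}\right)+B^{n,m}\frac{\Theta(a_0^2a_2^2q^{2n-2m-2};q^2)}{(a_2^2q^{-2m-2};q^2)_\infty\Theta(a_0^2q^{2n};q^2)}\,{}_1\varphi_1\left({0\atop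 a_2^{-2}q^{2m+4}};q^2,a_0^2q^{2n+2}\right),$$ $\psi_N^{n,m}=\det(F_{n-i+j,m})_{i,j=1}^N$ for $N>0$, $\psi_0^{n,m}=1$, $\psi_N^{n,m}=0$ for $N<0$, $$G^{n,m}=\Gamma(Q^{2n-m+1}\alpha_0^2\alpha_2;Q,Q)\,\Gamma(Q^{-n+2m-1}\alpha_1^2\alpha_0;Q,Q)\,\Gamma(Q^{-n-m}\alpha_2^2\alpha_1;Q,Q),$$ $$\tau_N^{n,m}[A,B]=(-1)^{N(N+1)/2}Q^{-2(2n-m)N^2+6nN}\alpha_0^{-4N^2+6N}\alpha_2^{-2N^2}\left(\frac{\Theta(-Q^{-6n}\alpha_0^{-6};Q^6)\,\Theta(-Q^{6m}\alpha_2^{-6};Q^6)}{\Theta(Q^{-6(n-m)}\alpha_0^{-6}\alpha_2^{-6};Q^6)}\right)^{N}G^{n,m}\,\psi_N^{n,m-1}.$$ **Theorem.** 1. For all periodic $A,B$ the functions $\tau_N[A,B]=\tau_N^{0,0}[A,B]$ are a family of hypergeometric $\tau$ functions, and the value of $\tau_N[A,B]$ at $(Q^n\alpha_0,Q^{-m}\alpha_2)$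 is $\tau_N^{n,m}[A,B]$. 2. The functions $F_{n,m}$ are exactly the solutions, of the form $F_{n,m}=f^{n,m}$ with $f$ a function on $\Omega$, of the contiguity relations $F_{n+1,m}-F_{n,m}=-a_0^2q^{2n}F_{n,m-1}$ and $F_{n,m+1}-F_{n,m}=-a_2^{-2}q^{2m+2}F_{n-1,m}$. 3. A family $\tau_N$ such that $\tau_N$ has no zeros on $\Omega$ for $N\ge0$ is a family of hypergeometric $\tau$ functions if and only if $\tau_N^{n,m}=C^{n,m}\,\tau_N^{n,m}[A,B]$ for all $n,m,N\in\mathbb{Z}$, with periodic $A,B$ and a gauge factor $C$, that is, a nowhere vanishing function with $C^{n,m}=C^{0,0}x^ny^m$, where $x,y$ do not depend on $n,m$. 4. If in addition such a family is normalized by $\tau_0^{n,m}=G^{n,m}$, then $\tau_N^{n,m}=\tau_N^{n,m}[A,B]$ for some periodic $A,B$. -/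

import Mathlib

noncomputable section

namespace QP3

/-! ## Conventions of `q`-analysis -/

/-- The `q`-shifted factorial `(a; q)_k`. -/
def qPoch (a q : ℂ) (k : ℕ) : ℂ := ∏ i ∈ Finset.range k, (1 - a * q ^ i)

/-- The infinite `q`-shifted factorial `(a; q)_∞`. -/
def qPochInf (a q : ℂ) : ℂ := ∏' i : ℕ, (1 - a * q ^ i)

/-- The double infinite product `(a; p, q)_∞`. -/
def qPochInf₂ (a p q : ℂ) : ℂ := ∏' ij : ℕ × ℕ, (1 - p ^ ij.1 * q ^ ij.2 * a)

/-- The basic hypergeometric series `ₛφᵣ` with upper parameters `as` and lower parameters `bs`. -/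
def basicHyp (as bs : List ℂ) (q z : ℂ) : ℂ :=
  ∑' n : ℕ, (as.map fun a => qPoch a q n).prod /
      ((bs.map fun b => qPoch b q n).prod * qPoch q q n) *
    ((-1) ^ n * q ^ (n * (n - 1) / 2)) ^ (1 + (bs.length : ℤ) - (as.length : ℤ)) * z ^ n

/-- The Jacobi theta function `Θ(a; q)`. -/
def theta (a q : ℂ) : ℂ := qPochInf a q * qPochInf (q * a⁻¹) q

/-- The elliptic gamma function `Γ(a; p, q)`. -/
def ellGamma (a p q : ℂ) : ℂ := qPochInf₂ (p * q * a⁻¹) p q / qPochInf₂ a p q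

/-! ## The birational action on the parameters and the `τ` variables

A point carries the values of the parameters `α 0, α 1, α 2, γ` (sixth roots of `a₀, a₁, a₂, c`)
and of the variables `τ₀, τ₁, τ₂` and `τ̄₀, τ̄₁, τ̄₂`; indices are taken modulo `3`.

A transformation `w` is given by its values `w(x)` on the coordinate functions `x` and is extended
to rational functions as a field automorphism.  It is represented by the map `w : P ↦ w P` of points
such that the coordinate `x` of `w P` is the value of `w(x)` at `P`, i.e. `w` acts on the arguments
of functions.  Hence a product `w w'` of transformations is represented by "first `w`, then `w'`". -/

@[ext]
structure Point where
  α : Fin 3 → ℂ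
  γ : ℂ
  τ : Fin 3 → ℂ
  τbar : Fin 3 → ℂ

/-- The Cartan matrix of type `A₂⁽¹⁾`. -/
def cartan : Matrix (Fin 3) (Fin 3) ℤ := !![2, -1, -1; -1, 2, -1; -1, -1, 2]

/-- `u_i = q^{-1/3} c^{-2/3} a_i`, where `q = Q ^ 6`. -/
def Point.u (Q : ℂ) (P : Point) (i : Fin 3) : ℂ := Q ^ (-2 : ℤ) * P.γ ^ (-4 : ℤ) * P.α i ^ 6

/-- `v_i = q^{1/3} c^{2/3} a_i`. -/
def Point.v (Q : ℂ) (P : Point) (i : Fin 3) : ℂ := Q ^ 2 * P.γ ^ 4 * P.α i ^ 6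

/-- `u_i^{1/2}`. -/
def Point.sqrtU (Q : ℂ) (P : Point) (i : Fin 3) : ℂ := Q⁻¹ * P.γ ^ (-2 : ℤ) * P.α i ^ 3

/-- `v_i^{1/2}`. -/
def Point.sqrtV (Q : ℂ) (P : Point) (i : Fin 3) : ℂ := Q * P.γ ^ 2 * P.α i ^ 3

/-- The simple reflection `s_i`. -/
def s (Q : ℂ) (i : Fin 3) (P : Point) : Point where
  α := fun j => P.α j * P.α i ^ (-cartan i j)
  γ := P.γ
  τ := Function.update P.τ i
    ((P.u Q i * P.τ (i + 1) * P.τbar (i - 1) + P.τbar (i + 1) * P.τ (i - 1)) /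
      (P.sqrtU Q i * P.τbar i))
  τbar := Function.update P.τbar i
    ((P.v Q i * P.τbar (i + 1) * P.τ (i - 1) + P.τ (i + 1) * P.τbar (i - 1)) /
      (P.sqrtV Q i * P.τ i))

/-- The diagram rotation `π`. -/
def rot (P : Point) : Point where
  α := fun i => P.α (i + 1)
  γ := P.γ
  τ := fun i => P.τ (i + 1)
  τbar := fun i => P.τbar (i + 1)

/-- The inverse rotation `π⁻¹`. -/
def rotInv (P : Point) : Point where
  α := fun i => P.α (i - 1)
  γ := P.γ
  τ := fun i => P.τ (i - 1)
  τbar := fun i => P.τbar (i - 1)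

/-- The reflection `w₀`; on the parameter `c` it is `c ↦ c⁻¹`. -/
def w0 (Q : ℂ) (P : Point) : Point where
  α := P.α
  γ := P.γ⁻¹
  τ := P.τ
  τbar := fun i =>
    P.α (i + 1) ^ 2 *
      (P.τbar i * P.τ (i + 1) * P.τ (i + 2) +
        P.u Q (i - 1) * P.τ i * P.τbar (i + 1) * P.τ (i + 2) +
        (P.u Q (i + 1))⁻¹ * P.τ i * P.τ (i + 1) * P.τbar (i + 2)) /
      (P.α (i + 2) ^ 2 * P.τbar (i + 1) * P.τbar (i + 2))

/-- The involution `r`; on the parameter `c` it is `c ↦ q⁻¹ c⁻¹`. -/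
def r (Q : ℂ) (P : Point) : Point where
  α := P.α
  γ := Q⁻¹ * P.γ⁻¹
  τ := P.τbar
  τbar := P.τ

/-- The translation `T₁ = π s₂ s₁`. -/
def T1 (Q : ℂ) (P : Point) : Point := s Q 1 (s Q 2 (rot P))

/-- The translation `T₂ = s₁ π s₂`. -/
def T2 (Q : ℂ) (P : Point) : Point := s Q 2 (rot (s Q 1 P))

/-- The translation `T₃ = s₂ s₁ π`. -/
def T3 (Q : ℂ) (P : Point) : Point := rot (s Q 1 (s Q 2 P))

/-- The translation `T₄ = r w₀`. -/
def T4 (Q : ℂ) (P : Point) : Point := w0 Q (r Q P)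

/-- `T₁⁻¹ = s₁ s₂ π⁻¹`. -/
def T1Inv (Q : ℂ) (P : Point) : Point := rotInv (s Q 2 (s Q 1 P))

/-- `T₂⁻¹ = s₂ π⁻¹ s₁`. -/
def T2Inv (Q : ℂ) (P : Point) : Point := s Q 1 (rotInv (s Q 2 P))

/-- `T₃⁻¹ = π⁻¹ s₁ s₂`. -/
def T3Inv (Q : ℂ) (P : Point) : Point := s Q 2 (s Q 1 (rotInv P))

/-- `T₄⁻¹ = w₀ r`. -/
def T4Inv (Q : ℂ) (P : Point) : Point := r Q (w0 Q P)

/-- All six `τ` variables are nonzero, so that the translations `T₁, T₂, T₃` and their inverses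
are defined at the point (only these variables occur in denominators). -/
def Point.Regular (P : Point) : Prop := ∀ i, P.τ i ≠ 0 ∧ P.τbar i ≠ 0

/-! ## Parameters and hypergeometric `τ` functions -/

/-- `α₁`, determined by `α₀ α₁ α₂ = Q`. -/
def alpha1 (Q α0 α2 : ℂ) : ℂ := Q / (α0 * α2)

/-- The parameters are nonzero and avoid the zeros and poles of the functions in the formulas:
`a_i² ∉ q^{2ℤ}` and `α_i / α_{i+1} ∉ Q^ℤ` for `i = 0, 1, 2`. -/
structure IsGeneric (Q α0 α2 : ℂ) : Prop where
  ne_zero0 : α0 ≠ 0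
  ne_zero2 : α2 ≠ 0
  pow0 : ∀ k : ℤ, α0 ^ 12 ≠ Q ^ (12 * k)
  pow1 : ∀ k : ℤ, alpha1 Q α0 α2 ^ 12 ≠ Q ^ (12 * k)
  pow2 : ∀ k : ℤ, α2 ^ 12 ≠ Q ^ (12 * k)
  ratio01 : ∀ k : ℤ, α0 / alpha1 Q α0 α2 ≠ Q ^ k
  ratio12 : ∀ k : ℤ, alpha1 Q α0 α2 / α2 ≠ Q ^ k
  ratio20 : ∀ k : ℤ, α2 / α0 ≠ Q ^ k

/-- A domain of parameters `(α₀, α₂)`: a set of generic parameters, stable under the action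
`(α₀, α₂) ↦ (Qⁿ α₀, Q⁻ᵐ α₂)` of `T₁ⁿ T₂ᵐ`. -/
structure IsParameterDomain (Q : ℂ) (Ω : Set (ℂ × ℂ)) : Prop where
  generic : ∀ α0 α2, (α0, α2) ∈ Ω → IsGeneric Q α0 α2
  shift : ∀ α0 α2, (α0, α2) ∈ Ω → ∀ n m : ℤ, (Q ^ n * α0, Q ^ (-m) * α2) ∈ Ω

/-- The point with `γ = Q ^ N` (that is, `T₄ᴺ` applied to `γ = 1`) and parameters
`(α₀, α₁, α₂)`, whose `τ` variables are
`τ₀ = τ_N^{-1,0}`, `τ₁ = τ_N^{0,0}`, `τ₂ = τ_N^{0,1}` and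
`τ̄₀ = τ_{N+1}^{-1,0}`, `τ̄₁ = τ_{N+1}^{0,0}`, `τ̄₂ = τ_{N+1}^{0,1}`,
where `τ_N^{n,m} = τ_N(Qⁿ α₀, Q⁻ᵐ α₂)`. -/
def tauPoint (Q : ℂ) (τ : ℤ → ℂ → ℂ → ℂ) (N : ℤ) (α0 α2 : ℂ) : Point where
  α := ![α0, alpha1 Q α0 α2, α2]
  γ := Q ^ N
  τ := ![τ N (Q⁻¹ * α0) α2, τ N α0 α2, τ N α0 (Q⁻¹ * α2)]
  τbar := ![τ (N + 1) (Q⁻¹ * α0) α2, τ (N + 1) α0 α2, τ (N + 1) α0 (Q⁻¹ * α2)]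

/-- Hypergeometric `τ` functions of `q`-P_III (with `γ = 1`) on the parameter domain `Ω`:
functions `τ_N(α₀, α₂)`, `N ∈ ℤ`, vanishing for `N < 0` and consistent with the action of
`⟨T₁, T₂, T₃, T₄⟩`: at every point where the birational transformation `T_i^{±1}` is defined,
transforming the `τ` variables is the same as transforming the arguments of the functions. -/
structure IsHypergeometricTau (Q : ℂ) (Ω : Set (ℂ × ℂ)) (τ : ℤ → ℂ → ℂ → ℂ) : Prop where
  boundary : ∀ N : ℤ, N < 0 → ∀ α0 α2, (α0, α2) ∈ Ω → τ N α0 α2 = 0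
  t1 : ∀ N : ℤ, ∀ α0 α2, (α0, α2) ∈ Ω → (tauPoint Q τ N α0 α2).Regular →
    T1 Q (tauPoint Q τ N α0 α2) = tauPoint Q τ N (Q * α0) α2
  t1Inv : ∀ N : ℤ, ∀ α0 α2, (α0, α2) ∈ Ω → (tauPoint Q τ N α0 α2).Regular →
    T1Inv Q (tauPoint Q τ N α0 α2) = tauPoint Q τ N (Q⁻¹ * α0) α2
  t2 : ∀ N : ℤ, ∀ α0 α2, (α0, α2) ∈ Ω → (tauPoint Q τ N α0 α2).Regular →
    T2 Q (tauPoint Q τ N α0 α2) = tauPoint Q τ N α0 (Q⁻¹ * α2)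
  t2Inv : ∀ N : ℤ, ∀ α0 α2, (α0, α2) ∈ Ω → (tauPoint Q τ N α0 α2).Regular →
    T2Inv Q (tauPoint Q τ N α0 α2) = tauPoint Q τ N α0 (Q * α2)
  t3 : ∀ N : ℤ, ∀ α0 α2, (α0, α2) ∈ Ω → (tauPoint Q τ N α0 α2).Regular →
    T3 Q (tauPoint Q τ N α0 α2) = tauPoint Q τ N (Q⁻¹ * α0) (Q * α2)
  t3Inv : ∀ N : ℤ, ∀ α0 α2, (α0, α2) ∈ Ω → (tauPoint Q τ N α0 α2).Regular →
    T3Inv Q (tauPoint Q τ N α0 α2) = tauPoint Q τ N (Q * α0) (Q⁻¹ * α2)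
  t4 : ∀ N : ℤ, ∀ α0 α2, (α0, α2) ∈ Ω → (∀ i, (tauPoint Q τ N α0 α2).τ i ≠ 0) →
    T4 Q (tauPoint Q τ N α0 α2) = tauPoint Q τ (N + 1) α0 α2
  t4Inv : ∀ N : ℤ, ∀ α0 α2, (α0, α2) ∈ Ω → (∀ i, (tauPoint Q τ N α0 α2).τbar i ≠ 0) →
    T4Inv Q (tauPoint Q τ N α0 α2) = tauPoint Q τ (N - 1) α0 α2

/-- `A_{n,m} = A(Qⁿ α₀, Q⁻ᵐ α₂)` is periodic of period one with respect to `n` and `m`. -/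
def IsPeriodic (Q : ℂ) (Ω : Set (ℂ × ℂ)) (A : ℂ → ℂ → ℂ) : Prop :=
  ∀ α0 α2, (α0, α2) ∈ Ω → A (Q * α0) α2 = A α0 α2 ∧ A α0 (Q⁻¹ * α2) = A α0 α2

/-- A gauge factor `C^{n,m} = C(Qⁿ α₀, Q⁻ᵐ α₂)`: it does not vanish, and on every lattice
`{(Qⁿ α₀, Q⁻ᵐ α₂)}` it is of the form `K xⁿ yᵐ`. -/
structure IsGauge (Q : ℂ) (Ω : Set (ℂ × ℂ)) (C : ℂ → ℂ → ℂ) : Prop where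
  ne_zero : ∀ α0 α2, (α0, α2) ∈ Ω → C α0 α2 ≠ 0
  geometric : ∀ α0 α2, (α0, α2) ∈ Ω → ∃ x y : ℂ, ∀ n m : ℤ,
    C (Q ^ n * α0) (Q ^ (-m) * α2) = C α0 α2 * x ^ n * y ^ m

/-- The function `F_{n,m}`, where `a_i = α_i ^ 6`, `q = Q ^ 6`. -/
def F (Q : ℂ) (A B : ℂ → ℂ → ℂ) (α0 α2 : ℂ) (n m : ℤ) : ℂ :=
  let q := Q ^ 6
  let a0 := α0 ^ 6
  let a2 := α2 ^ 6
  A (Q ^ n * α0) (Q ^ (-m) * α2) / qPochInf (a2 ^ (-2 : ℤ) * q ^ (2 * m + 2)) (q ^ 2) *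
      basicHyp [0] [a2 ^ 2 * q ^ (-2 * m)] (q ^ 2) (a2 ^ 2 * a0 ^ 2 * q ^ (2 * n - 2 * m)) +
    B (Q ^ n * α0) (Q ^ (-m) * α2) *
      (theta (a0 ^ 2 * a2 ^ 2 * q ^ (2 * n - 2 * m - 2)) (q ^ 2) /
        (qPochInf (a2 ^ 2 * q ^ (-2 * m - 2)) (q ^ 2) * theta (a0 ^ 2 * q ^ (2 * n)) (q ^ 2))) *
      basicHyp [0] [a2 ^ (-2 : ℤ) * q ^ (2 * m + 4)] (q ^ 2) (a0 ^ 2 * q ^ (2 * n + 2))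

/-- The contiguity relations
`F_{n+1,m} - F_{n,m} = -a₀² q^{2n} F_{n,m-1}`, `F_{n,m+1} - F_{n,m} = -a₂⁻² q^{2m+2} F_{n-1,m}`
for `F_{n,m} = f(Qⁿ α₀, Q⁻ᵐ α₂)`. -/
def IsContiguous (Q : ℂ) (Ω : Set (ℂ × ℂ)) (f : ℂ → ℂ → ℂ) : Prop :=
  ∀ α0 α2, (α0, α2) ∈ Ω → ∀ n m : ℤ,
    let Fnm : ℤ → ℤ → ℂ := fun k l => f (Q ^ k * α0) (Q ^ (-l) * α2)
    let q := Q ^ 6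
    Fnm (n + 1) m - Fnm n m = -(α0 ^ 6) ^ 2 * q ^ (2 * n) * Fnm n (m - 1) ∧
    Fnm n (m + 1) - Fnm n m = -(α2 ^ 6) ^ (-2 : ℤ) * q ^ (2 * m + 2) * Fnm (n - 1) m

/-- The Toeplitz determinant `ψ_N^{n,m}`, with `ψ_N^{n,m} = 0` for `N < 0`. -/
def psi (Q : ℂ) (A B : ℂ → ℂ → ℂ) (α0 α2 : ℂ) (N n m : ℤ) : ℂ :=
  if N < 0 then 0
  else Matrix.det (Matrix.of fun i j : Fin N.toNat =>
    F Q A B α0 α2 (n - ((i : ℕ) : ℤ) + ((j : ℕ) : ℤ)) m)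

/-- The product of three elliptic gamma functions. -/
def gammaFactor (Q α0 α2 : ℂ) (n m : ℤ) : ℂ :=
  let α1 := alpha1 Q α0 α2
  ellGamma (Q ^ (2 * n - m + 1) * α0 ^ 2 * α2) Q Q *
    ellGamma (Q ^ (-n + 2 * m - 1) * α1 ^ 2 * α0) Q Q *
    ellGamma (Q ^ (-n - m) * α2 ^ 2 * α1) Q Q

/-- The explicit expression for `τ_N^{n,m}`. -/
def hyperTau (Q : ℂ) (A B : ℂ → ℂ → ℂ) (α0 α2 : ℂ) (N n m : ℤ) : ℂ :=
  (-1) ^ (N * (N + 1) / 2) * Q ^ (-2 * (2 * n - m) * N ^ 2 + 6 * n * N) *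
      α0 ^ (-4 * N ^ 2 + 6 * N) * α2 ^ (-2 * N ^ 2) *
    (theta (-(Q ^ (-6 * n) * α0 ^ (-6 : ℤ))) (Q ^ 6) *
        theta (-(Q ^ (6 * m) * α2 ^ (-6 : ℤ))) (Q ^ 6) /
      theta (Q ^ (-6 * (n - m)) * α0 ^ (-6 : ℤ) * α2 ^ (-6 : ℤ)) (Q ^ 6)) ^ N *
    gammaFactor Q α0 α2 n m * psi Q A B α0 α2 N n (m - 1)

end QP3

end

/-! Everything takes place on the lattices of points `(Q^n α0, Q^(-m) α2)`. At two consecutive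
levels `N`, `N + 1`, the formula for a reflection `s_i` says that the `τ` values at the four
vertices of a lattice rhombus satisfy two bilinear relations (`RhombusRel`). The formula for `w_0`
is trilinear, but it follows from the rhombus relations together with bilinear relations of Toda
type between three levels. Both kinds are collected in `TriangleRel`, and
`IsBilinearTau.isHypergeometricTau` shows that they imply consistency with all the translations.

For the explicit functions, elliptic gamma quotients along a rhombus are monomials, and so are the
shifts of the theta quotient. Once these are removed, the bilinear relations become identities
between Toeplitz determinants of a solution of the contiguity relations. By contiguity, adjoining a
row `(1, 1, ...)` or `(1, Y, Y^2, ...)` to consecutive Toeplitz rows gives a Toeplitz determinant at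
level `m - 1` or `m + 1`. Hence each identity is a three-term Plücker relation (`bracket_plucker`),
or a combination of two of them.

A solution of the contiguity relations on one lattice is determined by two adjacent values
(`Contig.eq_zero`). The two `₁φ₁` solutions are independent: their Casoratian changes only by the
factor `b⁻¹` under `x ↦ p x`, and its behaviour along `p^n x` shows that it is nonzero
(`casoratian_ne_zero`). Thus they span all solutions, and uniqueness of the coefficients makes these
periodic.

Conversely, for a family without zeros, `τ_{-1} = 0` combined with the rhombus relations determines
the ratios of `τ_0` along each rhombus. The gamma factor has the same ratios, so `τ_0` is a gauge
factor times the gamma factor. The quotient `τ_1 / τ_0`, suitably normalized, then solves the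
contiguity relations, which yields `A` and `B`. Finally `T_4` computes level `N + 2` from levels `N`
and `N + 1`, so agreement at `N = 0, 1` is agreement everywhere
(`IsHypergeometricTau.eq_of_eq_zero_one`). -/

open Filter Topology
noncomputable section

namespace QP3

/-! ## Infinite products -/

/-- `b` is nonzero and not an integral power of `p`. -/
def NotPow (p b : ℂ) : Prop := b ≠ 0 ∧ ∀ k : ℤ, b ≠ p ^ k

section Products

variable {p : ℂ}

theorem NotPow.zpow_mul {b : ℂ} (hp0 : p ≠ 0) (h : NotPow p b) (k : ℤ) : NotPow p (p ^ k * b) := by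
  refine ⟨mul_ne_zero (zpow_ne_zero _ hp0) h.1, fun l hl => h.2 (l - k) ?_⟩
  rw [zpow_sub₀ hp0, ← hl]
  field_simp [zpow_ne_zero k hp0]

theorem NotPow.mul_left {b : ℂ} (hp0 : p ≠ 0) (h : NotPow p b) : NotPow p (p * b) := by
  simpa using h.zpow_mul hp0 1

theorem NotPow.div_self {b : ℂ} (hp0 : p ≠ 0) (h : NotPow p b) : NotPow p (b / p) := by
  have := h.zpow_mul hp0 (-1)
  rwa [zpow_neg_one, mul_comm, ← div_eq_mul_inv] at this

theorem NotPow.inv {b : ℂ} (h : NotPow p b) : NotPow p b⁻¹ := by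
  refine ⟨inv_ne_zero h.1, fun l hl => h.2 (-l) ?_⟩
  rw [zpow_neg, ← hl, inv_inv]

theorem NotPow.ne_one {b : ℂ} (h : NotPow p b) : b ≠ 1 := by
  simpa using h.2 0

theorem NotPow.one_sub_mul_pow_ne_zero {b : ℂ} (h : NotPow p b) (k : ℕ) : 1 - b * p ^ k ≠ 0 := by
  intro h0
  have h1 : b * p ^ k = 1 := by linear_combination -h0
  refine h.2 (-k) ?_
  rw [zpow_neg, zpow_natCast]
  exact eq_inv_of_mul_eq_one_left h1

variable (hp1 : ‖p‖ < 1)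
include hp1

theorem summable_norm_mul_pow (a : ℂ) : Summable fun i : ℕ => ‖-(a * p ^ i)‖ := by
  simp only [norm_neg, norm_mul, norm_pow]
  exact (summable_geometric_of_lt_one (norm_nonneg _) hp1).mul_left _

theorem multipliable_qPochInf (a : ℂ) : Multipliable fun i : ℕ => 1 - a * p ^ i := by
  simpa [sub_eq_add_neg] using multipliable_one_add_of_summable (summable_norm_mul_pow hp1 a)

theorem qPochInf_eq (a : ℂ) : qPochInf a p = (1 - a) * qPochInf (p * a) p := by
  have h : ∀ i : ℕ, 1 - a * p ^ (i + 1) = 1 - p * a * p ^ i := fun i => by ring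
  unfold qPochInf
  rw [tprod_eq_zero_mul' (f := fun i : ℕ => 1 - a * p ^ i)]
  · simp [h]
  · simpa [h] using multipliable_qPochInf hp1 (p * a)

theorem qPochInf_ne_zero {a : ℂ} (h : NotPow p a) : qPochInf a p ≠ 0 := by
  have := tprod_one_add_ne_zero_of_summable (f := fun i : ℕ => -(a * p ^ i))
    (fun i => by simpa [sub_eq_add_neg] using h.one_sub_mul_pow_ne_zero i)
    (summable_norm_mul_pow hp1 a)
  simpa [sub_eq_add_neg, qPochInf] using this

variable (hp0 : p ≠ 0)
include hp0

theorem theta_mul {a : ℂ} (ha : a ≠ 0) : theta (p * a) p = -a⁻¹ * theta a p := by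
  have h1 : p * (p * a)⁻¹ = a⁻¹ := by field_simp
  unfold theta
  rw [h1, qPochInf_eq hp1 a, qPochInf_eq hp1 a⁻¹]
  field_simp
  ring

theorem theta_ne_zero {a : ℂ} (h : NotPow p a) : theta a p ≠ 0 :=
  mul_ne_zero (qPochInf_ne_zero hp1 h) (qPochInf_ne_zero hp1 (h.inv.mul_left hp0))

omit hp0 in
theorem summable_norm_mul_pow_mul_pow (a : ℂ) :
    Summable fun ij : ℕ × ℕ => ‖-(p ^ ij.1 * p ^ ij.2 * a)‖ := by
  have h := summable_geometric_of_lt_one (norm_nonneg _) hp1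
  have h2 := (h.mul_of_nonneg h (fun i => by positivity) (fun i => by positivity)).mul_right ‖a‖
  simpa [norm_mul, norm_pow] using h2

omit hp0 in
theorem multipliable_qPochInf₂ (a : ℂ) :
    Multipliable fun ij : ℕ × ℕ => 1 - p ^ ij.1 * p ^ ij.2 * a := by
  simpa [sub_eq_add_neg] using
    multipliable_one_add_of_summable (summable_norm_mul_pow_mul_pow hp1 a)

omit hp0 in
theorem hasProd_qPochInf₂ (a : ℂ) :
    HasProd (fun i : ℕ => qPochInf (p ^ i * a) p) (qPochInf₂ a p p) := by
  refine (multipliable_qPochInf₂ hp1 a).hasProd.prod_fiberwise fun i => ?_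
  unfold qPochInf
  convert (multipliable_qPochInf hp1 (p ^ i * a)).hasProd using 2 with j
  ring

-- Grouped by rows, the double product loses exactly its row `i = 0` when `a` is replaced by `p *
-- a`.
omit hp0 in
theorem qPochInf₂_eq (a : ℂ) : qPochInf₂ a p p = qPochInf a p * qPochInf₂ (p * a) p p := by
  have h : ∀ i : ℕ, qPochInf (p ^ (i + 1) * a) p = qPochInf (p ^ i * (p * a)) p := fun i => by
    congr 1; ring
  rw [← (hasProd_qPochInf₂ hp1 a).tprod_eq, ← (hasProd_qPochInf₂ hp1 (p * a)).tprod_eq,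
    tprod_eq_zero_mul']
  · simp [h]
  · simpa [h] using (hasProd_qPochInf₂ hp1 (p * a)).multipliable

theorem qPochInf₂_ne_zero {a : ℂ} (h : NotPow p a) : qPochInf₂ a p p ≠ 0 := by
  have := tprod_one_add_ne_zero_of_summable (f := fun ij : ℕ × ℕ => -(p ^ ij.1 * p ^ ij.2 * a))
    (fun ij => ?_) (summable_norm_mul_pow_mul_pow hp1 a)
  · simpa [sub_eq_add_neg, qPochInf₂] using this
  · have h2 := (h.zpow_mul hp0 ij.1).one_sub_mul_pow_ne_zero ij.2
    rw [zpow_natCast] at h2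
    convert h2 using 1
    ring

theorem ellGamma_ne_zero {a : ℂ} (h : NotPow p a) : ellGamma a p p ≠ 0 := by
  refine div_ne_zero (qPochInf₂_ne_zero hp1 hp0 ?_) (qPochInf₂_ne_zero hp1 hp0 h)
  rw [mul_assoc]
  exact (h.inv.mul_left hp0).mul_left hp0

theorem ellGamma_mul {a : ℂ} (h : NotPow p a) :
    ellGamma (p * a) p p = theta a p * ellGamma a p p := by
  have ha := h.1
  have h1 : p * p * (p * a)⁻¹ = p * a⁻¹ := by field_simp
  have h2 : p * p * a⁻¹ = p * (p * a⁻¹) := by ring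
  unfold ellGamma theta
  rw [h1, qPochInf₂_eq hp1 (p * a⁻¹), qPochInf₂_eq hp1 a, h2]
  have h3 := qPochInf_ne_zero hp1 h
  have h4 := qPochInf₂_ne_zero hp1 hp0 (h.mul_left hp0)
  field_simp

/-- By `ellGamma_mul` the quotient of the two sides telescopes to `θ(p² a) / θ(a)`, a monomial by
quasi-periodicity. This and the next lemma are all that is needed about gamma functions on a
rhombus. -/
theorem ellGamma_mul_cube {a : ℂ} (h : NotPow p a) :
    ellGamma a p p * ellGamma (p ^ 3 * a) p p =
      (p * a ^ 2)⁻¹ * (ellGamma (p ^ 2 * a) p p * ellGamma (p * a) p p) := by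
  have ha := h.1
  have e3 : p ^ 3 * a = p * (p * (p * a)) := by ring
  have e2 : p ^ 2 * a = p * (p * a) := by ring
  rw [e3, e2, ellGamma_mul hp1 hp0 ((h.mul_left hp0).mul_left hp0),
    ellGamma_mul hp1 hp0 (h.mul_left hp0), ellGamma_mul hp1 hp0 h,
    theta_mul hp1 hp0 (mul_ne_zero hp0 ha), theta_mul hp1 hp0 ha]
  field_simp

theorem ellGamma_mul_sq {a : ℂ} (h : NotPow p a) :
    ellGamma (p * a) p p ^ 2 = -a * (ellGamma a p p * ellGamma (p ^ 2 * a) p p) := by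
  have ha := h.1
  have e2 : p ^ 2 * a = p * (p * a) := by ring
  rw [e2, ellGamma_mul hp1 hp0 (h.mul_left hp0), ellGamma_mul hp1 hp0 h,
    theta_mul hp1 hp0 ha]
  field_simp

end Products

/-! ## The series `₁φ₁` -/

/-- The terms of the series `₁φ₁(0; b; p, z)`. -/
def phiTerm (p b z : ℂ) (k : ℕ) : ℂ :=
  (-1) ^ k * p ^ (k * (k - 1) / 2) * z ^ k / (qPoch b p k * qPoch p p k)

/-- The series `₁φ₁(0; b; p, z)`. -/
def phi11 (p b z : ℂ) : ℂ := ∑' k, phiTerm p b z k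

theorem basicHyp_eq_phi11 (p b z : ℂ) : basicHyp [0] [b] p z = phi11 p b z := by
  unfold basicHyp phi11 phiTerm
  refine tsum_congr fun k => ?_
  simp [qPoch]
  ring

theorem qPoch_succ (a p : ℂ) (k : ℕ) : qPoch a p (k + 1) = qPoch a p k * (1 - a * p ^ k) := by
  simp [qPoch, Finset.prod_range_succ]

theorem qPoch_succ' (a p : ℂ) (k : ℕ) : qPoch a p (k + 1) = (1 - a) * qPoch (p * a) p k := by
  rw [qPoch, qPoch, Finset.prod_range_succ']
  rw [mul_comm]
  congr 1
  · simp
  · exact Finset.prod_congr rfl fun i _ => by ring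

theorem phiTerm_zero (p b z : ℂ) : phiTerm p b z 0 = 1 := by simp [phiTerm, qPoch]

/-- The recursion survives vanishing denominators, because inversion with `0⁻¹ = 0` is
multiplicative. -/
theorem phiTerm_succ (p b z : ℂ) (k : ℕ) :
    phiTerm p b z (k + 1) =
      phiTerm p b z k * (-(p ^ k * z) / ((1 - b * p ^ k) * (1 - p * p ^ k))) := by
  unfold phiTerm
  rw [Nat.triangle_succ, qPoch_succ, qPoch_succ, pow_add, pow_succ, pow_succ]
  simp only [div_eq_mul_inv, mul_inv]
  ring

theorem phiTerm_mul (p b c z : ℂ) (k : ℕ) : phiTerm p b (c * z) k = c ^ k * phiTerm p b z k := by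
  unfold phiTerm
  rw [mul_pow]
  ring

section Series

variable {p : ℂ} (hp1 : ‖p‖ < 1)
include hp1

theorem summable_phiTerm (b z : ℂ) : Summable (phiTerm p b z) := by
  have hpk : Tendsto (fun k : ℕ => p ^ k) atTop (𝓝 0) := tendsto_pow_atTop_nhds_zero_of_norm_lt_one hp1
  have h : Tendsto (fun k : ℕ => -(p ^ k * z) / ((1 - b * p ^ k) * (1 - p * p ^ k))) atTop
      (𝓝 (-(0 * z) / ((1 - b * 0) * (1 - p * 0)))) := by
    refine Tendsto.div ((hpk.mul_const z).neg) ?_ (by simp)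
    exact ((hpk.const_mul b).const_sub 1).mul ((hpk.const_mul p).const_sub 1)
  have h2 := h.norm
  simp only [zero_mul, neg_zero, zero_div, norm_zero] at h2
  refine summable_of_ratio_norm_eventually_le (r := 1 / 2) (by norm_num) ?_
  filter_upwards [h2.eventually_le_const (show (0 : ℝ) < 1 / 2 by norm_num)] with k hk
  rw [phiTerm_succ, norm_mul, mul_comm]
  exact mul_le_mul_of_nonneg_right hk (norm_nonneg _)

/-- Once `‖u n‖ ≤ 1`, the series at `z = 1` dominates, and only the constant term survives in the
limit. -/
theorem tendsto_phi11 (b : ℂ) {u : ℕ → ℂ} (hu : Tendsto u atTop (𝓝 0)) :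
    Tendsto (fun n => phi11 p b (u n)) atTop (𝓝 1) := by
  have key : ∀ z k, phiTerm p b z k = z ^ k * phiTerm p b 1 k := fun z k => by
    simpa using phiTerm_mul p b z 1 k
  have h1 : ∑' k, (if k = 0 then (1 : ℂ) else 0) = 1 := tsum_ite_eq 0 _
  rw [← h1]
  refine tendsto_tsum_of_dominated_convergence (summable_phiTerm hp1 b 1).norm (fun k => ?_) ?_
  · rcases Nat.eq_zero_or_pos k with rfl | hk
    · simp [phiTerm_zero]
    · rw [if_neg hk.ne']
      have := (hu.pow k).mul_const (phiTerm p b 1 k)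
      rw [zero_pow hk.ne', zero_mul] at this
      exact this.congr fun n => (key _ _).symm
  · have h2 := hu.norm
    rw [norm_zero] at h2
    filter_upwards [h2.eventually_le_const (zero_lt_one)] with n hn k
    rw [key, norm_mul, norm_pow]
    exact mul_le_of_le_one_left (norm_nonneg _) (pow_le_one₀ (norm_nonneg _) hn)

variable (hp0 : p ≠ 0)
include hp0

omit hp0 in
theorem one_sub_mul_pow_ne_zero_of_norm_lt_one (k : ℕ) : 1 - p * p ^ k ≠ 0 := by
  intro h
  have h1 : p ^ (k + 1) = 1 := by linear_combination -h
  have h2 := congrArg norm h1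
  rw [norm_pow, norm_one] at h2
  exact (pow_lt_one₀ (norm_nonneg _) hp1 k.succ_ne_zero).ne h2

/-- The constant terms cancel; in the term of index `k + 1` the factor `p^(k+1) - 1` cancels the
last factor of `(p; p)_{k+1}`, which leaves a series with index shifted by one. -/
theorem phi11_mul_sub {b : ℂ} (hb : NotPow p b) (z : ℂ) :
    phi11 p b (p * z) - phi11 p b z = z / (1 - b) * phi11 p (p * b) (p * z) := by
  have hb1 : 1 - b ≠ 0 := sub_ne_zero.2 hb.ne_one.symm
  unfold phi11
  rw [(summable_phiTerm hp1 b (p * z)).tsum_eq_zero_add, (summable_phiTerm hp1 b z).tsum_eq_zero_add,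
    phiTerm_zero, phiTerm_zero, add_sub_add_left_eq_sub, ← Summable.tsum_sub
      ((summable_nat_add_iff 1).2 (summable_phiTerm hp1 b (p * z)))
      ((summable_nat_add_iff 1).2 (summable_phiTerm hp1 b z)), ← tsum_mul_left]
  refine tsum_congr fun k => ?_
  rw [phiTerm_mul, phiTerm_mul, show p ^ (k + 1) = 1 - (1 - p * p ^ k) by ring]
  have hk := one_sub_mul_pow_ne_zero_of_norm_lt_one hp1 k
  have h1 : qPoch (p * b) p k ≠ 0 :=
    Finset.prod_ne_zero_iff.2 fun i _ => (hb.mul_left hp0).one_sub_mul_pow_ne_zero i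
  have h2 : qPoch p p k ≠ 0 :=
    Finset.prod_ne_zero_iff.2 fun i _ => one_sub_mul_pow_ne_zero_of_norm_lt_one hp1 i
  unfold phiTerm
  rw [qPoch_succ', qPoch_succ p, Nat.triangle_succ, pow_add]
  generalize 1 - p * p ^ k = d at hk ⊢
  field_simp
  ring

/-- This one holds term by term without an index shift: splitting `(b/p; p)_{k+1}` at either end
compares the two denominators. -/
theorem phi11_contiguity {b : ℂ} (hb : NotPow p b) (z : ℂ) :
    (1 - p / b) * phi11 p (b / p) (z / p) - phi11 p b z + p / b * phi11 p b (z / p) = 0 := by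
  unfold phi11
  rw [← tsum_mul_left, ← tsum_mul_left, ← Summable.tsum_sub
      ((summable_phiTerm hp1 _ _).mul_left _) (summable_phiTerm hp1 _ _), ← Summable.tsum_add
      (((summable_phiTerm hp1 _ _).mul_left _).sub (summable_phiTerm hp1 _ _))
      ((summable_phiTerm hp1 _ _).mul_left _), ← tsum_zero (β := ℕ)]
  refine tsum_congr fun k => ?_
  have hb0 := hb.1
  obtain ⟨y, rfl⟩ : ∃ y, z = p * y := ⟨z / p, by field_simp⟩
  rw [mul_div_cancel_left₀ _ hp0, phiTerm_mul]
  have hd : 1 - b / p ≠ 0 := sub_ne_zero.2 (hb.div_self hp0).ne_one.symm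
  have hd' : p - b ≠ 0 := by
    intro h; apply hd; field_simp; simpa using h
  have h1 : qPoch b p k ≠ 0 :=
    Finset.prod_ne_zero_iff.2 fun i _ => hb.one_sub_mul_pow_ne_zero i
  have h2 : qPoch p p k ≠ 0 :=
    Finset.prod_ne_zero_iff.2 fun i _ => one_sub_mul_pow_ne_zero_of_norm_lt_one hp1 i
  have h3 : qPoch (b / p) p k ≠ 0 :=
    Finset.prod_ne_zero_iff.2 fun i _ => (hb.div_self hp0).one_sub_mul_pow_ne_zero i
  have h4 : (1 - b / p) * qPoch b p k = qPoch (b / p) p k * (1 - b / p * p ^ k) := by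
    rw [← qPoch_succ, qPoch_succ', mul_div_cancel₀ _ hp0]
  unfold phiTerm
  field_simp at h4 ⊢
  linear_combination (-((-1) ^ k * p ^ (k * (k - 1) / 2) * y ^ k)) * h4

end Series

end QP3

end

noncomputable section
open Filter Topology

namespace QP3

/-! ## The contiguity relations -/

/-- A solution of the contiguity relations on one lattice. -/
structure Contig (p x y : ℂ) (f : ℤ → ℤ → ℂ) : Prop where
  right : ∀ n m, f (n + 1) m = f n m - x * p ^ n * f n (m - 1)
  up : ∀ n m, f n (m + 1) = f n m - y * p ^ m * f (n - 1) m

/-- The first solution of the contiguity relations. -/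
def contigA (p b x : ℂ) : ℂ := phi11 p b (b * x) / qPochInf (p / b) p

/-- The second solution of the contiguity relations. -/
def contigB (p b x : ℂ) : ℂ :=
  theta (x * b / p) p / (qPochInf (b / p) p * theta x p) * phi11 p (p ^ 2 / b) (p * x)

section

variable {p : ℂ} (hp1 : ‖p‖ < 1) (hp0 : p ≠ 0)
include hp1 hp0

theorem qPochInf_div_ne_zero {b : ℂ} (hb : NotPow p b) : qPochInf (p / b) p ≠ 0 :=
  qPochInf_ne_zero hp1 (by simpa [div_eq_mul_inv] using hb.inv.mul_left hp0)

/-- The normalization by `(p/b; p)_∞` absorbs the factor `1 - b` of `phi11_mul_sub`, so that the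
coefficient becomes a monomial. In the same way it absorbs `1 - p/b` in `contigA_up`. -/
theorem contigA_right {b : ℂ} (hb : NotPow p b) (x : ℂ) :
    contigA p b (p * x) - contigA p b x = -x * contigA p (p * b) x := by
  have h := phi11_mul_sub hp1 hp0 hb (b * x)
  have hb0 := hb.1
  have hb1 : 1 - b ≠ 0 := sub_ne_zero.2 hb.ne_one.symm
  have hb2 : b - 1 ≠ 0 := sub_ne_zero.2 hb.ne_one
  have h2 : qPochInf (p / (p * b)) p = (1 - 1 / b) * qPochInf (p / b) p := by
    rw [show p / (p * b) = 1 / b by field_simp, qPochInf_eq hp1, mul_one_div]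
  have h3 := qPochInf_div_ne_zero hp1 hp0 hb
  have h4 : phi11 p b (p * (b * x)) =
      phi11 p b (b * x) + b * x / (1 - b) * phi11 p (p * b) (p * (b * x)) := by
    linear_combination h
  unfold contigA
  rw [h2, show b * (p * x) = p * (b * x) by ring, show p * b * x = p * (b * x) by ring, h4]
  field_simp
  ring

theorem contigA_up {b : ℂ} (hb : NotPow p b) (x : ℂ) :
    contigA p (b / p) x - contigA p b x = -(p / b) * contigA p b (x / p) := by
  have h := phi11_contiguity hp1 hp0 hb (b * x)
  have hb0 := hb.1
  have h2 : qPochInf (p / b) p = (1 - p / b) * qPochInf (p / (b / p)) p := by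
    rw [qPochInf_eq hp1 (p / b), show p / (b / p) = p * (p / b) by field_simp]
  have h3 := qPochInf_div_ne_zero hp1 hp0 (hb.div_self hp0)
  have h5 : 1 - p / b ≠ 0 := by
    rw [sub_ne_zero]
    have := (hb.inv.mul_left hp0).ne_one.symm
    rwa [← div_eq_mul_inv] at this
  have h4 : phi11 p b (b * x) = (1 - p / b) * phi11 p (b / p) (b * x / p) +
      p / b * phi11 p b (b * x / p) := by
    linear_combination -h
  unfold contigA
  rw [h2, show b / p * x = b * x / p by ring, show b * (x / p) = b * x / p by ring, h4]
  have h6 : b - p ≠ 0 := by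
    intro h0; apply h5; field_simp; simpa using h0
  generalize phi11 p (b / p) (b * x / p) = u
  generalize phi11 p b (b * x / p) = v
  generalize qPochInf (p / (b / p)) p = w at h3 ⊢
  field_simp
  ring

theorem theta_div {a : ℂ} (ha : a ≠ 0) : theta a p = -(p / a) * theta (a / p) p := by
  have h := theta_mul hp1 hp0 (div_ne_zero ha hp0)
  rw [mul_div_cancel₀ _ hp0] at h
  rw [h]
  field_simp

/-- The second solution has lower parameter `p²/b`, so the two series identities exchange their
roles: `phi11_contiguity` gives the step in `x` and `phi11_mul_sub` the step in `b`. The theta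
quotient supplies the missing monomials. -/
theorem contigB_right {b x : ℂ} (hb : NotPow p b) (hx : NotPow p x) :
    contigB p b (p * x) - contigB p b x = -x * contigB p (p * b) x := by
  have hb0 := hb.1
  have hx0 := hx.1
  have h := phi11_contiguity hp1 hp0 (b := p ^ 2 / b) (by
    have := (hb.inv.mul_left hp0).mul_left hp0
    rwa [← mul_assoc, ← sq, ← div_eq_mul_inv] at this) (p * (p * x))
  have hd := (hb.div_self hp0)
  have h2 : qPochInf (b / p) p = (1 - b / p) * qPochInf b p := by
    rw [qPochInf_eq hp1 (b / p), mul_div_cancel₀ _ hp0]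
  have h3 := qPochInf_ne_zero hp1 hb
  have h5 : 1 - b / p ≠ 0 := sub_ne_zero.2 hd.ne_one.symm
  have h6 := theta_ne_zero hp1 hp0 hx
  have h7 : theta (p * x * b / p) p = -(p / (x * b)) * theta (x * b / p) p := by
    rw [show p * x * b / p = x * b by field_simp, theta_div hp1 hp0 (mul_ne_zero hx0 hb0)]
  have h8 : theta (x * (p * b) / p) p = -(p / (x * b)) * theta (x * b / p) p := by
    rw [← h7]; congr 1; ring
  rw [mul_div_cancel_left₀ _ hp0, show p ^ 2 / b / p = p / b by field_simp] at h
  unfold contigB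
  rw [h7, h8, theta_mul hp1 hp0 hx0, h2, mul_div_cancel_left₀ b hp0,
    show p ^ 2 / (p * b) = p / b by field_simp]
  have h9 : phi11 p (p ^ 2 / b) (p * (p * x)) = (1 - b / p) * phi11 p (p / b) (p * x) +
      b / p * phi11 p (p ^ 2 / b) (p * x) := by
    rw [show p / (p ^ 2 / b) = b / p by field_simp] at h
    linear_combination -h
  have h10 : p - b ≠ 0 := by
    intro h0; apply h5; field_simp; simpa using h0
  rw [h9]
  generalize phi11 p (p / b) (p * x) = u
  generalize phi11 p (p ^ 2 / b) (p * x) = v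
  field_simp
  ring

theorem contigB_up {b x : ℂ} (hb : NotPow p b) (hx : NotPow p x) :
    contigB p (b / p) x - contigB p b x = -(p / b) * contigB p b (x / p) := by
  have hb0 := hb.1
  have hx0 := hx.1
  have hB : NotPow p (p ^ 2 / b) := by
    have := (hb.inv.mul_left hp0).mul_left hp0
    rwa [← mul_assoc, ← sq, ← div_eq_mul_inv] at this
  have h := phi11_mul_sub hp1 hp0 hB x
  have h2 : qPochInf (b / p / p) p = (1 - b / p / p) * qPochInf (b / p) p := by
    rw [qPochInf_eq hp1 (b / p / p), mul_div_cancel₀ _ hp0]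
  have h3 := qPochInf_ne_zero hp1 (hb.div_self hp0)
  have h5 : 1 - b / p / p ≠ 0 := sub_ne_zero.2 ((hb.div_self hp0).div_self hp0).ne_one.symm
  have h5' : 1 - p ^ 2 / b ≠ 0 := sub_ne_zero.2 hB.ne_one.symm
  have h6 := theta_ne_zero hp1 hp0 (hx.div_self hp0)
  have h7 : theta (x * b / p) p = -(p ^ 2 / (x * b)) * theta (x * b / p / p) p := by
    rw [theta_div hp1 hp0 (div_ne_zero (mul_ne_zero hx0 hb0) hp0)]
    congr 1
    field_simp
  unfold contigB
  rw [show x * (b / p) / p = x * b / p / p by ring, show x / p * b / p = x * b / p / p by ring,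
    h7, h2, theta_div hp1 hp0 hx0, mul_div_cancel₀ x hp0,
    show p ^ 2 / (b / p) = p * (p ^ 2 / b) by field_simp]
  have h9 : phi11 p (p ^ 2 / b) (p * x) = phi11 p (p ^ 2 / b) x +
      x / (1 - p ^ 2 / b) * phi11 p (p * (p ^ 2 / b)) (p * x) := by
    linear_combination h
  rw [h9]
  have h10 : b - p ^ 2 ≠ 0 := by
    intro h0; apply h5'; field_simp; simpa using h0
  have h11 : p ^ 2 - b ≠ 0 := by
    intro h0; apply h10; linear_combination -h0
  field_simp
  ring

theorem contig_contigA {b : ℂ} (hb : NotPow p b) (x : ℂ) :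
    Contig p x (p / b) fun n m => contigA p (p ^ (-m) * b) (p ^ n * x) := by
  constructor
  · intro n m
    have h := contigA_right hp1 hp0 (hb.zpow_mul hp0 (-m)) (p ^ n * x)
    rw [← mul_assoc, ← mul_assoc, ← zpow_one_add₀ hp0, ← zpow_one_add₀ hp0] at h
    rw [show n + 1 = 1 + n by ring, show -(m - 1) = 1 + -m by ring]
    linear_combination h
  · intro n m
    have h := contigA_up hp1 hp0 (hb.zpow_mul hp0 (-m)) (p ^ n * x)
    have e1 : p ^ (-m) * b / p = p ^ (-(m + 1)) * b := by
      rw [show -(m + 1) = -m - 1 by ring, zpow_sub_one₀ hp0]; ring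
    have e2 : p ^ n * x / p = p ^ (n - 1) * x := by
      rw [zpow_sub_one₀ hp0]; ring
    have e3 : p / (p ^ (-m) * b) = p / b * p ^ m := by
      rw [zpow_neg]
      have := hb.1
      have := zpow_ne_zero m hp0
      field_simp
    rw [e1, e2, e3] at h
    linear_combination h

theorem contig_contigB {b x : ℂ} (hb : NotPow p b) (hx : NotPow p x) :
    Contig p x (p / b) fun n m => contigB p (p ^ (-m) * b) (p ^ n * x) := by
  constructor
  · intro n m
    have h := contigB_right hp1 hp0 (hb.zpow_mul hp0 (-m)) (hx.zpow_mul hp0 n)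
    rw [← mul_assoc, ← mul_assoc, ← zpow_one_add₀ hp0, ← zpow_one_add₀ hp0] at h
    rw [show n + 1 = 1 + n by ring, show -(m - 1) = 1 + -m by ring]
    linear_combination h
  · intro n m
    have h := contigB_up hp1 hp0 (hb.zpow_mul hp0 (-m)) (hx.zpow_mul hp0 n)
    have e1 : p ^ (-m) * b / p = p ^ (-(m + 1)) * b := by
      rw [show -(m + 1) = -m - 1 by ring, zpow_sub_one₀ hp0]; ring
    have e2 : p ^ n * x / p = p ^ (n - 1) * x := by
      rw [zpow_sub_one₀ hp0]; ring
    have e3 : p / (p ^ (-m) * b) = p / b * p ^ m := by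
      rw [zpow_neg]
      have := hb.1
      have := zpow_ne_zero m hp0
      field_simp
    rw [e1, e2, e3] at h
    linear_combination h

/-- The Casoratian of the two solutions. -/
def casoratian (p b x : ℂ) : ℂ :=
  contigA p b x * contigB p (p * b) x - contigA p (p * b) x * contigB p b x

/-- A step `x ↦ p x` acts on the pair of values at `b` and `p b` by a matrix with rows `(1, -x)` and
`(1, b⁻¹ - x)`, of determinant `b⁻¹`. -/
theorem casoratian_mul {b x : ℂ} (hb : NotPow p b) (hx : NotPow p x) :
    casoratian p b (p * x) = b⁻¹ * casoratian p b x := by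
  have hb0 := hb.1
  have hpb := hb.mul_left hp0
  have hpx := hx.mul_left hp0
  have a1 := contigA_right hp1 hp0 hb x
  have a2 := contigA_up hp1 hp0 hpb (p * x)
  have b1 := contigB_right hp1 hp0 hb hx
  have b2 := contigB_up hp1 hp0 hpb hpx
  have e : p / (p * b) = b⁻¹ := by field_simp
  rw [mul_div_cancel_left₀ _ hp0, mul_div_cancel_left₀ _ hp0, e] at a2 b2
  unfold casoratian
  rw [show contigA p (p * b) (p * x) = contigA p b (p * x) + b⁻¹ * contigA p (p * b) x by
      linear_combination -a2,
    show contigB p (p * b) (p * x) = contigB p b (p * x) + b⁻¹ * contigB p (p * b) x by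
      linear_combination -b2,
    show contigA p b (p * x) = contigA p b x - x * contigA p (p * b) x by linear_combination a1,
    show contigB p b (p * x) = contigB p b x - x * contigB p (p * b) x by linear_combination b1]
  ring

theorem theta_quotient {x c : ℂ} (hx : NotPow p x) (hc : c ≠ 0) (n : ℕ) :
    theta (p ^ n * x * c) p / theta (p ^ n * x) p = c⁻¹ ^ n * (theta (x * c) p / theta x p) := by
  induction n with
  | zero => simp
  | succ k ih =>
    have hx0 := hx.1
    have hk : p ^ k * x ≠ 0 := mul_ne_zero (pow_ne_zero _ hp0) hx0
    have e1 : p ^ (k + 1) * x = p * (p ^ k * x) := by ring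
    rw [e1, mul_assoc p, theta_mul hp1 hp0 (mul_ne_zero hk hc), theta_mul hp1 hp0 hk, pow_succ,
      mul_right_comm (c⁻¹ ^ k), ← ih]
    have h0 : theta (p ^ k * x) p ≠ 0 := by
      have := theta_ne_zero hp1 hp0 (hx.zpow_mul hp0 k)
      rwa [zpow_natCast] at this
    have := pow_ne_zero k hp0
    field_simp

/-- A zero at `x` would propagate to all `p^n x`, whereas `b^n` times the Casoratian at `p^n x` has
the nonzero limit `θ(x b) / ((p/b; p)_∞ (b; p)_∞ θ(x))`. -/
theorem casoratian_ne_zero {b x : ℂ} (hb : NotPow p b) (hx : NotPow p x)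
    (hbx : NotPow p (x * b)) : casoratian p b x ≠ 0 := by
  intro h0
  have hb0 := hb.1
  have hpk : Tendsto (fun k : ℕ => p ^ k) atTop (𝓝 0) :=
    tendsto_pow_atTop_nhds_zero_of_norm_lt_one hp1
  have hx' : ∀ n : ℕ, NotPow p (p ^ n * x) := fun n => by
    have := hx.zpow_mul hp0 n
    rwa [zpow_natCast] at this
  have hz : ∀ n : ℕ, casoratian p b (p ^ n * x) = 0 := by
    intro n
    induction n with
    | zero => simpa using h0
    | succ k ih =>
      rw [pow_succ', mul_assoc, casoratian_mul hp1 hp0 hb (hx' k), ih, mul_zero]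
  have hB : ∀ (c : ℂ), c ≠ 0 → ∀ n : ℕ, contigB p c (p ^ n * x) =
      (p / c) ^ n * (theta (x * c / p) p / (qPochInf (c / p) p * theta x p) *
        phi11 p (p ^ 2 / c) (p * (p ^ n * x))) := by
    intro c hc n
    have h := theta_quotient hp1 hp0 hx (div_ne_zero hc hp0) n
    unfold contigB
    rw [mul_div_assoc (p ^ n * x), mul_comm (qPochInf _ _), ← div_div, h, mul_div_assoc x,
      mul_comm (qPochInf _ _), ← div_div, inv_div]
    ring
  -- By `hB` the values of `contigB` at `p b` and at `b` scale like `b^(-n)` and `(p/b)^n`, so after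
  -- multiplication by `b^n` only the first product survives.
  have hlim : Tendsto (fun n : ℕ => b ^ n * casoratian p b (p ^ n * x)) atTop
      (𝓝 (1 / qPochInf (p / b) p *
          (theta (x * (p * b) / p) p / (qPochInf (p * b / p) p * theta x p) * 1) -
        1 / qPochInf (p / (p * b)) p *
          (0 * (theta (x * b / p) p / (qPochInf (b / p) p * theta x p) * 1)))) := by
    have hu : ∀ c : ℂ, Tendsto (fun n : ℕ => c * (p ^ n * x)) atTop (𝓝 0) := fun c => by
      simpa using (hpk.mul_const x).const_mul c
    have hA : ∀ c : ℂ, Tendsto (fun n : ℕ => contigA p c (p ^ n * x)) atTop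
        (𝓝 (1 / qPochInf (p / c) p)) := fun c =>
      (tendsto_phi11 hp1 c (hu c)).div_const _
    refine (((hA b).mul ((tendsto_phi11 hp1 (p ^ 2 / (p * b)) (hu p)).const_mul _)).sub
      ((hA (p * b)).mul (hpk.mul ((tendsto_phi11 hp1 (p ^ 2 / b) (hu p)).const_mul _)))).congr ?_
    intro n
    unfold casoratian
    rw [hB (p * b) (mul_ne_zero hp0 hb0), hB b hb0, div_pow, div_pow, mul_pow]
    have := pow_ne_zero n hp0
    have := pow_ne_zero n hb0
    field_simp
  simp only [hz, mul_zero, zero_mul, sub_zero, mul_one] at hlim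
  have h := tendsto_nhds_unique hlim tendsto_const_nhds
  have h2 : x * (p * b) / p = x * b := by field_simp
  rw [h2, mul_div_cancel_left₀ _ hp0] at h
  refine absurd h (mul_ne_zero (one_div_ne_zero (qPochInf_div_ne_zero hp1 hp0 hb))
    (div_ne_zero (theta_ne_zero hp1 hp0 hbx)
      (mul_ne_zero (qPochInf_ne_zero hp1 hb) (theta_ne_zero hp1 hp0 hx))))

end

theorem Contig.combination {p x y : ℂ} {f g : ℤ → ℤ → ℂ} (hf : Contig p x y f)
    (hg : Contig p x y g) (a b : ℂ) : Contig p x y fun n m => a * f n m + b * g n m := by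
  constructor
  · intro n m
    simp only [hf.right n m, hg.right n m]
    ring
  · intro n m
    simp only [hf.up n m, hg.up n m]
    ring

/-- Two vertically adjacent values propagate in all four directions; going left divides by `y p^m`,
going down by `x p^n`. Applied to differences, this bounds the dimension of the solution space by
two. -/
theorem Contig.eq_zero {p x y : ℂ} (hp0 : p ≠ 0) (hx : x ≠ 0) (hy : y ≠ 0) {f : ℤ → ℤ → ℂ}
    (hf : Contig p x y f) (h0 : f 0 0 = 0) (h1 : f 0 (-1) = 0) (n m : ℤ) : f n m = 0 := by
  have hr : ∀ n m, f n m = 0 → f n (m - 1) = 0 → f (n + 1) m = 0 ∧ f (n + 1) (m - 1) = 0 := by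
    intro n m h h'
    have e1 := hf.right n m
    have e2 := hf.up (n + 1) (m - 1)
    simp only [sub_add_cancel, add_sub_cancel_right] at e2
    rw [h, h'] at e1
    rw [h', e1] at e2
    exact ⟨by simpa using e1, by simpa using e2.symm⟩
  have hl : ∀ n m, f n m = 0 → f n (m - 1) = 0 → f (n - 1) m = 0 ∧ f (n - 1) (m - 1) = 0 := by
    intro n m h h'
    have e1 := hf.up n (m - 1)
    have e2 := hf.right (n - 1) m
    simp only [sub_add_cancel] at e1 e2
    rw [h, h'] at e1
    have e3 : f (n - 1) (m - 1) = 0 := by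
      simpa [hy, zpow_ne_zero _ hp0] using e1
    rw [h, e3] at e2
    exact ⟨by simpa using e2.symm, e3⟩
  have hu : ∀ n m, f n m = 0 → f n (m - 1) = 0 → f n (m + 1) = 0 := by
    intro n m h h'
    rw [hf.up, h, (hl n m h h').1]
    simp
  have hd : ∀ n m, f n m = 0 → f n (m - 1) = 0 → f n (m - 1 - 1) = 0 := by
    intro n m h h'
    have e := hf.right n (m - 1)
    rw [(hr n m h h').2, h'] at e
    simpa [hx, zpow_ne_zero _ hp0] using e
  have hn : ∀ n : ℤ, f n 0 = 0 ∧ f n (0 - 1) = 0 := by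
    intro n
    induction n using Int.induction_on with
    | zero => exact ⟨h0, by simpa using h1⟩
    | succ k ih => exact hr _ _ ih.1 ih.2
    | pred k ih => exact hl _ _ ih.1 ih.2
  have hm : ∀ m : ℤ, f n m = 0 ∧ f n (m - 1) = 0 := by
    intro m
    induction m using Int.induction_on with
    | zero => exact hn n
    | succ k ih => exact ⟨hu _ _ ih.1 ih.2, by simpa using ih.1⟩
    | pred k ih => exact ⟨ih.2, hd _ _ ih.1 ih.2⟩
  exact (hm m).1

end QP3

end

noncomputable section
open Filter Topology

namespace QP3

/-! ## The general solution of the contiguity relations -/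

section

variable {Q : ℂ} {Ω : Set (ℂ × ℂ)}

theorem norm_pow_twelve_lt_one (hQ1 : ‖Q‖ < 1) : ‖Q ^ 12‖ < 1 := by
  rw [norm_pow]
  exact pow_lt_one₀ (norm_nonneg _) hQ1 (by norm_num)

theorem IsGeneric.notPow_zero {α0 α2 : ℂ} (h : IsGeneric Q α0 α2) : NotPow (Q ^ 12) (α0 ^ 12) := by
  refine ⟨pow_ne_zero _ h.ne_zero0, fun k hk => h.pow0 k ?_⟩
  rw [hk, zpow_mul]
  norm_cast

theorem IsGeneric.notPow_two {α0 α2 : ℂ} (h : IsGeneric Q α0 α2) : NotPow (Q ^ 12) (α2 ^ 12) := by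
  refine ⟨pow_ne_zero _ h.ne_zero2, fun k hk => h.pow2 k ?_⟩
  rw [hk, zpow_mul]
  norm_cast

theorem IsGeneric.notPow_one {α0 α2 : ℂ} (hQ0 : Q ≠ 0) (h : IsGeneric Q α0 α2) :
    NotPow (Q ^ 12) (α0 ^ 12 * α2 ^ 12) := by
  refine ⟨mul_ne_zero (pow_ne_zero _ h.ne_zero0) (pow_ne_zero _ h.ne_zero2), fun k hk =>
    h.pow1 (1 - k) ?_⟩
  rw [alpha1, div_pow, mul_pow, hk, mul_sub, zpow_sub₀ hQ0, zpow_mul Q 12 k]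
  norm_cast

theorem IsParameterDomain.shift_zero (hΩ : IsParameterDomain Q Ω) {α0 α2 : ℂ} (h : (α0, α2) ∈ Ω)
    (n : ℤ) : (Q ^ n * α0, α2) ∈ Ω := by
  simpa using hΩ.shift α0 α2 h n 0

theorem IsParameterDomain.shift_two (hΩ : IsParameterDomain Q Ω) {α0 α2 : ℂ} (h : (α0, α2) ∈ Ω)
    (m : ℤ) : (α0, Q ^ m * α2) ∈ Ω := by
  simpa using hΩ.shift α0 α2 h 0 (-m)

theorem IsPeriodic.eq (hQ0 : Q ≠ 0) (hΩ : IsParameterDomain Q Ω) {A : ℂ → ℂ → ℂ}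
    (hA : IsPeriodic Q Ω A) {α0 α2 : ℂ} (h : (α0, α2) ∈ Ω) (n m : ℤ) :
    A (Q ^ n * α0) (Q ^ (-m) * α2) = A α0 α2 := by
  have h1 : ∀ n : ℤ, A (Q ^ n * α0) α2 = A α0 α2 := by
    intro n
    induction n using Int.induction_on with
    | zero => simp
    | succ k ih =>
      rw [add_comm, zpow_one_add₀ hQ0, mul_assoc, (hA _ _ (hΩ.shift_zero h k)).1, ih]
    | pred k ih =>
      rw [← ih, ← (hA _ _ (hΩ.shift_zero h (-k - 1))).1, ← mul_assoc, ← zpow_one_add₀ hQ0]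
      congr 3
      ring
  have h2 : ∀ m : ℤ, A (Q ^ n * α0) (Q ^ (-m) * α2) = A (Q ^ n * α0) α2 := by
    intro m
    induction m using Int.induction_on with
    | zero => simp
    | succ k ih =>
      have := (hA _ _ (hΩ.shift _ _ h n k)).2
      rw [ih, ← mul_assoc, ← zpow_neg_one, ← zpow_add₀ hQ0] at this
      rw [← this]
      congr 3
      ring
    | pred k ih =>
      rw [← ih, ← (hA _ _ (hΩ.shift _ _ h n (-k - 1))).2, ← mul_assoc, ← zpow_neg_one,
        ← zpow_add₀ hQ0]
      congr 3
      ring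
  rw [h2, h1]

theorem isPeriodic_of_eq {A : ℂ → ℂ → ℂ}
    (h : ∀ α0 α2, (α0, α2) ∈ Ω → ∀ n m : ℤ, A (Q ^ n * α0) (Q ^ (-m) * α2) = A α0 α2) :
    IsPeriodic Q Ω A := fun α0 α2 hα =>
  ⟨by simpa using h α0 α2 hα 1 0, by simpa using h α0 α2 hα 0 1⟩

/-- The base of the series is `q²`, so from here on `p = q² = Q^12`, `x = a₀²`, `b = a₂²` and `y = p
/ b`. -/
theorem isContiguous_iff (hQ0 : Q ≠ 0) (f : ℂ → ℂ → ℂ) :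
    IsContiguous Q Ω f ↔ ∀ α0 α2, (α0, α2) ∈ Ω →
      Contig (Q ^ 12) (α0 ^ 12) (Q ^ 12 / α2 ^ 12) fun n m => f (Q ^ n * α0) (Q ^ (-m) * α2) := by
  have e1 : ∀ (n : ℤ), (Q ^ 6) ^ (2 * n) = (Q ^ 12) ^ n := fun n => by
    rw [zpow_mul]
    norm_cast
    rw [← pow_mul]
  have e2 : ∀ (α : ℂ) (m : ℤ), (α ^ 6) ^ (-2 : ℤ) * (Q ^ 6) ^ (2 * m + 2) =
      Q ^ 12 / α ^ 12 * (Q ^ 12) ^ m := fun α m => by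
    rw [zpow_add₀ (pow_ne_zero _ hQ0), e1, zpow_neg]
    norm_cast
    rw [← pow_mul, ← pow_mul]
    ring
  constructor
  · intro h α0 α2 hα
    constructor
    · intro n m
      have := (h α0 α2 hα n m).1
      simp only [e1] at this
      linear_combination this
    · intro n m
      have := (h α0 α2 hα n m).2
      simp only [neg_mul, e2] at this
      linear_combination this
  · intro h α0 α2 hα n m
    constructor
    · have := (h α0 α2 hα).right n m
      simp only [e1]
      linear_combination this
    · have := (h α0 α2 hα).up n m
      simp only [neg_mul, e2]
      linear_combination this

theorem F_eq (hQ0 : Q ≠ 0) (hΩ : IsParameterDomain Q Ω) {A B : ℂ → ℂ → ℂ}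
    (hA : IsPeriodic Q Ω A) (hB : IsPeriodic Q Ω B) {α0 α2 : ℂ} (h : (α0, α2) ∈ Ω) (n m : ℤ) :
    F Q A B α0 α2 n m =
      A α0 α2 * contigA (Q ^ 12) ((Q ^ 12) ^ (-m) * α2 ^ 12) ((Q ^ 12) ^ n * α0 ^ 12) +
      B α0 α2 * contigB (Q ^ 12) ((Q ^ 12) ^ (-m) * α2 ^ 12) ((Q ^ 12) ^ n * α0 ^ 12) := by
  have e0 : ((Q ^ 6) ^ 2 : ℂ) = Q ^ 12 := by ring
  have e1 : ∀ (n : ℤ), (Q ^ 6) ^ (2 * n) = (Q ^ 12) ^ n := fun n => by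
    rw [zpow_mul]
    norm_cast
    rw [← pow_mul]
  have hq : (Q ^ 12 : ℂ) ≠ 0 := pow_ne_zero _ hQ0
  have h2 : α2 ≠ 0 := (hΩ.generic _ _ h).ne_zero2
  have e2 : (α2 ^ 6 : ℂ) ^ (-2 : ℤ) = (α2 ^ 12)⁻¹ := by
    rw [zpow_neg]
    norm_cast
    rw [← pow_mul]
  have hk := zpow_ne_zero m hq
  unfold F contigA contigB
  simp only [basicHyp_eq_phi11, hA.eq hQ0 hΩ h, hB.eq hQ0 hΩ h, e0]
  rw [e2, show 2 * m + 2 = 2 * (m + 1) by ring, show -2 * m = 2 * (-m) by ring,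
    show 2 * n - 2 * m = 2 * (n - m) by ring, show 2 * (n - m) - 2 = 2 * (n - m - 1) by ring,
    show 2 * (-m) - 2 = 2 * (-m - 1) by ring, show 2 * m + 4 = 2 * (m + 2) by ring,
    show 2 * n + 2 = 2 * (n + 1) by ring]
  simp only [e1, ← pow_mul, Nat.reduceMul]
  have d1 : (α2 ^ 12)⁻¹ * (Q ^ 12) ^ (m + 1) = Q ^ 12 / ((Q ^ 12) ^ (-m) * α2 ^ 12) := by
    rw [zpow_add_one₀ hq, zpow_neg]
    field_simp
  have d2 : α2 ^ 12 * α0 ^ 12 * (Q ^ 12) ^ (n - m) =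
      (Q ^ 12) ^ (-m) * α2 ^ 12 * ((Q ^ 12) ^ n * α0 ^ 12) := by
    rw [zpow_sub₀ hq, zpow_neg]
    field_simp
  have d3 : α0 ^ 12 * α2 ^ 12 * (Q ^ 12) ^ (n - m - 1) =
      (Q ^ 12) ^ n * α0 ^ 12 * ((Q ^ 12) ^ (-m) * α2 ^ 12) / Q ^ 12 := by
    rw [zpow_sub_one₀ hq, zpow_sub₀ hq, zpow_neg]
    field_simp
  have d4 : α2 ^ 12 * (Q ^ 12) ^ (-m - 1) = (Q ^ 12) ^ (-m) * α2 ^ 12 / Q ^ 12 := by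
    rw [zpow_sub_one₀ hq]
    ring
  have d5 : (α2 ^ 12)⁻¹ * (Q ^ 12) ^ (m + 2) = (Q ^ 12) ^ 2 / ((Q ^ 12) ^ (-m) * α2 ^ 12) := by
    rw [zpow_add₀ hq, zpow_neg]
    norm_cast
    field_simp
  have d6 : α0 ^ 12 * (Q ^ 12) ^ (n + 1) = Q ^ 12 * ((Q ^ 12) ^ n * α0 ^ 12) := by
    rw [zpow_add_one₀ hq]
    ring
  rw [d1, d2, d3, d4, d5, d6, mul_comm (α2 ^ 12), mul_comm (α0 ^ 12) ((Q ^ 12) ^ n)]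
  ring_nf

theorem contig_F (hQ0 : Q ≠ 0) (hQ1 : ‖Q‖ < 1) (hΩ : IsParameterDomain Q Ω) {A B : ℂ → ℂ → ℂ}
    (hA : IsPeriodic Q Ω A) (hB : IsPeriodic Q Ω B) {α0 α2 : ℂ} (h : (α0, α2) ∈ Ω) :
    Contig (Q ^ 12) (α0 ^ 12) (Q ^ 12 / α2 ^ 12) (F Q A B α0 α2) := by
  have hp1 := norm_pow_twelve_lt_one hQ1
  have hp0 : (Q ^ 12 : ℂ) ≠ 0 := pow_ne_zero _ hQ0
  have hg := hΩ.generic _ _ h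
  have := (contig_contigA hp1 hp0 hg.notPow_two (α0 ^ 12)).combination
    (contig_contigB hp1 hp0 hg.notPow_two hg.notPow_zero) (A α0 α2) (B α0 α2)
  convert this using 3 with n m
  exact F_eq hQ0 hΩ hA hB h n m

/-- Cramer's rule at the points `(0, 0)` and `(0, -1)`, with the Casoratian as determinant, gives
the coefficients; `Contig.eq_zero` spreads the equality over the lattice. -/
theorem Contig.existsUnique_combination {p b x : ℂ} (hp1 : ‖p‖ < 1) (hp0 : p ≠ 0)
    (hb : NotPow p b) (hx : NotPow p x) (hbx : NotPow p (x * b)) {f : ℤ → ℤ → ℂ}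
    (hf : Contig p x (p / b) f) :
    ∃! c : ℂ × ℂ, ∀ n m, f n m = c.1 * contigA p (p ^ (-m) * b) (p ^ n * x) +
      c.2 * contigB p (p ^ (-m) * b) (p ^ n * x) := by
  have hW := casoratian_ne_zero hp1 hp0 hb hx hbx
  have hA := contig_contigA hp1 hp0 hb x
  have hB := contig_contigB hp1 hp0 hb hx
  set W := casoratian p b x with hWd
  rw [casoratian] at hWd
  refine ⟨((f 0 0 * contigB p (p * b) x - f 0 (-1) * contigB p b x) / W,
    (f 0 (-1) * contigA p b x - f 0 0 * contigA p (p * b) x) / W), ?_, ?_⟩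
  · intro n m
    have hc := hf.combination (hA.combination hB
      ((f 0 0 * contigB p (p * b) x - f 0 (-1) * contigB p b x) / W)
      ((f 0 (-1) * contigA p b x - f 0 0 * contigA p (p * b) x) / W)) 1 (-1)
    have h0 := hc.eq_zero hp0 hx.1 (div_ne_zero hp0 hb.1) (by
      simp only [neg_zero, zpow_zero, one_mul]
      field_simp
      rw [hWd]
      ring) (by
      simp only [neg_neg, zpow_zero, one_mul, zpow_one]
      field_simp
      rw [hWd]
      ring) n m
    linear_combination h0
  · rintro ⟨c, d⟩ h
    have h1 := h 0 0
    have h2 := h 0 (-1)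
    simp only [neg_zero, neg_neg, zpow_zero, one_mul, zpow_one] at h1 h2
    rw [h1, h2]
    ext
    · field_simp
      rw [hWd]
      ring
    · field_simp
      rw [hWd]
      ring

theorem isContiguous_iff_exists (hQ0 : Q ≠ 0) (hQ1 : ‖Q‖ < 1) (hΩ : IsParameterDomain Q Ω)
    (f : ℂ → ℂ → ℂ) : IsContiguous Q Ω f ↔
      ∃ A B : ℂ → ℂ → ℂ, IsPeriodic Q Ω A ∧ IsPeriodic Q Ω B ∧
        ∀ α0 α2, (α0, α2) ∈ Ω → ∀ n m : ℤ,
          f (Q ^ n * α0) (Q ^ (-m) * α2) = F Q A B α0 α2 n m := by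
  have hp1 := norm_pow_twelve_lt_one hQ1
  have hp0 : (Q ^ 12 : ℂ) ≠ 0 := pow_ne_zero _ hQ0
  rw [isContiguous_iff hQ0]
  constructor
  · intro h
    have key : ∀ a : ℂ × ℂ, a ∈ Ω → ∃! c : ℂ × ℂ, ∀ n m : ℤ,
        f (Q ^ n * a.1) (Q ^ (-m) * a.2) =
          c.1 * contigA (Q ^ 12) ((Q ^ 12) ^ (-m) * a.2 ^ 12) ((Q ^ 12) ^ n * a.1 ^ 12) +
          c.2 * contigB (Q ^ 12) ((Q ^ 12) ^ (-m) * a.2 ^ 12) ((Q ^ 12) ^ n * a.1 ^ 12) := by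
      rintro ⟨α0, α2⟩ hα
      have hg := hΩ.generic _ _ hα
      exact (h α0 α2 hα).existsUnique_combination hp1 hp0 hg.notPow_two hg.notPow_zero
        (hg.notPow_one hQ0)
    choose! c hc hu using key
    have hper : ∀ α0 α2, (α0, α2) ∈ Ω → ∀ n m : ℤ,
        c (Q ^ n * α0, Q ^ (-m) * α2) = c (α0, α2) := by
      intro α0 α2 hα n m
      -- Points of one lattice carry the same function up to a shift of the indices, so uniqueness
      -- forces equal coefficients.
      refine (hu _ (hΩ.shift _ _ hα n m) _ fun k l => ?_).symm
      have := hc _ hα (k + n) (l + m)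
      rw [zpow_add₀ hQ0, zpow_add₀ hp0, neg_add, zpow_add₀ hQ0, zpow_add₀ hp0] at this
      have e : ∀ (a : ℂ) (j : ℤ), (Q ^ j * a) ^ 12 = (Q ^ 12) ^ j * a ^ 12 := fun a j => by
        rw [mul_pow, ← zpow_natCast (Q ^ j), ← zpow_mul, mul_comm j, zpow_mul]
        norm_cast
      simp only [e]
      simpa only [mul_assoc] using this
    have hA : IsPeriodic Q Ω fun α0 α2 => (c (α0, α2)).1 :=
      isPeriodic_of_eq fun α0 α2 hα n m => by simp only [hper α0 α2 hα n m]
    have hB : IsPeriodic Q Ω fun α0 α2 => (c (α0, α2)).2 :=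
      isPeriodic_of_eq fun α0 α2 hα n m => by simp only [hper α0 α2 hα n m]
    refine ⟨_, _, hA, hB, fun α0 α2 hα n m => ?_⟩
    rw [F_eq hQ0 hΩ hA hB hα]
    exact hc _ hα n m
  · rintro ⟨A, B, hA, hB, h⟩ α0 α2 hα
    convert contig_F hQ0 hQ1 hΩ hA hB hα using 3 with n m
    exact h α0 α2 hα n m

end

end QP3

end

noncomputable section
open Matrix

namespace QP3

/-! ## Determinants -/

section Plucker

variable {R : Type*} [CommRing R]

/-- The determinant of the matrix with rows `a, b` and the rows `X`. -/
def bracket {k : ℕ} (X : Fin k → Fin (k + 2) → R) (a b : Fin (k + 2) → R) : R :=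
  det (of (vecCons a (vecCons b X)))

theorem bracket_swap {k : ℕ} (X : Fin k → Fin (k + 2) → R) (a b : Fin (k + 2) → R) :
    bracket X b a = -bracket X a b := by
  have h := (detRowAlternating (R := R) (n := Fin (k + 2))).map_swap
    (vecCons a (vecCons b X)) (i := 0) (j := 1) (by simp)
  have e : (vecCons a (vecCons b X)) ∘ Equiv.swap (0 : Fin (k + 2)) 1 = vecCons b (vecCons a X) := by
    funext i
    refine Fin.cases ?_ (fun i => Fin.cases ?_ (fun i => ?_) i) i
    · simp
    · simp
    · rw [Function.comp_apply, Equiv.swap_apply_of_ne_of_ne]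
      · simp
      · exact Fin.succ_ne_zero _
      · exact fun h => Fin.succ_ne_zero i (Fin.succ_injective _ h)
  rw [e] at h
  exact h

/-- Cramer's rule writes `det • c` as a combination of the rows `a`, `b` and `X i`, without
division. The linear form `v ↦ bracket X v d` kills every `X i`, and what remains is the relation.
-/
theorem bracket_plucker {k : ℕ} (X : Fin k → Fin (k + 2) → R) (a b c d : Fin (k + 2) → R) :
    bracket X a b * bracket X c d - bracket X a c * bracket X b d +
      bracket X a d * bracket X b c = 0 := by
  set A : Matrix (Fin (k + 2)) (Fin (k + 2)) R := of (vecCons a (vecCons b X)) with hA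
  let L := (detRowAlternating (R := R) (n := Fin (k + 2))).toMultilinearMap.toLinearMap
    (vecCons 0 (vecCons d X)) 0
  have hL : ∀ v, L v = bracket X v d := by
    intro v
    change det (Function.update (vecCons 0 (vecCons d X)) 0 v) = _
    unfold bracket
    congr 1
    funext i
    refine Fin.cases ?_ (fun i => ?_) i
    · rw [Function.update_self]; rfl
    · rw [Function.update_of_ne (Fin.succ_ne_zero i)]; rfl
  have hX : ∀ i, bracket X (X i) d = 0 := by
    intro i
    exact det_zero_of_row_eq (i := 0) (j := i.succ.succ) (Fin.succ_ne_zero _).symm rfl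
  have h : ∑ i, Aᵀ.cramer c i • (vecCons a (vecCons b X) : Fin (k + 2) → Fin (k + 2) → R) i =
      A.det • c := by
    have := mulVec_cramer Aᵀ c
    rwa [mulVec_transpose, vecMul_eq_sum, det_transpose] at this
  rw [Fin.sum_univ_succ, Fin.sum_univ_succ] at h
  simp only [cons_val_succ, cons_val_zero] at h
  have h2 := congrArg L h
  rw [map_add, map_add, map_sum, map_smul, map_smul, map_smul, Finset.sum_eq_zero (by
    intro i _
    rw [map_smul, hL, hX, smul_zero])] at h2
  simp only [hL, smul_eq_mul, cramer_transpose_apply, add_zero] at h2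
  have e0 : A.updateRow 0 c = of (vecCons c (vecCons b X)) := by
    ext i j
    refine Fin.cases ?_ (fun i => ?_) i
    · rw [updateRow_self]; rfl
    · rw [updateRow_ne (Fin.succ_ne_zero i)]; rfl
  have e1 : A.updateRow (Fin.succ 0) c = of (vecCons a (vecCons c X)) := by
    ext i j
    refine Fin.cases ?_ (fun i => Fin.cases ?_ (fun i => ?_) i) i
    · rw [updateRow_ne (Fin.succ_ne_zero _).symm]; rfl
    · rw [updateRow_self]; rfl
    · rw [updateRow_ne (fun h => Fin.succ_ne_zero i (Fin.succ_injective _ h))]; rfl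
  rw [e0, e1] at h2
  change bracket X c b * bracket X a d + bracket X a c * bracket X b d =
    bracket X a b * bracket X c d at h2
  rw [bracket_swap X b c] at h2
  linear_combination -h2

theorem det_snoc {k : ℕ} (X : Fin k → Fin (k + 1) → R) (b : Fin (k + 1) → R) :
    det (of (Fin.snoc (α := fun _ => Fin (k + 1) → R) X b)) = (-1) ^ k * det (of (vecCons b X)) := by
  rw [det_succ_row _ (Fin.last k), det_succ_row_zero, Finset.mul_sum]
  refine Finset.sum_congr rfl fun j _ => ?_
  have e : (of (Fin.snoc (α := fun _ => Fin (k + 1) → R) X b)).submatrix (Fin.last k).succAbove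
      j.succAbove = (of (vecCons b X)).submatrix Fin.succ j.succAbove := by
    ext i l
    simp
  rw [e]
  simp
  ring

theorem bracket_eq_snoc {k : ℕ} (X : Fin k → Fin (k + 2) → R) (a b : Fin (k + 2) → R) :
    bracket X a b =
      (-1) ^ k * det (of (vecCons a (Fin.snoc (α := fun _ => Fin (k + 2) → R) X b))) := by
  have e : vecCons a (Fin.snoc (α := fun _ => Fin (k + 2) → R) X b) =
      Fin.snoc (α := fun _ => Fin (k + 2) → R) (vecCons a X) b :=
    Fin.cons_snoc_eq_snoc_cons _ _ _
  have h : ((-1 : R) ^ k) * (-1) ^ k = 1 := by rw [← mul_pow]; simp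
  have h2 : det (of (vecCons b (vecCons a X))) = -bracket X a b := bracket_swap X a b
  rw [e, det_snoc, h2, pow_succ]
  linear_combination -bracket X a b * h

/-- The geometric row. -/
def geomRow (y : R) (k : ℕ) : Fin k → R := fun j => y ^ (j : ℕ)

/-- Subtracting `y` times the preceding column from each column turns the geometric row into `(1, 0,
..., 0)`. -/
theorem det_cons_geomRow {k : ℕ} (y : R) (X : Fin k → Fin (k + 1) → R) :
    det (of (vecCons (geomRow y (k + 1)) X)) =
      det (of fun i j => X i j.succ - y * X i j.castSucc) := by
  let B : Matrix (Fin (k + 1)) (Fin (k + 1)) R :=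
    of fun i => Fin.cases (vecCons (geomRow y (k + 1)) X i 0) fun j =>
      vecCons (geomRow y (k + 1)) X i j.succ - y * vecCons (geomRow y (k + 1)) X i j.castSucc
  rw [det_eq_of_forall_col_eq_smul_add_pred (B := B) (fun _ => y) (fun i => by simp [B])
    (fun i j => by simp [B]), det_succ_row_zero, Fin.sum_univ_succ, Finset.sum_eq_zero]
  · simp only [B, geomRow, of_apply, Fin.cases_zero, cons_val_zero, Fin.val_zero, pow_zero, one_mul,
      add_zero]
    congr 1
  · intro j _
    simp [B, geomRow, pow_succ']

theorem det_cons_single_zero {k : ℕ} (X : Fin k → Fin (k + 1) → R) :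
    det (of (vecCons (Pi.single 0 1) X)) = det (of fun i j => X i j.succ) := by
  rw [det_succ_row_zero, Fin.sum_univ_succ, Finset.sum_eq_zero]
  · simp only [of_apply, cons_val_zero, Fin.val_zero, pow_zero, one_mul, add_zero, Pi.single_eq_same]
    congr 1
  · intro j _
    simp

theorem det_cons_single_last {k : ℕ} (X : Fin k → Fin (k + 1) → R) :
    det (of (vecCons (Pi.single (Fin.last k) 1) X)) =
      (-1) ^ k * det (of fun i j => X i j.castSucc) := by
  rw [det_succ_row_zero, Fin.sum_univ_castSucc, Finset.sum_eq_zero]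
  · simp only [of_apply, cons_val_zero, Fin.val_last, zero_add, Pi.single_eq_same, mul_one]
    congr 2
    ext i j
    simp
  · intro j _
    simp

end Plucker

/-- The Toeplitz determinant with entries `f (n - i + j)`. -/
def toeplitz (f : ℤ → ℂ) (k : ℕ) (n : ℤ) : ℂ :=
  det (of fun i j : Fin k => f (n - ((i : ℕ) : ℤ) + ((j : ℕ) : ℤ)))

/-- Rows of a Toeplitz matrix. -/
def toeplitzRow (f : ℤ → ℂ) (k : ℕ) (n : ℤ) : Fin k → ℂ := fun j => f (n + ((j : ℕ) : ℤ))

/-- Consecutive rows of a Toeplitz matrix. -/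
def toeplitzRows (f : ℤ → ℂ) (l k : ℕ) (n : ℤ) : Fin l → Fin k → ℂ :=
  fun i => toeplitzRow f k (n - ((i : ℕ) : ℤ))

theorem cons_toeplitzRows (f : ℤ → ℂ) (l k : ℕ) (n : ℤ) :
    vecCons (toeplitzRow f k (n + 1)) (toeplitzRows f l k n) = toeplitzRows f (l + 1) k (n + 1) := by
  funext i
  refine Fin.cases ?_ (fun i => ?_) i
  · simp [toeplitzRows]
  · simp [toeplitzRows]

theorem snoc_toeplitzRows (f : ℤ → ℂ) (l k : ℕ) (n : ℤ) :
    Fin.snoc (α := fun _ => Fin k → ℂ) (toeplitzRows f l k n) (toeplitzRow f k (n - l)) =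
      toeplitzRows f (l + 1) k n := by
  funext i
  refine Fin.lastCases ?_ (fun i => ?_) i
  · simp [toeplitzRows]
  · simp [toeplitzRows]

theorem toeplitzRows_succ (f : ℤ → ℂ) (l k : ℕ) (n : ℤ) :
    (fun (i : Fin l) (j : Fin k) => toeplitzRows f l (k + 1) n i j.succ) =
      toeplitzRows f l k (n + 1) := by
  funext i j
  simp only [toeplitzRows, toeplitzRow, Fin.val_succ]
  congr 1
  push_cast
  ring

theorem toeplitzRows_castSucc (f : ℤ → ℂ) (l k : ℕ) (n : ℤ) :
    (fun (i : Fin l) (j : Fin k) => toeplitzRows f l (k + 1) n i j.castSucc) =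
      toeplitzRows f l k n := by
  funext i j
  simp only [toeplitzRows, toeplitzRow, Fin.val_castSucc]

theorem det_toeplitzRows (f : ℤ → ℂ) (k : ℕ) (n : ℤ) :
    det (of (toeplitzRows f k k n)) = toeplitz f k n := rfl

theorem toeplitz_one (f : ℤ → ℂ) (n : ℤ) : toeplitz f 1 n = f n := by simp [toeplitz]

end QP3

end

noncomputable section
open Matrix

namespace QP3

/-! ## Bilinear relations of Toeplitz determinants -/

section

variable {p x y : ℂ} {f : ℤ → ℤ → ℂ} {k : ℕ}

/-- The Toeplitz determinants of a function on the lattice. -/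
def latticeToeplitz (f : ℤ → ℤ → ℂ) (k : ℕ) (n m : ℤ) : ℂ := toeplitz (fun l => f l m) k n

/-- An entrywise weight `c p^(s - i + j)` splits into a row weight and a column weight; pairing row
`i` with column `i` gives `c p^s` each time. -/
theorem prod_toeplitz_weights (hp0 : p ≠ 0) (c : ℂ) (s : ℤ) (k : ℕ) :
    (∏ i : Fin k, (c * p ^ (s - ((i : ℕ) : ℤ)))) * ∏ j : Fin k, p ^ (j : ℕ) = (c * p ^ s) ^ k := by
  rw [← Finset.prod_mul_distrib]
  have : ∀ i : Fin k, c * p ^ (s - ((i : ℕ) : ℤ)) * p ^ (i : ℕ) = c * p ^ s := fun i => by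
    rw [zpow_sub₀ hp0, zpow_natCast]
    have := pow_ne_zero (i : ℕ) hp0
    field_simp
  simp [this]

/-- Differences of adjacent columns are, by `Contig.right`, weighted entries at level `m - 1`. In
the next lemma the ratio `y p^m` makes the column operation coincide with `Contig.up`, which leads
to level `m + 1` without weights. -/
theorem Contig.det_cons_one (hp0 : p ≠ 0) (hf : Contig p x y f) (k : ℕ) (s m : ℤ) :
    det (of (vecCons (geomRow 1 (k + 1)) (toeplitzRows (fun l => f l m) k (k + 1) s))) =
      (-x * p ^ s) ^ k * latticeToeplitz f k s (m - 1) := by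
  have e : (of fun (i j : Fin k) => toeplitzRows (fun l => f l m) k (k + 1) s i j.succ -
      1 * toeplitzRows (fun l => f l m) k (k + 1) s i j.castSucc) =
      of fun i j : Fin k => (-x * p ^ (s - ((i : ℕ) : ℤ))) * (of fun (i j : Fin k) => p ^ (j : ℕ) *
        (of fun i j : Fin k => f (s - ((i : ℕ) : ℤ) + ((j : ℕ) : ℤ)) (m - 1)) i j) i j := by
    ext i j
    simp only [toeplitzRows, toeplitzRow, of_apply, Fin.val_succ, Fin.val_castSucc]
    have h := hf.right (s - ((i : ℕ) : ℤ) + ((j : ℕ) : ℤ)) m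
    rw [zpow_add₀ hp0, zpow_natCast] at h
    push_cast
    rw [← add_assoc, h]
    ring
  rw [det_cons_geomRow, e, det_mul_column, det_mul_row, ← mul_assoc, prod_toeplitz_weights hp0]
  rfl

theorem Contig.det_cons_geomRow (hf : Contig p x y f) (k : ℕ) (s m : ℤ) :
    det (of (vecCons (geomRow (y * p ^ m) (k + 1))
      (toeplitzRows (fun l => f l m) k (k + 1) s))) = latticeToeplitz f k (s + 1) (m + 1) := by
  rw [QP3.det_cons_geomRow]
  unfold latticeToeplitz toeplitz
  congr 1
  ext i j
  simp only [toeplitzRows, toeplitzRow, of_apply, Fin.val_succ, Fin.val_castSucc]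
  have h := hf.up (s + 1 - ((i : ℕ) : ℤ) + ((j : ℕ) : ℤ)) m
  rw [h]
  congr 2
  · push_cast; ring
  · congr 1; ring

/-- The row of ones is removed first. This multiplies the other geometric row by `y p^m - 1` and
moves the Toeplitz rows down to level `m - 1`. The column weights `p^j` come out of all rows, which
lowers the geometric ratio to `y p^(m-1)`, just what is needed to return to level `m`. -/
theorem Contig.bracket_one_geomRow (hp0 : p ≠ 0) (hf : Contig p x y f) (k : ℕ) (s m : ℤ) :
    bracket (toeplitzRows (fun l => f l m) k (k + 2) s) (geomRow 1 (k + 2))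
        (geomRow (y * p ^ m) (k + 2)) =
      (y * p ^ m - 1) * (-x * p ^ (s + 1)) ^ k * latticeToeplitz f k (s + 1) m := by
  have hf' := hf.det_cons_geomRow k s (m - 1)
  rw [sub_add_cancel] at hf'
  have e : (of fun (i j : Fin (k + 1)) =>
      (vecCons (geomRow (y * p ^ m) (k + 2)) (toeplitzRows (fun l => f l m) k (k + 2) s) :
        Fin (k + 1) → Fin (k + 2) → ℂ) i j.succ - 1 *
      (vecCons (geomRow (y * p ^ m) (k + 2)) (toeplitzRows (fun l => f l m) k (k + 2) s) :
        Fin (k + 1) → Fin (k + 2) → ℂ) i j.castSucc) =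
      of fun i j : Fin (k + 1) =>
        (vecCons (y * p ^ m - 1) (fun i : Fin k => -x * p ^ (s - ((i : ℕ) : ℤ))) :
          Fin (k + 1) → ℂ) i *
        (of fun (i j : Fin (k + 1)) => p ^ (j : ℕ) * (of (vecCons (geomRow (y * p ^ (m - 1)) (k + 1))
          (toeplitzRows (fun l => f l (m - 1)) k (k + 1) s))) i j) i j := by
    ext i j
    refine Fin.cases ?_ (fun i => ?_) i
    · simp only [of_apply, cons_val_zero, geomRow, Fin.val_succ, Fin.val_castSucc]
      rw [← mul_pow, show p * (y * p ^ (m - 1)) = y * p ^ m by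
        rw [zpow_sub_one₀ hp0]; field_simp]
      ring
    · simp only [of_apply, cons_val_succ, toeplitzRows, toeplitzRow, Fin.val_succ,
        Fin.val_castSucc]
      have h := hf.right (s - ((i : ℕ) : ℤ) + ((j : ℕ) : ℤ)) m
      rw [zpow_add₀ hp0, zpow_natCast] at h
      push_cast
      rw [← add_assoc, h]
      ring
  unfold bracket
  rw [QP3.det_cons_geomRow, e, det_mul_column, det_mul_row, hf', Fin.prod_univ_succ,
    Fin.prod_univ_succ]
  simp only [cons_val_zero, cons_val_succ, Fin.val_zero, pow_zero, one_mul, Fin.val_succ, pow_succ,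
    Finset.prod_mul_distrib, Finset.prod_const, Finset.card_univ, Fintype.card_fin]
  have h := prod_toeplitz_weights hp0 1 s k
  simp only [one_mul] at h
  rw [zpow_add_one₀ hp0, mul_pow, mul_pow, ← h]
  ring

theorem bracket_toeplitzRow_prev (g : Fin (k + 2) → ℂ) (h : ℤ → ℂ) (s : ℤ) :
    bracket (toeplitzRows h k (k + 2) s) g (toeplitzRow h (k + 2) (s + 1)) =
      det (of (vecCons g (toeplitzRows h (k + 1) (k + 2) (s + 1)))) := by
  rw [bracket, cons_toeplitzRows]

theorem bracket_toeplitzRow_next (g : Fin (k + 2) → ℂ) (h : ℤ → ℂ) (s : ℤ) :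
    bracket (toeplitzRows h k (k + 2) s) g (toeplitzRow h (k + 2) (s - k)) =
      (-1) ^ k * det (of (vecCons g (toeplitzRows h (k + 1) (k + 2) s))) := by
  rw [bracket_eq_snoc, snoc_toeplitzRows]

theorem bracket_prev_next (h : ℤ → ℂ) (s : ℤ) :
    bracket (toeplitzRows h k (k + 2) s) (toeplitzRow h (k + 2) (s + 1))
      (toeplitzRow h (k + 2) (s - k)) = (-1) ^ k * toeplitz h (k + 2) (s + 1) := by
  rw [bracket_eq_snoc, snoc_toeplitzRows, cons_toeplitzRows, det_toeplitzRows]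

theorem bracket_first (g : Fin (k + 2) → ℂ) (h : ℤ → ℂ) (s : ℤ) :
    bracket (toeplitzRows h k (k + 2) s) (Pi.single 0 1) g =
      det (of (vecCons (fun j => g j.succ) (toeplitzRows h k (k + 1) (s + 1)))) := by
  rw [bracket, det_cons_single_zero, ← toeplitzRows_succ]
  congr 2
  funext i
  refine Fin.cases ?_ (fun i => ?_) i <;> rfl

theorem bracket_last (g : Fin (k + 2) → ℂ) (h : ℤ → ℂ) (s : ℤ) :
    bracket (toeplitzRows h k (k + 2) s) (Pi.single (Fin.last (k + 1)) 1) g =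
      -(-1) ^ k * det (of (vecCons (fun j => g j.castSucc) (toeplitzRows h k (k + 1) s))) := by
  rw [bracket, det_cons_single_last, ← toeplitzRows_castSucc, pow_succ, mul_neg_one]
  congr 3
  funext i
  refine Fin.cases ?_ (fun i => ?_) i <;> rfl

theorem det_cons_single_zero_toeplitzRows (h : ℤ → ℂ) (s : ℤ) :
    det (of (vecCons (Pi.single 0 1) (toeplitzRows h k (k + 1) s))) = toeplitz h k (s + 1) := by
  rw [det_cons_single_zero, toeplitzRows_succ, det_toeplitzRows]

theorem det_cons_single_last_toeplitzRows (h : ℤ → ℂ) (s : ℤ) :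
    det (of (vecCons (Pi.single (Fin.last k) 1) (toeplitzRows h k (k + 1) s))) =
      (-1) ^ k * toeplitz h k s := by
  rw [det_cons_single_last, toeplitzRows_castSucc, det_toeplitzRows]

theorem bracket_first_last (h : ℤ → ℂ) (s : ℤ) :
    bracket (toeplitzRows h k (k + 2) s) (Pi.single 0 1) (Pi.single (Fin.last (k + 1)) 1) =
      (-1) ^ k * toeplitz h k (s + 1) := by
  have e : (fun j : Fin (k + 1) => (Pi.single (Fin.last (k + 1)) 1 : Fin (k + 2) → ℂ) j.succ) =
      Pi.single (Fin.last k) 1 := by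
    funext j
    simp only [Pi.single_apply, ← Fin.succ_last, Fin.succ_inj]
  rw [bracket_first, e, det_cons_single_last_toeplitzRows]

theorem geomRow_castSucc (c : ℂ) (k : ℕ) :
    (fun j : Fin k => geomRow c (k + 1) j.castSucc) = geomRow c k := rfl

theorem geomRow_one_succ (k : ℕ) :
    (fun j : Fin k => geomRow (1 : ℂ) (k + 1) j.succ) = geomRow 1 k := by
  funext j
  simp [geomRow]

theorem det_cons_geomRow_succ (c : ℂ) (X : Fin k → Fin (k + 1) → ℂ) :
    det (of (vecCons (fun j : Fin (k + 1) => geomRow c (k + 2) j.succ) X)) =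
      c * det (of (vecCons (geomRow c (k + 1)) X)) := by
  have := det_updateRow_smul (of (vecCons (geomRow c (k + 1)) X)) 0 c (geomRow c (k + 1))
  have e : ∀ v, (of (vecCons (geomRow c (k + 1)) X)).updateRow 0 v = of (vecCons v X) := by
    intro v
    ext i j
    refine Fin.cases ?_ (fun i => ?_) i
    · rw [updateRow_self]; rfl
    · rw [updateRow_ne (Fin.succ_ne_zero i)]; rfl
  rw [e, e] at this
  rw [← this]
  congr 3
  funext j
  simp [geomRow, pow_succ']

end

/-! ### Rhombus and Toda relations as Plücker relations -/

section

variable {p x y : ℂ} {f : ℤ → ℤ → ℂ}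

local notation "T" => latticeToeplitz f

theorem neg_one_pow_mul_self (k : ℕ) : ((-1 : ℂ) ^ k) * (-1) ^ k = 1 := by
  rw [← mul_pow]; simp

variable (f) in
/-- The values of the brackets that do not involve a geometric row. -/
theorem bracket_units (k : ℕ) (s m : ℤ) :
    let X := toeplitzRows (fun l => f l m) k (k + 2) s
    let a := toeplitzRow (fun l => f l m) (k + 2) (s + 1)
    let z := toeplitzRow (fun l => f l m) (k + 2) (s - k)
    let e : Fin (k + 2) → ℂ := Pi.single 0 1
    let l : Fin (k + 2) → ℂ := Pi.single (Fin.last (k + 1)) 1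
    bracket X e a = T (k + 1) (s + 2) m ∧ bracket X e z = (-1) ^ k * T (k + 1) (s + 1) m ∧
    bracket X l a = -(-1) ^ k * T (k + 1) (s + 1) m ∧ bracket X l z = -T (k + 1) s m ∧
    bracket X a z = (-1) ^ k * T (k + 2) (s + 1) m ∧ bracket X e l = (-1) ^ k * T k (s + 1) m := by
  intro X a z e l
  refine ⟨?_, ?_, ?_, ?_, bracket_prev_next _ _, bracket_first_last _ _⟩
  · rw [bracket_toeplitzRow_prev, det_cons_single_zero_toeplitzRows, add_assoc]
    rfl
  · rw [bracket_toeplitzRow_next, det_cons_single_zero_toeplitzRows]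
    rfl
  · rw [bracket_toeplitzRow_prev, det_cons_single_last_toeplitzRows, pow_succ, mul_neg_one]
    rfl
  · rw [bracket_toeplitzRow_next, det_cons_single_last_toeplitzRows, pow_succ, ← mul_assoc,
      ← mul_assoc, neg_one_pow_mul_self, one_mul, neg_one_mul]
    rfl

/-- The values of the brackets with the row `1, 1, …`. -/
theorem Contig.bracket_one (hp0 : p ≠ 0) (hf : Contig p x y f) (k : ℕ) (s m : ℤ) :
    let X := toeplitzRows (fun l => f l m) k (k + 2) s
    let a := toeplitzRow (fun l => f l m) (k + 2) (s + 1)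
    let z := toeplitzRow (fun l => f l m) (k + 2) (s - k)
    let e : Fin (k + 2) → ℂ := Pi.single 0 1
    let l : Fin (k + 2) → ℂ := Pi.single (Fin.last (k + 1)) 1
    let g : Fin (k + 2) → ℂ := geomRow 1 (k + 2)
    bracket X g a = (-x * p ^ (s + 1)) ^ (k + 1) * T (k + 1) (s + 1) (m - 1) ∧
    bracket X g z = (-1) ^ k * ((-x * p ^ s) ^ (k + 1) * T (k + 1) s (m - 1)) ∧
    bracket X e g = (-x * p ^ (s + 1)) ^ k * T k (s + 1) (m - 1) ∧
    bracket X l g = -(-1) ^ k * ((-x * p ^ s) ^ k * T k s (m - 1)) := by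
  intro X a z e l g
  refine ⟨?_, ?_, ?_, ?_⟩
  · rw [bracket_toeplitzRow_prev, hf.det_cons_one hp0]
  · rw [bracket_toeplitzRow_next, hf.det_cons_one hp0]
  · rw [bracket_first, geomRow_one_succ, hf.det_cons_one hp0]
  · rw [bracket_last, geomRow_castSucc, hf.det_cons_one hp0]

/-- The values of the brackets with the row `1, Y, Y ^ 2, …`. -/
theorem Contig.bracket_geomRow (hf : Contig p x y f) (k : ℕ) (s m : ℤ) :
    let X := toeplitzRows (fun l => f l m) k (k + 2) s
    let a := toeplitzRow (fun l => f l m) (k + 2) (s + 1)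
    let z := toeplitzRow (fun l => f l m) (k + 2) (s - k)
    let e : Fin (k + 2) → ℂ := Pi.single 0 1
    let l : Fin (k + 2) → ℂ := Pi.single (Fin.last (k + 1)) 1
    let g : Fin (k + 2) → ℂ := geomRow (y * p ^ m) (k + 2)
    bracket X g a = T (k + 1) (s + 2) (m + 1) ∧
    bracket X g z = (-1) ^ k * T (k + 1) (s + 1) (m + 1) ∧
    bracket X e g = y * p ^ m * T k (s + 2) (m + 1) ∧
    bracket X l g = -(-1) ^ k * T k (s + 1) (m + 1) := by
  intro X a z e l g
  refine ⟨?_, ?_, ?_, ?_⟩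
  · rw [bracket_toeplitzRow_prev, hf.det_cons_geomRow, add_assoc]
    rfl
  · rw [bracket_toeplitzRow_next, hf.det_cons_geomRow]
  · rw [bracket_first, det_cons_geomRow_succ, hf.det_cons_geomRow, add_assoc]
    rfl
  · rw [bracket_last, geomRow_castSucc, hf.det_cons_geomRow]

variable (hp0 : p ≠ 0) (hx : x ≠ 0) (hf : Contig p x y f) (k : ℕ) (n m : ℤ)
include hp0 hf

-- The Plücker relations below use four of six extra rows: the Toeplitz rows before and after `X`,
-- the first and last unit vectors, and the geometric rows of ratio `1` and `y p^m`. The names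
-- `zero`, `one`, `two` refer to the reflection served; unprimed and primed versions give the two
-- halves of `RhombusRel`.
omit hp0 in
theorem Contig.rhombus_zero :
    T (k + 1) n (m + 1) * T k n m - T k n (m + 1) * T (k + 1) n m +
      y * p ^ m * T k (n + 1) (m + 1) * T (k + 1) (n - 1) m = 0 := by
  obtain ⟨ea, ez, la, lz, az, el⟩ := bracket_units f k (n - 1) m
  obtain ⟨ga, gz, eg, lg⟩ := hf.bracket_geomRow k (n - 1) m
  have h := bracket_plucker (toeplitzRows (fun l => f l m) k (k + 2) (n - 1))
    (geomRow (y * p ^ m) (k + 2)) (toeplitzRow (fun l => f l m) (k + 2) (n - 1 - k))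
    (Pi.single 0 1) (Pi.single (Fin.last (k + 1)) 1)
  rw [bracket_swap _ (Pi.single 0 1) (geomRow _ _),
    bracket_swap _ (Pi.single (Fin.last (k + 1)) 1) (geomRow _ _),
    bracket_swap _ (Pi.single 0 1) (toeplitzRow _ _ _),
    bracket_swap _ (Pi.single (Fin.last (k + 1)) 1) (toeplitzRow _ _ _),
    gz, el, eg, lz, lg, ez] at h
  rw [show n - 1 + 1 = n by ring, show n - 1 + 2 = n + 1 by ring] at h
  linear_combination h + (T k n (m + 1) * T (k + 1) n m - T (k + 1) n (m + 1) * T k n m) *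
    neg_one_pow_mul_self k

omit hp0 in
theorem Contig.rhombus_one :
    T (k + 1) n (m + 1) * T k (n - 1) m + y * p ^ m * T k n (m + 1) * T (k + 1) (n - 1) m -
      T k (n - 1) (m + 1) * T (k + 1) n m = 0 := by
  obtain ⟨ea, ez, la, lz, az, el⟩ := bracket_units f k (n - 2) m
  obtain ⟨ga, gz, eg, lg⟩ := hf.bracket_geomRow k (n - 2) m
  have h := bracket_plucker (toeplitzRows (fun l => f l m) k (k + 2) (n - 2))
    (geomRow (y * p ^ m) (k + 2)) (toeplitzRow (fun l => f l m) (k + 2) (n - 2 + 1))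
    (Pi.single 0 1) (Pi.single (Fin.last (k + 1)) 1)
  rw [bracket_swap _ (Pi.single 0 1) (geomRow _ _),
    bracket_swap _ (Pi.single (Fin.last (k + 1)) 1) (geomRow _ _),
    bracket_swap _ (Pi.single 0 1) (toeplitzRow _ _ _),
    bracket_swap _ (Pi.single (Fin.last (k + 1)) 1) (toeplitzRow _ _ _),
    ga, el, eg, la, lg, ea] at h
  rw [show n - 2 + 1 = n - 1 by ring, show n - 2 + 2 = n by ring] at h
  refine (mul_eq_zero_iff_left (a := (-1 : ℂ) ^ k)
    (pow_ne_zero _ (by norm_num))).1 ?_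
  linear_combination h

include hx in
theorem Contig.rhombus_zero' :
    p ^ k * T k n m * T (k + 1) n (m + 1) - x * p ^ (n + k) * T (k + 1) n m * T k n (m + 1) -
      T k (n - 1) m * T (k + 1) (n + 1) (m + 1) = 0 := by
  obtain ⟨ea, ez, la, lz, az, el⟩ := bracket_units f k (n - 1) (m + 1)
  obtain ⟨ga, gz, eg, lg⟩ := hf.bracket_one hp0 k (n - 1) (m + 1)
  have h := bracket_plucker (toeplitzRows (fun l => f l (m + 1)) k (k + 2) (n - 1))
    (geomRow 1 (k + 2)) (toeplitzRow (fun l => f l (m + 1)) (k + 2) (n - 1 + 1))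
    (Pi.single 0 1) (Pi.single (Fin.last (k + 1)) 1)
  rw [bracket_swap _ (Pi.single 0 1) (geomRow _ _),
    bracket_swap _ (Pi.single (Fin.last (k + 1)) 1) (geomRow _ _),
    bracket_swap _ (Pi.single 0 1) (toeplitzRow _ _ _),
    bracket_swap _ (Pi.single (Fin.last (k + 1)) 1) (toeplitzRow _ _ _),
    ga, el, eg, la, lg, ea] at h
  have hpn := zpow_ne_zero n hp0
  rw [show n - 1 + 2 = n + 1 by ring, show n - 1 + 1 = n by ring, add_sub_cancel_right,
    zpow_sub_one₀ hp0] at h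
  rw [zpow_add₀ hp0, zpow_natCast]
  -- The row weights at `n` and `n - 1` are expressed by those at `n - 1`; their common power is
  -- then cancelled.
  refine (mul_eq_zero_iff_left (a := (-1 : ℂ) ^ k * (-x * (p ^ n * p⁻¹)) ^ k)
    (mul_ne_zero (pow_ne_zero _ (by norm_num)) (pow_ne_zero _ (by simp [hx, hpn, hp0])))).1 ?_
  have e : (-x * p ^ n) ^ k = (-x * (p ^ n * p⁻¹)) ^ k * p ^ k := by
    rw [← mul_pow]; congr 1; field_simp
  rw [pow_succ, e] at h
  linear_combination h

include hx in
theorem Contig.rhombus_one' :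
    p ^ k * T k n m * T (k + 1) (n - 1) (m + 1) -
      x * p ^ (n - 1) * T (k + 1) (n - 1) m * T k n (m + 1) -
      T k (n - 1) m * T (k + 1) n (m + 1) = 0 := by
  obtain ⟨ea, ez, la, lz, az, el⟩ := bracket_units f k (n - 1) (m + 1)
  obtain ⟨ga, gz, eg, lg⟩ := hf.bracket_one hp0 k (n - 1) (m + 1)
  have h := bracket_plucker (toeplitzRows (fun l => f l (m + 1)) k (k + 2) (n - 1))
    (geomRow 1 (k + 2)) (toeplitzRow (fun l => f l (m + 1)) (k + 2) (n - 1 - k))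
    (Pi.single 0 1) (Pi.single (Fin.last (k + 1)) 1)
  rw [bracket_swap _ (Pi.single 0 1) (geomRow _ _),
    bracket_swap _ (Pi.single (Fin.last (k + 1)) 1) (geomRow _ _),
    bracket_swap _ (Pi.single 0 1) (toeplitzRow _ _ _),
    bracket_swap _ (Pi.single (Fin.last (k + 1)) 1) (toeplitzRow _ _ _),
    gz, el, eg, lz, lg, ez] at h
  have hpn := zpow_ne_zero n hp0
  rw [show n - 1 + 1 = n by ring, add_sub_cancel_right, zpow_sub_one₀ hp0] at h
  rw [zpow_sub_one₀ hp0]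
  refine (mul_eq_zero_iff_left (a := (-x * (p ^ n * p⁻¹)) ^ k)
    (pow_ne_zero _ (by simp [hx, hpn, hp0]))).1 ?_
  have e : (-x * p ^ n) ^ k = (-x * (p ^ n * p⁻¹)) ^ k * p ^ k := by
    rw [← mul_pow]; congr 1; field_simp
  rw [pow_succ, e] at h
  have h1 := neg_one_pow_mul_self k
  generalize (-x * (p ^ n * p⁻¹)) ^ k = c at *
  linear_combination h + (c * x * p ^ n * p⁻¹ * T (k + 1) (n - 1) m * T k n (m + 1) +
    c * T k (n - 1) m * T (k + 1) n (m + 1)) * h1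

-- With both geometric rows present, one Plücker relation involves the levels `m - 1`, `m` and `m +
-- 1`. This lemma and its companion are two linear equations for the same two products of levels `m
-- - 1` and `m + 1`.
include hx in
theorem Contig.rhombus_two_aux :
    (1 - y * p ^ m) * p ^ k * T k n m * T (k + 1) (n - 1) m -
      T k (n - 1) (m - 1) * T (k + 1) n (m + 1) -
      x * p ^ (n - 1) * T (k + 1) (n - 1) (m - 1) * T k n (m + 1) = 0 := by
  obtain ⟨ea, ez, la, lz, az, el⟩ := bracket_units f k (n - 1) m
  obtain ⟨ga, gz, eg, lg⟩ := hf.bracket_one hp0 k (n - 1) m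
  obtain ⟨wa, wz, ew, lw⟩ := hf.bracket_geomRow k (n - 1) m
  have gw := hf.bracket_one_geomRow hp0 k (n - 1) m
  have h := bracket_plucker (toeplitzRows (fun l => f l m) k (k + 2) (n - 1))
    (geomRow 1 (k + 2)) (geomRow (y * p ^ m) (k + 2)) (Pi.single (Fin.last (k + 1)) 1)
    (toeplitzRow (fun l => f l m) (k + 2) (n - 1 - k))
  rw [bracket_swap _ (Pi.single (Fin.last (k + 1)) 1) (geomRow 1 _),
    bracket_swap _ (Pi.single (Fin.last (k + 1)) 1) (geomRow (y * p ^ m) _),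
    gw, lz, lg, wz, gz, lw] at h
  have hpn := zpow_ne_zero n hp0
  rw [show n - 1 + 1 = n by ring, zpow_sub_one₀ hp0] at h
  rw [zpow_sub_one₀ hp0]
  refine (mul_eq_zero_iff_left (a := (-x * (p ^ n * p⁻¹)) ^ k)
    (pow_ne_zero _ (by simp [hx, hpn, hp0]))).1 ?_
  have e : (-x * p ^ n) ^ k = (-x * (p ^ n * p⁻¹)) ^ k * p ^ k := by
    rw [← mul_pow]; congr 1; field_simp
  rw [pow_succ, e] at h
  have h1 := neg_one_pow_mul_self k
  generalize (-x * (p ^ n * p⁻¹)) ^ k = c at *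
  linear_combination h + (c * x * p ^ n * p⁻¹ * T (k + 1) (n - 1) (m - 1) * T k n (m + 1) +
    c * T k (n - 1) (m - 1) * T (k + 1) n (m + 1)) * h1

include hx in
theorem Contig.rhombus_two_aux' :
    (y * p ^ m - 1) * T k (n - 1) m * T (k + 1) n m +
      T k (n - 1) (m - 1) * T (k + 1) n (m + 1) +
      x * p ^ (n - 1) * (y * p ^ m) * T (k + 1) (n - 1) (m - 1) * T k n (m + 1) = 0 := by
  obtain ⟨ea, ez, la, lz, az, el⟩ := bracket_units f k (n - 2) m
  obtain ⟨ga, gz, eg, lg⟩ := hf.bracket_one hp0 k (n - 2) m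
  obtain ⟨wa, wz, ew, lw⟩ := hf.bracket_geomRow k (n - 2) m
  have gw := hf.bracket_one_geomRow hp0 k (n - 2) m
  have h := bracket_plucker (toeplitzRows (fun l => f l m) k (k + 2) (n - 2))
    (geomRow 1 (k + 2)) (geomRow (y * p ^ m) (k + 2)) (Pi.single 0 1)
    (toeplitzRow (fun l => f l m) (k + 2) (n - 2 + 1))
  rw [bracket_swap _ (Pi.single 0 1) (geomRow 1 _),
    bracket_swap _ (Pi.single 0 1) (geomRow (y * p ^ m) _), gw, ea, eg, wa, ga, ew] at h
  rw [show n - 2 + 1 = n - 1 by ring, show n - 2 + 2 = n by ring] at h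
  refine (mul_eq_zero_iff_left (a := (-x * p ^ (n - 1)) ^ k)
    (pow_ne_zero _ (by simp [hx, zpow_ne_zero _ hp0]))).1 ?_
  rw [pow_succ] at h
  linear_combination h

-- The linear system of the two auxiliary relations has determinant `y p^m - 1` up to sign, whence
-- the condition `hy`.
include hx in
theorem Contig.rhombus_two (hy : y * p ^ m ≠ 1) :
    T k (n - 1) (m - 1) * T (k + 1) n (m + 1) = T k (n - 1) m * T (k + 1) n m -
      y * p ^ (m + k) * T k n m * T (k + 1) (n - 1) m := by
  have h1 := hf.rhombus_two_aux hp0 hx k n m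
  have h2 := hf.rhombus_two_aux' hp0 hx k n m
  rw [zpow_add₀ hp0, zpow_natCast]
  refine mul_left_cancel₀ (sub_ne_zero.2 hy) ?_
  linear_combination -(y * p ^ m * h1) - h2

include hx in
theorem Contig.rhombus_two' (hy : y * p ^ m ≠ 1) :
    x * p ^ (n - 1) * T (k + 1) (n - 1) (m - 1) * T k n (m + 1) =
      p ^ k * T k n m * T (k + 1) (n - 1) m - T k (n - 1) m * T (k + 1) n m := by
  have h1 := hf.rhombus_two_aux hp0 hx k n m
  have h2 := hf.rhombus_two_aux' hp0 hx k n m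
  refine mul_left_cancel₀ (sub_ne_zero.2 hy) ?_
  linear_combination h1 + h2

-- Using both Toeplitz neighbours of `X` produces a determinant of size `k + 2`. The two letters in
-- the name are the triangle vertices at which the determinants of sizes `k + 2` and `k` sit.
include hx in
theorem Contig.toda_zy :
    p ^ k * T k n m * T (k + 2) n (m + 1) = x * p ^ (n - 1) *
      (p ^ (k + 1) * T (k + 1) n m * T (k + 1) n (m + 1) -
        T (k + 1) (n - 1) m * T (k + 1) (n + 1) (m + 1)) := by
  obtain ⟨ea, ez, la, lz, az, el⟩ := bracket_units f k (n - 1) (m + 1)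
  obtain ⟨ga, gz, eg, lg⟩ := hf.bracket_one hp0 k (n - 1) (m + 1)
  have h := bracket_plucker (toeplitzRows (fun l => f l (m + 1)) k (k + 2) (n - 1))
    (geomRow 1 (k + 2)) (Pi.single 0 1) (toeplitzRow (fun l => f l (m + 1)) (k + 2) (n - 1 + 1))
    (toeplitzRow (fun l => f l (m + 1)) (k + 2) (n - 1 - k))
  rw [bracket_swap _ (Pi.single 0 1) (geomRow _ _), eg, az, ga, ez, gz, ea] at h
  have hpn := zpow_ne_zero n hp0
  rw [show n - 1 + 2 = n + 1 by ring, show n - 1 + 1 = n by ring, add_sub_cancel_right,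
    zpow_sub_one₀ hp0] at h
  rw [zpow_sub_one₀ hp0, ← sub_eq_zero]
  refine (mul_eq_zero_iff_left (a := (-1 : ℂ) ^ k * (-x * (p ^ n * p⁻¹)) ^ k)
    (mul_ne_zero (pow_ne_zero _ (by norm_num)) (pow_ne_zero _ (by simp [hx, hpn, hp0])))).1 ?_
  have e : (-x * p ^ n) ^ k = (-x * (p ^ n * p⁻¹)) ^ k * p ^ k := by
    rw [← mul_pow]; congr 1; field_simp
  have e' : (-x * p ^ n) ^ (k + 1) = (-x * (p ^ n * p⁻¹)) ^ (k + 1) * p ^ (k + 1) := by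
    rw [← mul_pow]; congr 1; field_simp
  rw [e, e', pow_succ (-x * _)] at h
  linear_combination -h

include hx in
theorem Contig.toda_zx :
    T k (n - 1) m * T (k + 2) n (m + 1) = x * p ^ (n - 1) *
      (p ^ (k + 1) * T (k + 1) n m * T (k + 1) (n - 1) (m + 1) -
        T (k + 1) (n - 1) m * T (k + 1) n (m + 1)) := by
  obtain ⟨ea, ez, la, lz, az, el⟩ := bracket_units f k (n - 1) (m + 1)
  obtain ⟨ga, gz, eg, lg⟩ := hf.bracket_one hp0 k (n - 1) (m + 1)
  have h := bracket_plucker (toeplitzRows (fun l => f l (m + 1)) k (k + 2) (n - 1))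
    (geomRow 1 (k + 2)) (Pi.single (Fin.last (k + 1)) 1)
    (toeplitzRow (fun l => f l (m + 1)) (k + 2) (n - 1 + 1))
    (toeplitzRow (fun l => f l (m + 1)) (k + 2) (n - 1 - k))
  rw [bracket_swap _ (Pi.single (Fin.last (k + 1)) 1) (geomRow _ _), lg, az, ga, lz, gz, la] at h
  have hpn := zpow_ne_zero n hp0
  rw [show n - 1 + 1 = n by ring, add_sub_cancel_right, zpow_sub_one₀ hp0] at h
  rw [zpow_sub_one₀ hp0, ← sub_eq_zero]
  refine (mul_eq_zero_iff_left (a := (-x * (p ^ n * p⁻¹)) ^ k)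
    (pow_ne_zero _ (by simp [hx, hpn, hp0]))).1 ?_
  have e' : (-x * p ^ n) ^ (k + 1) = (-x * (p ^ n * p⁻¹)) ^ (k + 1) * p ^ (k + 1) := by
    rw [← mul_pow]; congr 1; field_simp
  rw [e', pow_succ (-x * _)] at h
  have h1 := neg_one_pow_mul_self k
  generalize (-x * (p ^ n * p⁻¹)) ^ k = c at *
  linear_combination h - (c * T k (n - 1) m * T (k + 2) n (m + 1) +
    c * x * p ^ n * p⁻¹ * T (k + 1) (n - 1) m * T (k + 1) n (m + 1)) * h1

omit hp0 in
theorem Contig.toda_xz :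
    y * p ^ m * T k n (m + 1) * T (k + 2) (n - 1) m =
      T (k + 1) (n - 1) (m + 1) * T (k + 1) n m - T (k + 1) n (m + 1) * T (k + 1) (n - 1) m := by
  obtain ⟨ea, ez, la, lz, az, el⟩ := bracket_units f k (n - 2) m
  obtain ⟨ga, gz, eg, lg⟩ := hf.bracket_geomRow k (n - 2) m
  have h := bracket_plucker (toeplitzRows (fun l => f l m) k (k + 2) (n - 2))
    (geomRow (y * p ^ m) (k + 2)) (Pi.single 0 1) (toeplitzRow (fun l => f l m) (k + 2) (n - 2 + 1))
    (toeplitzRow (fun l => f l m) (k + 2) (n - 2 - k))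
  rw [bracket_swap _ (Pi.single 0 1) (geomRow _ _), eg, az, ga, ez, gz, ea] at h
  rw [show n - 2 + 1 = n - 1 by ring, show n - 2 + 2 = n by ring] at h
  rw [← sub_eq_zero]
  refine (mul_eq_zero_iff_left (a := (-1 : ℂ) ^ k)
    (pow_ne_zero _ (by norm_num))).1 ?_
  linear_combination -h

omit hp0 in
theorem Contig.toda_yz :
    T k n (m + 1) * T (k + 2) n m =
      T (k + 1) n (m + 1) * T (k + 1) n m - T (k + 1) (n + 1) (m + 1) * T (k + 1) (n - 1) m := by
  obtain ⟨ea, ez, la, lz, az, el⟩ := bracket_units f k (n - 1) m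
  obtain ⟨ga, gz, eg, lg⟩ := hf.bracket_geomRow k (n - 1) m
  have h := bracket_plucker (toeplitzRows (fun l => f l m) k (k + 2) (n - 1))
    (geomRow (y * p ^ m) (k + 2)) (Pi.single (Fin.last (k + 1)) 1)
    (toeplitzRow (fun l => f l m) (k + 2) (n - 1 + 1))
    (toeplitzRow (fun l => f l m) (k + 2) (n - 1 - k))
  rw [bracket_swap _ (Pi.single (Fin.last (k + 1)) 1) (geomRow _ _), lg, az, ga, lz, gz, la] at h
  rw [show n - 1 + 1 = n by ring, show n - 1 + 2 = n + 1 by ring] at h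
  linear_combination h + (T (k + 1) n (m + 1) * T (k + 1) n m - T k n (m + 1) * T (k + 2) n m) *
    neg_one_pow_mul_self k

end

end QP3

end

noncomputable section

namespace QP3

/-! ## The gauge factors of the explicit `τ` functions -/

section

variable {Q : ℂ} {Ω : Set (ℂ × ℂ)}

theorem notPow_of_ratio (hQ0 : Q ≠ 0) {b c : ℂ} (k : ℤ) (hc : c ≠ 0) (hb : b = Q ^ k * c)
    (h : ∀ k : ℤ, c ≠ Q ^ k) : NotPow Q b := by
  subst hb
  exact NotPow.zpow_mul hQ0 ⟨hc, h⟩ k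

theorem IsGeneric.notPow_A (hQ0 : Q ≠ 0) {α0 α2 : ℂ} (h : IsGeneric Q α0 α2) :
    NotPow Q (Q * α0 ^ 2 * α2) := by
  have h0 := h.ne_zero0
  have h2 := h.ne_zero2
  refine notPow_of_ratio hQ0 2 (c := α0 / alpha1 Q α0 α2) ?_ ?_ h.ratio01
  · simp [alpha1, *]
  · rw [alpha1]; norm_cast; field_simp

theorem IsGeneric.notPow_B (hQ0 : Q ≠ 0) {α0 α2 : ℂ} (h : IsGeneric Q α0 α2) :
    NotPow Q (Q / (α0 * α2 ^ 2)) := by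
  have h0 := h.ne_zero0
  have h2 := h.ne_zero2
  refine notPow_of_ratio hQ0 0 (c := alpha1 Q α0 α2 / α2) ?_ ?_ h.ratio12
  · simp [alpha1, *]
  · rw [alpha1]; norm_cast; field_simp

theorem IsGeneric.notPow_C (hQ0 : Q ≠ 0) {α0 α2 : ℂ} (h : IsGeneric Q α0 α2) :
    NotPow Q (Q * α2 / α0) := by
  have h0 := h.ne_zero0
  have h2 := h.ne_zero2
  refine notPow_of_ratio hQ0 1 (c := α2 / α0) ?_ ?_ h.ratio20
  · simp [*]
  · norm_cast; field_simp

/-- The product of elliptic gamma functions at the base point of the lattice. -/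
def gammaBase (Q α0 α2 : ℂ) : ℂ :=
  ellGamma (Q * α0 ^ 2 * α2) Q Q * ellGamma (Q / (α0 * α2 ^ 2)) Q Q *
    ellGamma (Q * α2 / α0) Q Q

theorem gammaFactor_eq (hQ0 : Q ≠ 0) {α0 α2 : ℂ} (h0 : α0 ≠ 0) (h2 : α2 ≠ 0) (n m : ℤ) :
    gammaFactor Q α0 α2 n m = gammaBase Q (Q ^ n * α0) (Q ^ (-m) * α2) := by
  have hn := zpow_ne_zero n hQ0
  have hm := zpow_ne_zero m hQ0
  have e1 : Q ^ (2 * n - m + 1) = Q ^ n * Q ^ n * (Q ^ m)⁻¹ * Q := by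
    rw [zpow_add_one₀ hQ0, zpow_sub₀ hQ0, two_mul, zpow_add₀ hQ0, div_eq_mul_inv]
  have e2 : Q ^ (-n + 2 * m - 1) = (Q ^ n)⁻¹ * (Q ^ m * Q ^ m) * Q⁻¹ := by
    rw [zpow_sub_one₀ hQ0, zpow_add₀ hQ0, two_mul, zpow_add₀ hQ0, zpow_neg]
  have e3 : Q ^ (-n - m) = (Q ^ n)⁻¹ * (Q ^ m)⁻¹ := by
    rw [zpow_sub₀ hQ0, zpow_neg, div_eq_mul_inv]
  unfold gammaFactor gammaBase
  simp only [e1, e2, e3, zpow_neg, alpha1]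
  congr 1
  · congr 1
    · congr 1
      field_simp
    · congr 1
      field_simp
  · congr 1
    field_simp

theorem gammaBase_ne_zero (hQ0 : Q ≠ 0) (hQ1 : ‖Q‖ < 1) {α0 α2 : ℂ} (h : IsGeneric Q α0 α2) :
    gammaBase Q α0 α2 ≠ 0 :=
  mul_ne_zero (mul_ne_zero (ellGamma_ne_zero hQ1 hQ0 (h.notPow_A hQ0))
    (ellGamma_ne_zero hQ1 hQ0 (h.notPow_B hQ0))) (ellGamma_ne_zero hQ1 hQ0 (h.notPow_C hQ0))

theorem ellGamma_cube (hQ0 : Q ≠ 0) (hQ1 : ‖Q‖ < 1) {a b c d : ℂ} (h : NotPow Q a)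
    (hb : b = Q * a) (hc : c = Q ^ 2 * a) (hd : d = Q ^ 3 * a) :
    ellGamma a Q Q * ellGamma d Q Q = (Q * a ^ 2)⁻¹ * (ellGamma b Q Q * ellGamma c Q Q) := by
  rw [hb, hc, hd, ellGamma_mul_cube hQ1 hQ0 h]
  ring

theorem ellGamma_sq (hQ0 : Q ≠ 0) (hQ1 : ‖Q‖ < 1) {a b c : ℂ} (h : NotPow Q a)
    (hb : b = Q * a) (hc : c = Q ^ 2 * a) :
    ellGamma b Q Q ^ 2 = -a * (ellGamma a Q Q * ellGamma c Q Q) := by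
  rw [hb, hc, ellGamma_mul_sq hQ1 hQ0 h]

/-- For two of the three gamma functions the arguments at opposite vertices are `a, Q³ a` against `Q
a, Q² a`; for the third they are `Q a` twice against `a, Q² a`. The same pattern, with the roles
permuted, holds for the other two rhombi. -/
theorem gammaBase_rhombus_zero (hQ0 : Q ≠ 0) (hQ1 : ‖Q‖ < 1) {α0 α2 : ℂ}
    (h : IsGeneric Q α0 α2) :
    gammaBase Q (Q⁻¹ * α0) α2 * gammaBase Q (Q * α0) (Q⁻¹ * α2) =
      -(Q ^ 3 / (α0 ^ 3 * α2 ^ 6)) * (gammaBase Q α0 α2 * gammaBase Q α0 (Q⁻¹ * α2)) := by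
  have h0 := h.ne_zero0
  have h2 := h.ne_zero2
  have eA := ellGamma_cube hQ0 hQ1 (a := Q * (Q⁻¹ * α0) ^ 2 * α2) (b := Q * α0 ^ 2 * (Q⁻¹ * α2))
    (c := Q * α0 ^ 2 * α2) (d := Q * (Q * α0) ^ 2 * (Q⁻¹ * α2))
    (notPow_of_ratio hQ0 (-2) (h.notPow_A hQ0).1 (by rw [zpow_neg]; norm_cast; field_simp)
      (h.notPow_A hQ0).2) (by field_simp) (by field_simp) (by field_simp)
  have eB := ellGamma_sq hQ0 hQ1 (a := Q / (α0 * α2 ^ 2)) (b := Q / (Q⁻¹ * α0 * α2 ^ 2))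
    (c := Q / (α0 * (Q⁻¹ * α2) ^ 2)) (h.notPow_B hQ0) (by field_simp) (by field_simp)
  have eC := ellGamma_cube hQ0 hQ1 (a := Q * (Q⁻¹ * α2) / (Q * α0)) (b := Q * (Q⁻¹ * α2) / α0)
    (c := Q * α2 / α0) (d := Q * α2 / (Q⁻¹ * α0))
    (notPow_of_ratio hQ0 (-2) (h.notPow_C hQ0).1 (by rw [zpow_neg]; norm_cast; field_simp)
      (h.notPow_C hQ0).2) (by field_simp) (by field_simp) (by field_simp)
  have eB' : Q / (Q * α0 * (Q⁻¹ * α2) ^ 2) = Q / (Q⁻¹ * α0 * α2 ^ 2) := by field_simp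
  unfold gammaBase
  rw [eB']
  rw [show ∀ a b c d f : ℂ, a * b * c * (d * b * f) = (a * d) * b ^ 2 * (f * c) by
    intros; ring, eA, eB, eC]
  field_simp

theorem gammaBase_rhombus_one (hQ0 : Q ≠ 0) (hQ1 : ‖Q‖ < 1) {α0 α2 : ℂ}
    (h : IsGeneric Q α0 α2) :
    gammaBase Q α0 α2 * gammaBase Q (Q⁻¹ * α0) (Q⁻¹ * α2) =
      -(α2 ^ 3 / α0 ^ 3) * (gammaBase Q (Q⁻¹ * α0) α2 * gammaBase Q α0 (Q⁻¹ * α2)) := by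
  have h0 := h.ne_zero0
  have h2 := h.ne_zero2
  have eA := ellGamma_cube hQ0 hQ1 (a := Q * (Q⁻¹ * α0) ^ 2 * (Q⁻¹ * α2))
    (b := Q * (Q⁻¹ * α0) ^ 2 * α2) (c := Q * α0 ^ 2 * (Q⁻¹ * α2)) (d := Q * α0 ^ 2 * α2)
    (notPow_of_ratio hQ0 (-3) (h.notPow_A hQ0).1 (by rw [zpow_neg]; norm_cast; field_simp)
      (h.notPow_A hQ0).2) (by field_simp) (by field_simp) (by field_simp)
  have eB := ellGamma_cube hQ0 hQ1 (a := Q / (α0 * α2 ^ 2)) (b := Q / (Q⁻¹ * α0 * α2 ^ 2))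
    (c := Q / (α0 * (Q⁻¹ * α2) ^ 2)) (d := Q / (Q⁻¹ * α0 * (Q⁻¹ * α2) ^ 2)) (h.notPow_B hQ0)
    (by field_simp) (by field_simp) (by field_simp)
  have eC := ellGamma_sq hQ0 hQ1 (a := Q * (Q⁻¹ * α2) / α0) (b := Q * α2 / α0)
    (c := Q * α2 / (Q⁻¹ * α0))
    (notPow_of_ratio hQ0 (-1) (h.notPow_C hQ0).1 (by rw [zpow_neg]; norm_cast; field_simp)
      (h.notPow_C hQ0).2) (by field_simp) (by field_simp)
  have eC' : Q * (Q⁻¹ * α2) / (Q⁻¹ * α0) = Q * α2 / α0 := by field_simp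
  unfold gammaBase
  rw [eC', show ∀ a b c d f : ℂ, a * b * c * (d * f * c) = (d * a) * (b * f) * c ^ 2 by
    intros; ring, eA, eB, eC]
  field_simp

theorem gammaBase_rhombus_two (hQ0 : Q ≠ 0) (hQ1 : ‖Q‖ < 1) {α0 α2 : ℂ}
    (h : IsGeneric Q α0 α2) :
    gammaBase Q α0 (Q⁻¹ * α2) * gammaBase Q (Q⁻¹ * α0) (Q * α2) =
      -(α0 ^ 6 * α2 ^ 3 / Q ^ 3) * (gammaBase Q (Q⁻¹ * α0) α2 * gammaBase Q α0 α2) := by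
  have h0 := h.ne_zero0
  have h2 := h.ne_zero2
  have eA := ellGamma_sq hQ0 hQ1 (a := Q * (Q⁻¹ * α0) ^ 2 * α2)
    (b := Q * α0 ^ 2 * (Q⁻¹ * α2)) (c := Q * α0 ^ 2 * α2)
    (notPow_of_ratio hQ0 (-2) (h.notPow_A hQ0).1 (by rw [zpow_neg]; norm_cast; field_simp)
      (h.notPow_A hQ0).2) (by field_simp) (by field_simp)
  have eB := ellGamma_cube hQ0 hQ1 (a := Q / (Q⁻¹ * α0 * (Q * α2) ^ 2)) (b := Q / (α0 * α2 ^ 2))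
    (c := Q / (Q⁻¹ * α0 * α2 ^ 2)) (d := Q / (α0 * (Q⁻¹ * α2) ^ 2))
    (notPow_of_ratio hQ0 (-1) (h.notPow_B hQ0).1 (by rw [zpow_neg]; norm_cast; field_simp)
      (h.notPow_B hQ0).2) (by field_simp) (by field_simp) (by field_simp)
  have eC := ellGamma_cube hQ0 hQ1 (a := Q * (Q⁻¹ * α2) / α0) (b := Q * α2 / α0)
    (c := Q * α2 / (Q⁻¹ * α0)) (d := Q * (Q * α2) / (Q⁻¹ * α0))
    (notPow_of_ratio hQ0 (-1) (h.notPow_C hQ0).1 (by rw [zpow_neg]; norm_cast; field_simp)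
      (h.notPow_C hQ0).2) (by field_simp) (by field_simp) (by field_simp)
  have eA' : Q * (Q⁻¹ * α0) ^ 2 * (Q * α2) = Q * α0 ^ 2 * (Q⁻¹ * α2) := by field_simp
  unfold gammaBase
  rw [eA', show ∀ a b c d f : ℂ, a * b * c * (a * d * f) = a ^ 2 * (d * b) * (c * f) by
    intros; ring, eA, eB, eC]
  field_simp

/-! ### The theta factor and the monomial prefactor -/

/-- The quotient of theta functions at the base point of the lattice. -/
def thetaBase (Q α0 α2 : ℂ) : ℂ :=
  theta (-(α0 ^ 6)⁻¹) (Q ^ 6) * theta (-(α2 ^ 6)⁻¹) (Q ^ 6) / theta ((α0 ^ 6 * α2 ^ 6)⁻¹) (Q ^ 6)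

theorem norm_pow_six_lt_one (hQ1 : ‖Q‖ < 1) : ‖Q ^ 6‖ < 1 := by
  rw [norm_pow]
  exact pow_lt_one₀ (norm_nonneg _) hQ1 (by norm_num)

theorem theta_inv_mul (hQ0 : Q ≠ 0) (hQ1 : ‖Q‖ < 1) {a : ℂ} (ha : a ≠ 0) :
    theta (Q ^ 6 * a⁻¹) (Q ^ 6) = -a * theta a⁻¹ (Q ^ 6) := by
  rw [theta_mul (norm_pow_six_lt_one hQ1) (pow_ne_zero _ hQ0) (inv_ne_zero ha), inv_inv]

/-- The powers of `α0` in the multipliers of the two theta functions involved cancel. The quotient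
thus realizes a multiplier in one variable that is a monomial in the other one. -/
theorem thetaBase_left (hQ0 : Q ≠ 0) (hQ1 : ‖Q‖ < 1) {α0 α2 : ℂ} (h0 : α0 ≠ 0) (h2 : α2 ≠ 0) :
    thetaBase Q (Q⁻¹ * α0) α2 = -(α2 ^ 6)⁻¹ * thetaBase Q α0 α2 := by
  have e1 : -((Q⁻¹ * α0) ^ 6)⁻¹ = Q ^ 6 * (-α0 ^ 6)⁻¹ := by field_simp
  have e2 : ((Q⁻¹ * α0) ^ 6 * α2 ^ 6)⁻¹ = Q ^ 6 * (α0 ^ 6 * α2 ^ 6)⁻¹ := by field_simp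
  have e3 : -(α0 ^ 6)⁻¹ = (-α0 ^ 6)⁻¹ := by rw [inv_neg]
  have h06 := pow_ne_zero 6 h0
  unfold thetaBase
  rw [e1, e2, e3, theta_inv_mul hQ0 hQ1 (neg_ne_zero.2 h06),
    theta_inv_mul hQ0 hQ1 (mul_ne_zero h06 (pow_ne_zero 6 h2))]
  field_simp

theorem thetaBase_up (hQ0 : Q ≠ 0) (hQ1 : ‖Q‖ < 1) {α0 α2 : ℂ} (h0 : α0 ≠ 0) (h2 : α2 ≠ 0) :
    thetaBase Q α0 (Q⁻¹ * α2) = -(α0 ^ 6)⁻¹ * thetaBase Q α0 α2 := by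
  have e1 : -((Q⁻¹ * α2) ^ 6)⁻¹ = Q ^ 6 * (-α2 ^ 6)⁻¹ := by field_simp
  have e2 : (α0 ^ 6 * (Q⁻¹ * α2) ^ 6)⁻¹ = Q ^ 6 * (α0 ^ 6 * α2 ^ 6)⁻¹ := by field_simp
  have e3 : -(α2 ^ 6)⁻¹ = (-α2 ^ 6)⁻¹ := by rw [inv_neg]
  have h26 := pow_ne_zero 6 h2
  unfold thetaBase
  rw [e1, e2, e3, theta_inv_mul hQ0 hQ1 (neg_ne_zero.2 h26),
    theta_inv_mul hQ0 hQ1 (mul_ne_zero (pow_ne_zero 6 h0) h26)]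
  field_simp

theorem thetaBase_right (hQ0 : Q ≠ 0) (hQ1 : ‖Q‖ < 1) {α0 α2 : ℂ} (h0 : α0 ≠ 0) (h2 : α2 ≠ 0) :
    thetaBase Q (Q * α0) α2 = -α2 ^ 6 * thetaBase Q α0 α2 := by
  have := thetaBase_left hQ0 hQ1 (mul_ne_zero hQ0 h0) h2
  rw [inv_mul_cancel_left₀ hQ0] at this
  rw [this]
  field_simp

theorem thetaBase_down (hQ0 : Q ≠ 0) (hQ1 : ‖Q‖ < 1) {α0 α2 : ℂ} (h0 : α0 ≠ 0) (h2 : α2 ≠ 0) :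
    thetaBase Q α0 (Q * α2) = -α0 ^ 6 * thetaBase Q α0 α2 := by
  have := thetaBase_up hQ0 hQ1 h0 (mul_ne_zero hQ0 h2)
  rw [inv_mul_cancel_left₀ hQ0] at this
  rw [this]
  field_simp

theorem thetaBase_ne_zero (hQ0 : Q ≠ 0) (hQ1 : ‖Q‖ < 1) {α0 α2 : ℂ} (h : IsGeneric Q α0 α2) :
    thetaBase Q α0 α2 ≠ 0 := by
  have hp1 := norm_pow_six_lt_one hQ1
  have hp0 : Q ^ 6 ≠ 0 := pow_ne_zero _ hQ0
  -- Genericity restricts the squares, hence excludes the zeros of the theta functions for both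
  -- signs of the argument.
  have key : ∀ c : ℂ, c ≠ 0 → NotPow (Q ^ 12) (c ^ 2) → NotPow (Q ^ 6) c := by
    intro c hc hn
    refine ⟨hc, fun k hk => hn.2 k ?_⟩
    rw [hk, ← zpow_natCast ((Q ^ 6) ^ k), ← zpow_mul, mul_comm, zpow_mul]
    norm_cast
    rw [← pow_mul]
  have h06 := pow_ne_zero 6 h.ne_zero0
  have h26 := pow_ne_zero 6 h.ne_zero2
  refine div_ne_zero (mul_ne_zero (theta_ne_zero hp1 hp0 ?_) (theta_ne_zero hp1 hp0 ?_))
    (theta_ne_zero hp1 hp0 ?_)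
  · rw [← inv_neg]
    refine (key _ (neg_ne_zero.2 h06) ?_).inv
    convert h.notPow_zero using 1; ring
  · rw [← inv_neg]
    refine (key _ (neg_ne_zero.2 h26) ?_).inv
    convert h.notPow_two using 1; ring
  · refine (key _ (mul_ne_zero h06 h26) ?_).inv
    convert h.notPow_one hQ0 using 1; ring

/-- The prefactor of `ψ_N` at the base point of the lattice, without the gamma functions. -/
def prefactor (Q : ℂ) (k : ℕ) (α0 α2 : ℂ) : ℂ :=
  (-1) ^ (k * (k + 1) / 2) * (α0 ^ (6 * k) / (α0 ^ (4 * k ^ 2) * α2 ^ (2 * k ^ 2))) *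
    thetaBase Q α0 α2 ^ k

theorem prefactor_ne_zero (hQ0 : Q ≠ 0) (hQ1 : ‖Q‖ < 1) {α0 α2 : ℂ} (h : IsGeneric Q α0 α2)
    (k : ℕ) : prefactor Q k α0 α2 ≠ 0 := by
  have h0 := h.ne_zero0
  have h2 := h.ne_zero2
  refine mul_ne_zero (mul_ne_zero (pow_ne_zero _ (by norm_num)) ?_)
    (pow_ne_zero _ (thetaBase_ne_zero hQ0 hQ1 h))
  exact div_ne_zero (pow_ne_zero _ h0) (mul_ne_zero (pow_ne_zero _ h0) (pow_ne_zero _ h2))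

theorem prefactor_zero (α0 α2 : ℂ) : prefactor Q 0 α0 α2 = 1 := by simp [prefactor]

/-- Exponents linear or quadratic in `k` are reduced to `a ^ k` and `a ^ k ^ 2`, which the later
rational identities treat as independent quantities. -/
theorem pow_six_mul (a : ℂ) (k : ℕ) : a ^ (6 * k) = (a ^ k) ^ 6 := by rw [← pow_mul, mul_comm]

theorem pow_four_mul_sq (a : ℂ) (k : ℕ) : a ^ (4 * k ^ 2) = (a ^ k ^ 2) ^ 4 := by
  rw [← pow_mul, mul_comm]

theorem pow_two_mul_sq (a : ℂ) (k : ℕ) : a ^ (2 * k ^ 2) = (a ^ k ^ 2) ^ 2 := by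
  rw [← pow_mul, mul_comm]

theorem prefactor_left (hQ0 : Q ≠ 0) (hQ1 : ‖Q‖ < 1) {α0 α2 : ℂ} (h0 : α0 ≠ 0) (h2 : α2 ≠ 0)
    (k : ℕ) : prefactor Q k (Q⁻¹ * α0) α2 =
      (-1) ^ k * (Q ^ k ^ 2) ^ 4 / ((Q ^ k) ^ 6 * (α2 ^ k) ^ 6) * prefactor Q k α0 α2 := by
  have e : (-(α2 ^ 6)⁻¹ * thetaBase Q α0 α2) ^ k = (-1) ^ k * ((α2 ^ k) ^ 6)⁻¹ * thetaBase Q α0 α2 ^ k := by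
    rw [neg_mul, neg_pow, mul_pow, inv_pow, ← pow_mul, ← pow_mul, mul_comm k 6, mul_assoc]
  unfold prefactor
  rw [thetaBase_left hQ0 hQ1 h0 h2, e]
  simp only [pow_six_mul, pow_four_mul_sq, pow_two_mul_sq, mul_pow, inv_pow]
  field_simp

theorem prefactor_right (hQ0 : Q ≠ 0) (hQ1 : ‖Q‖ < 1) {α0 α2 : ℂ} (h0 : α0 ≠ 0) (h2 : α2 ≠ 0)
    (k : ℕ) : prefactor Q k (Q * α0) α2 =
      (-1) ^ k * (Q ^ k) ^ 6 * (α2 ^ k) ^ 6 / (Q ^ k ^ 2) ^ 4 * prefactor Q k α0 α2 := by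
  have e : (-α2 ^ 6 * thetaBase Q α0 α2) ^ k = (-1) ^ k * (α2 ^ k) ^ 6 * thetaBase Q α0 α2 ^ k := by
    rw [neg_mul, neg_pow, mul_pow, ← pow_mul, ← pow_mul, mul_comm k 6, mul_assoc]
  unfold prefactor
  rw [thetaBase_right hQ0 hQ1 h0 h2, e]
  simp only [pow_six_mul, pow_four_mul_sq, pow_two_mul_sq, mul_pow]
  field_simp

theorem prefactor_up (hQ0 : Q ≠ 0) (hQ1 : ‖Q‖ < 1) {α0 α2 : ℂ} (h0 : α0 ≠ 0) (h2 : α2 ≠ 0)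
    (k : ℕ) : prefactor Q k α0 (Q⁻¹ * α2) =
      (-1) ^ k * (Q ^ k ^ 2) ^ 2 / (α0 ^ k) ^ 6 * prefactor Q k α0 α2 := by
  have e : (-(α0 ^ 6)⁻¹ * thetaBase Q α0 α2) ^ k = (-1) ^ k * ((α0 ^ k) ^ 6)⁻¹ * thetaBase Q α0 α2 ^ k := by
    rw [neg_mul, neg_pow, mul_pow, inv_pow, ← pow_mul, ← pow_mul, mul_comm k 6, mul_assoc]
  unfold prefactor
  rw [thetaBase_up hQ0 hQ1 h0 h2, e]
  simp only [pow_six_mul, pow_four_mul_sq, pow_two_mul_sq, mul_pow, inv_pow]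
  field_simp

theorem prefactor_down (hQ0 : Q ≠ 0) (hQ1 : ‖Q‖ < 1) {α0 α2 : ℂ} (h0 : α0 ≠ 0) (h2 : α2 ≠ 0)
    (k : ℕ) : prefactor Q k α0 (Q * α2) =
      (-1) ^ k * (α0 ^ k) ^ 6 / (Q ^ k ^ 2) ^ 2 * prefactor Q k α0 α2 := by
  have e : (-α0 ^ 6 * thetaBase Q α0 α2) ^ k = (-1) ^ k * (α0 ^ k) ^ 6 * thetaBase Q α0 α2 ^ k := by
    rw [neg_mul, neg_pow, mul_pow, ← pow_mul, ← pow_mul, mul_comm k 6, mul_assoc]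
  unfold prefactor
  rw [thetaBase_down hQ0 hQ1 h0 h2, e]
  simp only [pow_six_mul, pow_four_mul_sq, pow_two_mul_sq, mul_pow]
  field_simp

/-- Only the second difference in `k` matters: the factors with linear exponent drop out, `-4k²` and
`-2k²` give `-8` and `-4`, and `k(k+1)/2` gives the sign. -/
theorem prefactor_toda {α0 α2 : ℂ} (h0 : α0 ≠ 0) (h2 : α2 ≠ 0) (k : ℕ) :
    prefactor Q (k + 2) α0 α2 * prefactor Q k α0 α2 =
      -(α0 ^ 8 * α2 ^ 4)⁻¹ * prefactor Q (k + 1) α0 α2 ^ 2 := by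
  have e1 : (k + 1) * (k + 1 + 1) / 2 = k * (k + 1) / 2 + (k + 1) := by
    rw [show (k + 1) * (k + 1 + 1) = k * (k + 1) + (k + 1) * 2 by ring,
      Nat.add_mul_div_right _ _ (by norm_num)]
  have e2 : (k + 2) * (k + 2 + 1) / 2 = k * (k + 1) / 2 + (k + 1) + (k + 2) := by
    rw [show (k + 2) * (k + 2 + 1) = k * (k + 1) + (k + 1 + (k + 2)) * 2 by ring,
      Nat.add_mul_div_right _ _ (by norm_num)]
    ring
  unfold prefactor
  rw [e1, e2]
  generalize thetaBase Q α0 α2 = v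
  have p1 : ∀ a : ℂ, a ^ (4 * (k + 2) ^ 2) = a ^ (4 * k ^ 2) * (a ^ (16 * k) * a ^ 16) := fun a => by
    ring
  have p2 : ∀ a : ℂ, a ^ (4 * (k + 1) ^ 2) = a ^ (4 * k ^ 2) * (a ^ (8 * k) * a ^ 4) := fun a => by
    ring
  have p3 : ∀ a : ℂ, a ^ (2 * (k + 2) ^ 2) = a ^ (2 * k ^ 2) * (a ^ (8 * k) * a ^ 8) := fun a => by
    ring
  have p4 : ∀ a : ℂ, a ^ (2 * (k + 1) ^ 2) = a ^ (2 * k ^ 2) * (a ^ (4 * k) * a ^ 2) := fun a => by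
    ring
  have hs : ((-1 : ℂ) ^ (k * (k + 1) / 2)) ^ 2 = 1 := by rw [← pow_mul, mul_comm, pow_mul]; simp
  have hs' : ((-1 : ℂ) ^ k) ^ 2 = 1 := by rw [← pow_mul, mul_comm, pow_mul]; simp
  simp only [p1, p2, p3, p4, pow_add, mul_add, pow_one]
  have n1 := pow_ne_zero (4 * k ^ 2) h0
  have n2 := pow_ne_zero (2 * k ^ 2) h2
  have n3 : α0 ^ (16 * k) = (α0 ^ (8 * k)) ^ 2 := by ring
  have n4 : α2 ^ (8 * k) = (α2 ^ (4 * k)) ^ 2 := by ring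
  have n5 := pow_ne_zero (8 * k) h0
  have n6 := pow_ne_zero (4 * k) h2
  rw [n3, n4]
  generalize α0 ^ (4 * k ^ 2) = A at *
  generalize α2 ^ (2 * k ^ 2) = B at *
  generalize α0 ^ (8 * k) = C at *
  generalize α2 ^ (4 * k) = D at *
  generalize α0 ^ (6 * k) = E at *
  generalize (-1 : ℂ) ^ (k * (k + 1) / 2) = σ at *
  generalize (-1 : ℂ) ^ k = ε at *
  generalize v ^ k = w at *
  field_simp
  ring

end

end QP3

end

noncomputable section

namespace QP3

/-! ## Values of the explicit `τ` functions on the lattice -/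

section

variable {Q : ℂ} {Ω : Set (ℂ × ℂ)} {A B : ℂ → ℂ → ℂ}

theorem F_shift (hQ0 : Q ≠ 0) (hΩ : IsParameterDomain Q Ω) (hA : IsPeriodic Q Ω A)
    (hB : IsPeriodic Q Ω B) {α0 α2 : ℂ} (h : (α0, α2) ∈ Ω) (n m k l : ℤ) :
    F Q A B (Q ^ n * α0) (Q ^ (-m) * α2) k l = F Q A B α0 α2 (k + n) (l + m) := by
  have hp0 : (Q ^ 12 : ℂ) ≠ 0 := pow_ne_zero _ hQ0
  have e : ∀ (a : ℂ) (j : ℤ), (Q ^ j * a) ^ 12 = (Q ^ 12) ^ j * a ^ 12 := fun a j => by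
    rw [mul_pow, ← zpow_natCast (Q ^ j), ← zpow_mul, mul_comm j, zpow_mul]
    norm_cast
  rw [F_eq hQ0 hΩ hA hB (hΩ.shift _ _ h n m), F_eq hQ0 hΩ hA hB h, hA.eq hQ0 hΩ h,
    hB.eq hQ0 hΩ h, e, e, ← mul_assoc, ← mul_assoc, ← zpow_add₀ hp0, ← zpow_add₀ hp0, neg_add]

theorem psi_natCast (A B : ℂ → ℂ → ℂ) (α0 α2 : ℂ) (k : ℕ) (n m : ℤ) :
    psi Q A B α0 α2 k n m = latticeToeplitz (F Q A B α0 α2) k n m := by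
  simp [psi, latticeToeplitz, toeplitz]

theorem psi_shift (hQ0 : Q ≠ 0) (hΩ : IsParameterDomain Q Ω) (hA : IsPeriodic Q Ω A)
    (hB : IsPeriodic Q Ω B) {α0 α2 : ℂ} (h : (α0, α2) ∈ Ω) (N n m k l : ℤ) :
    psi Q A B (Q ^ n * α0) (Q ^ (-m) * α2) N k l = psi Q A B α0 α2 N (k + n) (l + m) := by
  unfold psi
  congr 3
  ext i j
  rw [F_shift hQ0 hΩ hA hB h]
  congr 1
  ring

theorem hyperTau_shift (hQ0 : Q ≠ 0) (hΩ : IsParameterDomain Q Ω) (hA : IsPeriodic Q Ω A)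
    (hB : IsPeriodic Q Ω B) {α0 α2 : ℂ} (h : (α0, α2) ∈ Ω) (N n m : ℤ) :
    hyperTau Q A B (Q ^ n * α0) (Q ^ (-m) * α2) N 0 0 = hyperTau Q A B α0 α2 N n m := by
  have hg := hΩ.generic _ _ h
  have hg' := hΩ.generic _ _ (hΩ.shift _ _ h n m)
  unfold hyperTau
  rw [psi_shift hQ0 hΩ hA hB h, gammaFactor_eq hQ0 hg'.ne_zero0 hg'.ne_zero2,
    gammaFactor_eq hQ0 hg.ne_zero0 hg.ne_zero2]
  have e1 : (Q ^ n * α0) ^ (-6 : ℤ) = Q ^ (-6 * n) * α0 ^ (-6 : ℤ) := by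
    rw [mul_zpow, ← zpow_mul, mul_comm n]
  have e2 : (Q ^ (-m) * α2) ^ (-6 : ℤ) = Q ^ (6 * m) * α2 ^ (-6 : ℤ) := by
    rw [mul_zpow, ← zpow_mul]; congr 2; ring
  have e3 : Q ^ (-6 * n) * α0 ^ (-6 : ℤ) * (Q ^ (6 * m) * α2 ^ (-6 : ℤ)) =
      Q ^ (-6 * (n - m)) * α0 ^ (-6 : ℤ) * α2 ^ (-6 : ℤ) := by
    rw [show -6 * (n - m) = -6 * n + 6 * m by ring, zpow_add₀ hQ0]; ring
  have e4 : (Q ^ n * α0) ^ (-4 * N ^ 2 + 6 * N) * (Q ^ (-m) * α2) ^ (-2 * N ^ 2) =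
      Q ^ (-2 * (2 * n - m) * N ^ 2 + 6 * n * N) * α0 ^ (-4 * N ^ 2 + 6 * N) *
        α2 ^ (-2 * N ^ 2) := by
    rw [mul_zpow, mul_zpow, ← zpow_mul, ← zpow_mul, show -2 * (2 * n - m) * N ^ 2 + 6 * n * N =
      n * (-4 * N ^ 2 + 6 * N) + -m * (-2 * N ^ 2) by ring, zpow_add₀ hQ0]
    ring
  simp only [e1, e2, mul_zero, sub_zero, zpow_zero, one_mul, zero_mul, add_zero, neg_zero, e3,
    zero_sub, zero_add]
  rw [mul_one, mul_assoc (_ ^ (N * (N + 1) / 2)) ((Q ^ n * α0) ^ _), e4,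
    show -1 + m = m - 1 by ring]
  ring

theorem hyperTau_neg (A B : ℂ → ℂ → ℂ) (α0 α2 : ℂ) {N : ℤ} (hN : N < 0) (n m : ℤ) :
    hyperTau Q A B α0 α2 N n m = 0 := by
  simp [hyperTau, psi, hN]

theorem hyperTau_natCast (hQ0 : Q ≠ 0) (hΩ : IsParameterDomain Q Ω) {α0 α2 : ℂ}
    (h : (α0, α2) ∈ Ω) (k : ℕ) :
    hyperTau Q A B α0 α2 k 0 0 =
      prefactor Q k α0 α2 * gammaBase Q α0 α2 * latticeToeplitz (F Q A B α0 α2) k 0 (-1) := by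
  have hg := hΩ.generic _ _ h
  have h0 := hg.ne_zero0
  have h2 := hg.ne_zero2
  have e0 : ((k : ℤ) * (k + 1) / 2) = ((k * (k + 1) / 2 : ℕ) : ℤ) := by push_cast; rfl
  have e1 : ∀ a : ℂ, a ^ (-6 : ℤ) = (a ^ 6)⁻¹ := fun a => by rw [zpow_neg]; norm_cast
  have e2 : α0 ^ (-4 * (k : ℤ) ^ 2 + 6 * k) = α0 ^ (6 * k) / α0 ^ (4 * k ^ 2) := by
    rw [zpow_add₀ h0, neg_mul, zpow_neg, mul_comm, div_eq_mul_inv]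
    norm_cast
  have e3 : α2 ^ (-2 * (k : ℤ) ^ 2) = (α2 ^ (2 * k ^ 2))⁻¹ := by
    rw [neg_mul, zpow_neg]
    norm_cast
  unfold hyperTau prefactor thetaBase
  rw [psi_natCast, gammaFactor_eq hQ0 h0 h2, e0, e2, e3]
  simp only [e1, mul_zero, sub_zero, zpow_zero, one_mul, zero_mul, add_zero, neg_zero, zero_sub,
    zpow_natCast, mul_one, mul_inv]
  ring

/-- The value of `ψ_k`, with its prefactors, at the point `(n, m)`. -/
theorem hyperTau_point (hQ0 : Q ≠ 0) (hΩ : IsParameterDomain Q Ω) (hA : IsPeriodic Q Ω A)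
    (hB : IsPeriodic Q Ω B) {α0 α2 : ℂ} (h : (α0, α2) ∈ Ω) (k : ℕ) (n m : ℤ) {β0 β2 : ℂ}
    (h0 : β0 = Q ^ n * α0) (h2 : β2 = Q ^ (-m) * α2) :
    hyperTau Q A B β0 β2 k 0 0 = prefactor Q k β0 β2 * gammaBase Q β0 β2 *
      latticeToeplitz (F Q A B α0 α2) k n (m - 1) := by
  subst h0 h2
  rw [hyperTau_natCast hQ0 hΩ (hΩ.shift _ _ h n m), ← psi_natCast, psi_shift hQ0 hΩ hA hB h,
    psi_natCast]
  congr 2 <;> ring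

/-- The values of the `τ` functions at the vertices of a triangle of the lattice and at their
reflections in the opposite sides, in terms of numbers `ψ` satisfying bilinear relations. -/
structure LocalTau (Q α0 α2 : ℂ) (tx ty tz dx dy dz : ℤ → ℂ) : Prop where
  neg : ∀ N < 0, tx N = 0 ∧ ty N = 0 ∧ tz N = 0 ∧ dx N = 0 ∧ dy N = 0 ∧ dz N = 0
  exists_psi : ∃ (w : ℕ → ℂ) (gx gy gz hx hy hz : ℂ) (f : ℤ → ℤ → ℂ),
    Contig (Q ^ 12) (α0 ^ 12) (Q ^ 12 / α2 ^ 12) f ∧ w 0 = 1 ∧ (∀ k, w k ≠ 0) ∧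
    (∀ k, w (k + 2) * w k = -(α0 ^ 8 * α2 ^ 4)⁻¹ * w (k + 1) ^ 2) ∧
    gx ≠ 0 ∧ gy ≠ 0 ∧ gz ≠ 0 ∧
    gx * hx = -(Q ^ 3 / (α0 ^ 3 * α2 ^ 6)) * (gy * gz) ∧
    gy * hy = -(α2 ^ 3 / α0 ^ 3) * (gx * gz) ∧
    gz * hz = -(α0 ^ 6 * α2 ^ 3 / Q ^ 3) * (gx * gy) ∧
    ∀ k : ℕ,
      tx k = w k * gx * ((-1) ^ k * (Q ^ k ^ 2) ^ 4 / ((Q ^ k) ^ 6 * (α2 ^ k) ^ 6)) *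
        latticeToeplitz f k (-1) (-1) ∧
      ty k = w k * gy * latticeToeplitz f k 0 (-1) ∧
      tz k = w k * gz * ((-1) ^ k * (Q ^ k ^ 2) ^ 2 / (α0 ^ k) ^ 6) * latticeToeplitz f k 0 0 ∧
      dx k = w k * hx * ((α2 ^ k) ^ 6 / ((Q ^ k ^ 2) ^ 2 * (α0 ^ k) ^ 6)) *
        latticeToeplitz f k 1 0 ∧
      dy k = w k * hy * ((Q ^ k ^ 2) ^ 6 / ((α0 ^ k) ^ 6 * (α2 ^ k) ^ 6)) *
        latticeToeplitz f k (-1) 0 ∧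
      dz k = w k * hz * ((Q ^ k ^ 2) ^ 2 * (α0 ^ k) ^ 6 / ((Q ^ k) ^ 12 * (α2 ^ k) ^ 6)) *
        latticeToeplitz f k (-1) (-2)

theorem localTau_hyperTau (hQ0 : Q ≠ 0) (hQ1 : ‖Q‖ < 1) (hΩ : IsParameterDomain Q Ω)
    (hA : IsPeriodic Q Ω A) (hB : IsPeriodic Q Ω B) {α0 α2 : ℂ} (h : (α0, α2) ∈ Ω) :
    LocalTau Q α0 α2 (fun N => hyperTau Q A B (Q⁻¹ * α0) α2 N 0 0)
      (fun N => hyperTau Q A B α0 α2 N 0 0) (fun N => hyperTau Q A B α0 (Q⁻¹ * α2) N 0 0)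
      (fun N => hyperTau Q A B (Q * α0) (Q⁻¹ * α2) N 0 0)
      (fun N => hyperTau Q A B (Q⁻¹ * α0) (Q⁻¹ * α2) N 0 0)
      (fun N => hyperTau Q A B (Q⁻¹ * α0) (Q * α2) N 0 0) := by
  have hg := hΩ.generic _ _ h
  have h0 := hg.ne_zero0
  have h2 := hg.ne_zero2
  have hQi := inv_ne_zero hQ0
  have mx : (Q⁻¹ * α0, α2) ∈ Ω := by simpa using hΩ.shift_zero h (-1)
  have mz : (α0, Q⁻¹ * α2) ∈ Ω := by simpa using hΩ.shift_two h (-1)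
  have P := hyperTau_point hQ0 hΩ hA hB h
  refine ⟨fun N hN => ⟨hyperTau_neg _ _ _ _ hN _ _, hyperTau_neg _ _ _ _ hN _ _,
    hyperTau_neg _ _ _ _ hN _ _, hyperTau_neg _ _ _ _ hN _ _, hyperTau_neg _ _ _ _ hN _ _,
    hyperTau_neg _ _ _ _ hN _ _⟩, fun k => prefactor Q k α0 α2, gammaBase Q (Q⁻¹ * α0) α2,
    gammaBase Q α0 α2, gammaBase Q α0 (Q⁻¹ * α2), gammaBase Q (Q * α0) (Q⁻¹ * α2),
    gammaBase Q (Q⁻¹ * α0) (Q⁻¹ * α2), gammaBase Q (Q⁻¹ * α0) (Q * α2), F Q A B α0 α2,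
    contig_F hQ0 hQ1 hΩ hA hB h, prefactor_zero _ _, prefactor_ne_zero hQ0 hQ1 hg,
    prefactor_toda h0 h2, gammaBase_ne_zero hQ0 hQ1 (hΩ.generic _ _ mx),
    gammaBase_ne_zero hQ0 hQ1 hg, gammaBase_ne_zero hQ0 hQ1 (hΩ.generic _ _ mz),
    gammaBase_rhombus_zero hQ0 hQ1 hg, gammaBase_rhombus_one hQ0 hQ1 hg,
    gammaBase_rhombus_two hQ0 hQ1 hg, fun k => ?_⟩
  have hε := neg_one_pow_mul_self k
  have nQ := pow_ne_zero k hQ0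
  have nQ2 := pow_ne_zero (k ^ 2) hQ0
  have n0 := pow_ne_zero k h0
  have n2 := pow_ne_zero k h2
  refine ⟨?_, ?_, ?_, ?_, ?_, ?_⟩
  -- The triangle has lattice coordinates `(-1, 0)`, `(0, 0)`, `(0, 1)`, the reflected vertices `(1,
  -- 1)`, `(-1, 1)`, `(-1, -1)`; the determinant is taken at `m - 1`.
  · rw [P k (-1) 0 (by simp) (by simp), prefactor_left hQ0 hQ1 h0 h2, zero_sub]
    ring
  · rw [P k 0 0 (by simp) (by simp), zero_sub]
  · rw [P k 0 1 (by simp) (by simp), prefactor_up hQ0 hQ1 h0 h2, sub_self]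
    ring
  · rw [P k 1 1 (by simp) (by simp), prefactor_right hQ0 hQ1 h0 (mul_ne_zero hQi h2),
      prefactor_up hQ0 hQ1 h0 h2, sub_self, mul_pow, inv_pow]
    generalize (-1 : ℂ) ^ k = ε at *
    generalize gammaBase Q (Q * α0) (Q⁻¹ * α2) = g
    field_simp
    linear_combination g * prefactor Q k α0 α2 * latticeToeplitz (F Q A B α0 α2) k 1 0 * hε
  · rw [P k (-1) 1 (by simp) (by simp), prefactor_left hQ0 hQ1 h0 (mul_ne_zero hQi h2),
      prefactor_up hQ0 hQ1 h0 h2, sub_self, mul_pow, inv_pow]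
    generalize (-1 : ℂ) ^ k = ε at *
    generalize gammaBase Q (Q⁻¹ * α0) (Q⁻¹ * α2) = g
    field_simp
    linear_combination g * prefactor Q k α0 α2 * latticeToeplitz (F Q A B α0 α2) k (-1) 0 * hε
  · rw [P k (-1) (-1) (by simp) (by simp), prefactor_left hQ0 hQ1 h0 (mul_ne_zero hQ0 h2),
      prefactor_down hQ0 hQ1 h0 h2, mul_pow]
    norm_num only
    generalize (-1 : ℂ) ^ k = ε at *
    generalize gammaBase Q (Q⁻¹ * α0) (Q * α2) = g
    field_simp
    linear_combination g * prefactor Q k α0 α2 * latticeToeplitz (F Q A B α0 α2) k (-1) (-2) * hε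

end

end QP3

end

noncomputable section

namespace QP3

/-! ## Bilinear relations of the `τ` functions -/

/-- The relation of the `τ` variables at the vertices of a rhombus with the vertices `x, d` and
`y, z`; the primes denote the variables `τ̄`. -/
def RhombusRel (κ a x y z d x' y' z' d' : ℂ) : Prop :=
  κ * a ^ 3 * x' * d = a ^ 6 * y * z' + κ ^ 2 * y' * z ∧
    κ * a ^ 3 * x * d' = κ ^ 2 * a ^ 6 * y' * z + y * z'

/-- The bilinear relations for the values of `τ` functions at the vertices `x, y, z` of a triangle
of the lattice and at their reflections `dx, dy, dz` in the opposite sides. -/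
structure TriangleRel (Q α0 α1 α2 : ℂ) (tx ty tz dx dy dz : ℤ → ℂ) : Prop where
  neg : ∀ N < 0, tx N = 0 ∧ ty N = 0 ∧ tz N = 0
  rhombus : ∀ k : ℕ,
    RhombusRel (Q * (Q ^ k) ^ 2) α0 (tx k) (ty k) (tz k) (dx k)
      (tx (k + 1)) (ty (k + 1)) (tz (k + 1)) (dx (k + 1)) ∧
    RhombusRel (Q * (Q ^ k) ^ 2) α1 (ty k) (tz k) (tx k) (dy k)
      (ty (k + 1)) (tz (k + 1)) (tx (k + 1)) (dy (k + 1)) ∧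
    RhombusRel (Q * (Q ^ k) ^ 2) α2 (tz k) (tx k) (ty k) (dz k)
      (tz (k + 1)) (tx (k + 1)) (ty (k + 1)) (dz (k + 1))
  toda : ∀ k : ℕ,
    ((Q ^ k) ^ 2 / Q) ^ 2 * α0 ^ 4 * α1 ^ 2 * tz (k + 1) * ty (k - 1) =
      ((Q ^ k) ^ 2 / Q) ^ 4 * α0 ^ 6 * α1 ^ 6 * tz k * ty k +
        (Q ^ k) ^ 2 / Q * α0 ^ 3 * tx k * dx k ∧
    ((Q ^ k) ^ 2 / Q) ^ 2 * α0 ^ 4 * α1 ^ 2 * tz (k + 1) * tx (k - 1) =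
      ((Q ^ k) ^ 2 / Q) ^ 3 * α0 ^ 6 * α1 ^ 3 * ty k * dy k + tz k * tx k ∧
    ((Q ^ k) ^ 2 / Q) ^ 2 * α1 ^ 4 * α2 ^ 2 * tx (k + 1) * tz (k - 1) =
      ((Q ^ k) ^ 2 / Q) ^ 4 * α1 ^ 6 * α2 ^ 6 * tx k * tz k +
        (Q ^ k) ^ 2 / Q * α1 ^ 3 * ty k * dy k ∧
    ((Q ^ k) ^ 2 / Q) ^ 2 * α2 ^ 4 * α0 ^ 2 * ty (k + 1) * tz (k - 1) =
      ((Q ^ k) ^ 2 / Q) ^ 3 * α2 ^ 6 * α0 ^ 3 * tx k * dx k + ty k * tz k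

/-! ### The algebra behind the bilinear relations

The numbers `T` stand for the Toeplitz determinants, the other factors for their coefficients in
the `τ` functions. -/

section

variable {Q α0 α2 w w' gx gy gz B C D E ε : ℂ}

/-- Here `B, C, D, E, ε` stand for `Q^k`, `α0^k`, `α2^k`, `Q^(k²)`, `(-1)^k`, and `w, w'` for the
prefactors of sizes `k`, `k + 1`. In each lemma the difference of the two sides is the determinant
relation `h` times an explicit monomial factor. -/
theorem tau_rhombus_zero_fst (hQ0 : Q ≠ 0) (h0 : α0 ≠ 0) (h2 : α2 ≠ 0) (hw : w ≠ 0) (hx : gx ≠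
    0) (hy : gy ≠ 0) (hz : gz ≠ 0) (hB : B ≠ 0) (hC : C ≠ 0) (hD : D ≠ 0) (hE : E ≠ 0) (hε : ε = 1
    ∨ ε = -1) {Ty Tz Tdx Tx' Ty' Tz' : ℂ} (h : Tz' * Ty - Tz * Ty' + (1 / α2 ^ 12) * Tdx * Tx' = 0)
    : (Q * B ^ 2) * α0 ^ 3 * ((w' * gx * ((ε * -1) * (E * B ^ 2 * Q) ^ 4 / ((B * Q) ^ 6 * (D * α2)
    ^ 6))) * Tx') * ((w * (-(Q ^ 3 / (α0 ^ 3 * α2 ^ 6)) * (gy * gz) / gx) * (D ^ 6 / (E ^ 2 * C ^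
    6))) * Tdx) = α0 ^ 6 * ((w * gy) * Ty) * ((w' * gz * ((ε * -1) * (E * B ^ 2 * Q) ^ 2 / (C * α0)
    ^ 6)) * Tz') + (Q * B ^ 2) ^ 2 * ((w' * gy) * Ty') * ((w * gz * (ε * E ^ 2 / C ^ 6)) * Tz) :=
    by
  refine sub_eq_zero.1 (Eq.trans ?_ (mul_eq_zero_of_right
    (-(α0 ^ 6 * (w * gy) * (w' * gz * ((ε * -1) * (E * B ^ 2 * Q) ^ 2 / (C * α0) ^ 6)))) h))
  rcases hε with rfl | rfl <;> field_simp <;> ring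

theorem tau_rhombus_zero_snd (hQ0 : Q ≠ 0) (h0 : α0 ≠ 0) (h2 : α2 ≠ 0) (hw : w ≠ 0) (hx : gx ≠
    0) (hy : gy ≠ 0) (hz : gz ≠ 0) (hB : B ≠ 0) (hC : C ≠ 0) (hD : D ≠ 0) (hE : E ≠ 0) (hε : ε = 1
    ∨ ε = -1) {Tx Ty Tz Ty' Tz' Tdx' : ℂ} (h : B ^ 12 * Ty * Tz' - α0 ^ 12 * B ^ 12 * Ty' * Tz - Tx
    * Tdx' = 0) : (Q * B ^ 2) * α0 ^ 3 * ((w * gx * (ε * E ^ 4 / (B ^ 6 * D ^ 6))) * Tx) * ((w' *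
    (-(Q ^ 3 / (α0 ^ 3 * α2 ^ 6)) * (gy * gz) / gx) * ((D * α2) ^ 6 / ((E * B ^ 2 * Q) ^ 2 * (C *
    α0) ^ 6))) * Tdx') = (Q * B ^ 2) ^ 2 * α0 ^ 6 * ((w' * gy) * Ty') * ((w * gz * (ε * E ^ 2 / C ^
    6)) * Tz) + ((w * gy) * Ty) * ((w' * gz * ((ε * -1) * (E * B ^ 2 * Q) ^ 2 / (C * α0) ^ 6)) *
    Tz') := by
  refine sub_eq_zero.1 (Eq.trans ?_ (mul_eq_zero_of_right
    (-((w * gy) * (w' * gz * ((ε * -1) * (E * B ^ 2 * Q) ^ 2 / (C * α0) ^ 6)) / B ^ 12)) h))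
  rcases hε with rfl | rfl <;> field_simp <;> ring

theorem tau_rhombus_one_fst (hQ0 : Q ≠ 0) (h0 : α0 ≠ 0) (h2 : α2 ≠ 0) (hw : w ≠ 0) (hx : gx ≠
    0) (hy : gy ≠ 0) (hz : gz ≠ 0) (hB : B ≠ 0) (hC : C ≠ 0) (hD : D ≠ 0) (hE : E ≠ 0) (hε : ε = 1
    ∨ ε = -1) {Tx Tz Tdy Tx' Ty' Tz' : ℂ} (h : Tz' * Tx + (1 / α2 ^ 12) * Tz * Tx' - Tdy * Ty' = 0)
    : (Q * B ^ 2) * (Q / (α0 * α2)) ^ 3 * ((w' * gy) * Ty') * ((w * (-(α2 ^ 3 / α0 ^ 3) * (gx * gz)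
    / gy) * (E ^ 6 / (C ^ 6 * D ^ 6))) * Tdy) = (Q / (α0 * α2)) ^ 6 * ((w * gz * (ε * E ^ 2 / C ^
    6)) * Tz) * ((w' * gx * ((ε * -1) * (E * B ^ 2 * Q) ^ 4 / ((B * Q) ^ 6 * (D * α2) ^ 6))) * Tx')
    + (Q * B ^ 2) ^ 2 * ((w' * gz * ((ε * -1) * (E * B ^ 2 * Q) ^ 2 / (C * α0) ^ 6)) * Tz') * ((w *
    gx * (ε * E ^ 4 / (B ^ 6 * D ^ 6))) * Tx) := by
  refine sub_eq_zero.1 (Eq.trans ?_ (mul_eq_zero_of_right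
    (-((Q * B ^ 2) ^ 2 * (w' * gz * ((ε * -1) * (E * B ^ 2 * Q) ^ 2 / (C * α0) ^ 6)) * (w * gx * (ε
    * E ^ 4 / (B ^ 6 * D ^ 6))))) h))
  rcases hε with rfl | rfl <;> field_simp <;> ring

theorem tau_rhombus_one_snd (hQ0 : Q ≠ 0) (h0 : α0 ≠ 0) (h2 : α2 ≠ 0) (hw : w ≠ 0) (hx : gx ≠
    0) (hy : gy ≠ 0) (hz : gz ≠ 0) (hB : B ≠ 0) (hC : C ≠ 0) (hD : D ≠ 0) (hE : E ≠ 0) (hε : ε = 1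
    ∨ ε = -1) {Tx Ty Tz Tx' Tz' Tdy' : ℂ} (h : B ^ 12 * Ty * Tdy' - (α0 ^ 12 / Q ^ 12) * Tx' * Tz -
    Tx * Tz' = 0) : (Q * B ^ 2) * (Q / (α0 * α2)) ^ 3 * ((w * gy) * Ty) * ((w' * (-(α2 ^ 3 / α0 ^
    3) * (gx * gz) / gy) * ((E * B ^ 2 * Q) ^ 6 / ((C * α0) ^ 6 * (D * α2) ^ 6))) * Tdy') = (Q * B
    ^ 2) ^ 2 * (Q / (α0 * α2)) ^ 6 * ((w' * gz * ((ε * -1) * (E * B ^ 2 * Q) ^ 2 / (C * α0) ^ 6)) *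
    Tz') * ((w * gx * (ε * E ^ 4 / (B ^ 6 * D ^ 6))) * Tx) + ((w * gz * (ε * E ^ 2 / C ^ 6)) * Tz)
    * ((w' * gx * ((ε * -1) * (E * B ^ 2 * Q) ^ 4 / ((B * Q) ^ 6 * (D * α2) ^ 6))) * Tx') := by
  refine sub_eq_zero.1 (Eq.trans ?_ (mul_eq_zero_of_right
    ((Q * B ^ 2) ^ 2 * (Q / (α0 * α2)) ^ 6 * (w' * gz * ((ε * -1) * (E * B ^ 2 * Q) ^ 2 / (C * α0)
    ^ 6)) * (w * gx * (ε * E ^ 4 / (B ^ 6 * D ^ 6)))) h))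
  rcases hε with rfl | rfl <;> field_simp <;> ring

theorem tau_rhombus_two_fst (hQ0 : Q ≠ 0) (h0 : α0 ≠ 0) (h2 : α2 ≠ 0) (hw : w ≠ 0) (hx : gx ≠
    0) (hy : gy ≠ 0) (hz : gz ≠ 0) (hB : B ≠ 0) (hC : C ≠ 0) (hD : D ≠ 0) (hE : E ≠ 0) (hε : ε = 1
    ∨ ε = -1) {Tx Ty Tdz Tx' Ty' Tz' : ℂ} (h : Tdz * Tz' - Tx * Ty' + (1 / α2 ^ 12) * B ^ 12 * Ty *
    Tx' = 0) : (Q * B ^ 2) * α2 ^ 3 * ((w' * gz * ((ε * -1) * (E * B ^ 2 * Q) ^ 2 / (C * α0) ^ 6))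
    * Tz') * ((w * (-(α0 ^ 6 * α2 ^ 3 / Q ^ 3) * (gx * gy) / gz) * (E ^ 2 * C ^ 6 / (B ^ 12 * D ^
    6))) * Tdz) = α2 ^ 6 * ((w * gx * (ε * E ^ 4 / (B ^ 6 * D ^ 6))) * Tx) * ((w' * gy) * Ty') + (Q
    * B ^ 2) ^ 2 * ((w' * gx * ((ε * -1) * (E * B ^ 2 * Q) ^ 4 / ((B * Q) ^ 6 * (D * α2) ^ 6))) *
    Tx') * ((w * gy) * Ty) := by
  refine sub_eq_zero.1 (Eq.trans ?_ (mul_eq_zero_of_right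
    (α2 ^ 6 * (w * gx * (ε * E ^ 4 / (B ^ 6 * D ^ 6))) * (w' * gy)) h))
  rcases hε with rfl | rfl <;> field_simp <;> ring

theorem tau_rhombus_two_snd (hQ0 : Q ≠ 0) (h2 : α2 ≠ 0) (hw : w ≠ 0) (hx : gx ≠
    0) (hy : gy ≠ 0) (hz : gz ≠ 0) (hB : B ≠ 0) (hC : C ≠ 0) (hD : D ≠ 0) (hE : E ≠ 0) (hε : ε = 1
    ∨ ε = -1) {Tx Ty Tz Tx' Ty' Tdz' : ℂ} (h : (α0 ^ 12 / Q ^ 12) * Tdz' * Tz - B ^ 12 * Ty * Tx' +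
    Tx * Ty' = 0) : (Q * B ^ 2) * α2 ^ 3 * ((w * gz * (ε * E ^ 2 / C ^ 6)) * Tz) * ((w' * (-(α0 ^ 6
    * α2 ^ 3 / Q ^ 3) * (gx * gy) / gz) * ((E * B ^ 2 * Q) ^ 2 * (C * α0) ^ 6 / ((B * Q) ^ 12 * (D
    * α2) ^ 6))) * Tdz') = (Q * B ^ 2) ^ 2 * α2 ^ 6 * ((w' * gx * ((ε * -1) * (E * B ^ 2 * Q) ^ 4 /
    ((B * Q) ^ 6 * (D * α2) ^ 6))) * Tx') * ((w * gy) * Ty) + ((w * gx * (ε * E ^ 4 / (B ^ 6 * D ^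
    6))) * Tx) * ((w' * gy) * Ty') := by
  refine sub_eq_zero.1 (Eq.trans ?_ (mul_eq_zero_of_right
    (-((w * gx * (ε * E ^ 4 / (B ^ 6 * D ^ 6))) * (w' * gy))) h))
  rcases hε with rfl | rfl <;> field_simp <;> ring

/-- The prefactor of size `k + 2` is eliminated by its Toda relation, which is where `-(α0^8 α2^4)⁻¹
w'² / w` comes from. -/
theorem tau_toda_zy (hQ0 : Q ≠ 0) (h0 : α0 ≠ 0) (h2 : α2 ≠ 0) (hw : w ≠ 0) (hx : gx ≠ 0) (hy :
    gy ≠ 0) (hz : gz ≠ 0) (hB : B ≠ 0) (hC : C ≠ 0) (hD : D ≠ 0) (hE : E ≠ 0) (hε : ε = 1 ∨ ε = -1)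
    {Ty Tx' Ty' Tz' Tdx' Tz'' : ℂ} (h : B ^ 12 * Ty * Tz'' - (α0 ^ 12 / Q ^ 12) * (B ^ 12 * Q ^ 12
    * Ty' * Tz' - Tx' * Tdx') = 0) : (Q * B ^ 2) ^ 2 * α0 ^ 4 * (Q / (α0 * α2)) ^ 2 * (((-(α0 ^ 8 *
    α2 ^ 4)⁻¹ * w' ^ 2 / w) * gz * (ε * (E * B ^ 4 * Q ^ 4) ^ 2 / (C * α0 ^ 2) ^ 6)) * Tz'') * ((w
    * gy) * Ty) = (Q * B ^ 2) ^ 4 * α0 ^ 6 * (Q / (α0 * α2)) ^ 6 * ((w' * gz * ((ε * -1) * (E * B ^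
    2 * Q) ^ 2 / (C * α0) ^ 6)) * Tz') * ((w' * gy) * Ty') + (Q * B ^ 2) * α0 ^ 3 * ((w' * gx * ((ε
    * -1) * (E * B ^ 2 * Q) ^ 4 / ((B * Q) ^ 6 * (D * α2) ^ 6))) * Tx') * ((w' * (-(Q ^ 3 / (α0 ^ 3
    * α2 ^ 6)) * (gy * gz) / gx) * ((D * α2) ^ 6 / ((E * B ^ 2 * Q) ^ 2 * (C * α0) ^ 6))) * Tdx')
    := by
  refine sub_eq_zero.1 (Eq.trans ?_ (mul_eq_zero_of_right
    ((Q * B ^ 2) ^ 2 * α0 ^ 4 * (Q / (α0 * α2)) ^ 2 * ((-(α0 ^ 8 * α2 ^ 4)⁻¹ * w' ^ 2 / w) * gz *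
    (ε * (E * B ^ 4 * Q ^ 4) ^ 2 / (C * α0 ^ 2) ^ 6)) * (w * gy) / B ^ 12) h))
  rcases hε with rfl | rfl <;> field_simp <;> ring

theorem tau_toda_zx (hQ0 : Q ≠ 0) (h0 : α0 ≠ 0) (h2 : α2 ≠ 0) (hw : w ≠ 0) (hx : gx ≠ 0) (hy :
    gy ≠ 0) (hz : gz ≠ 0) (hB : B ≠ 0) (hC : C ≠ 0) (hD : D ≠ 0) (hE : E ≠ 0) (hε : ε = 1 ∨ ε = -1)
    {Tx Tx' Ty' Tz' Tdy' Tz'' : ℂ} (h : Tx * Tz'' - (α0 ^ 12 / Q ^ 12) * (B ^ 12 * Q ^ 12 * Ty' *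
    Tdy' - Tx' * Tz') = 0) : (Q * B ^ 2) ^ 2 * α0 ^ 4 * (Q / (α0 * α2)) ^ 2 * (((-(α0 ^ 8 * α2 ^
    4)⁻¹ * w' ^ 2 / w) * gz * (ε * (E * B ^ 4 * Q ^ 4) ^ 2 / (C * α0 ^ 2) ^ 6)) * Tz'') * ((w * gx
    * (ε * E ^ 4 / (B ^ 6 * D ^ 6))) * Tx) = (Q * B ^ 2) ^ 3 * α0 ^ 6 * (Q / (α0 * α2)) ^ 3 * ((w'
    * gy) * Ty') * ((w' * (-(α2 ^ 3 / α0 ^ 3) * (gx * gz) / gy) * ((E * B ^ 2 * Q) ^ 6 / ((C * α0)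
    ^ 6 * (D * α2) ^ 6))) * Tdy') + ((w' * gz * ((ε * -1) * (E * B ^ 2 * Q) ^ 2 / (C * α0) ^ 6)) *
    Tz') * ((w' * gx * ((ε * -1) * (E * B ^ 2 * Q) ^ 4 / ((B * Q) ^ 6 * (D * α2) ^ 6))) * Tx') :=
    by
  refine sub_eq_zero.1 (Eq.trans ?_ (mul_eq_zero_of_right
    ((Q * B ^ 2) ^ 2 * α0 ^ 4 * (Q / (α0 * α2)) ^ 2 * ((-(α0 ^ 8 * α2 ^ 4)⁻¹ * w' ^ 2 / w) * gz *
    (ε * (E * B ^ 4 * Q ^ 4) ^ 2 / (C * α0 ^ 2) ^ 6)) * (w * gx * (ε * E ^ 4 / (B ^ 6 * D ^ 6))))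
    h))
  rcases hε with rfl | rfl <;> field_simp <;> ring

theorem tau_toda_xz (hQ0 : Q ≠ 0) (h0 : α0 ≠ 0) (h2 : α2 ≠ 0) (hw : w ≠ 0) (hx : gx ≠ 0) (hy :
    gy ≠ 0) (hz : gz ≠ 0) (hB : B ≠ 0) (hC : C ≠ 0) (hD : D ≠ 0) (hE : E ≠ 0) (hε : ε = 1 ∨ ε = -1)
    {Tz Tx' Ty' Tz' Tdy' Tx'' : ℂ} (h : (1 / α2 ^ 12) * Tz * Tx'' - (Tdy' * Ty' - Tz' * Tx') = 0) :
    (Q * B ^ 2) ^ 2 * (Q / (α0 * α2)) ^ 4 * α2 ^ 2 * (((-(α0 ^ 8 * α2 ^ 4)⁻¹ * w' ^ 2 / w) * gx *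
    (ε * (E * B ^ 4 * Q ^ 4) ^ 4 / ((B * Q ^ 2) ^ 6 * (D * α2 ^ 2) ^ 6))) * Tx'') * ((w * gz * (ε *
    E ^ 2 / C ^ 6)) * Tz) = (Q * B ^ 2) ^ 4 * (Q / (α0 * α2)) ^ 6 * α2 ^ 6 * ((w' * gx * ((ε * -1)
    * (E * B ^ 2 * Q) ^ 4 / ((B * Q) ^ 6 * (D * α2) ^ 6))) * Tx') * ((w' * gz * ((ε * -1) * (E * B
    ^ 2 * Q) ^ 2 / (C * α0) ^ 6)) * Tz') + (Q * B ^ 2) * (Q / (α0 * α2)) ^ 3 * ((w' * gy) * Ty') *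
    ((w' * (-(α2 ^ 3 / α0 ^ 3) * (gx * gz) / gy) * ((E * B ^ 2 * Q) ^ 6 / ((C * α0) ^ 6 * (D * α2)
    ^ 6))) * Tdy') := by
  refine sub_eq_zero.1 (Eq.trans ?_ (mul_eq_zero_of_right
    ((Q * B ^ 2) ^ 2 * (Q / (α0 * α2)) ^ 4 * α2 ^ 2 * ((-(α0 ^ 8 * α2 ^ 4)⁻¹ * w' ^ 2 / w) * gx *
    (ε * (E * B ^ 4 * Q ^ 4) ^ 4 / ((B * Q ^ 2) ^ 6 * (D * α2 ^ 2) ^ 6))) * (w * gz * (ε * E ^ 2 /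
    C ^ 6)) / (1 / α2 ^ 12)) h))
  rcases hε with rfl | rfl <;> field_simp <;> ring

theorem tau_toda_yz (hQ0 : Q ≠ 0) (h0 : α0 ≠ 0) (h2 : α2 ≠ 0) (hw : w ≠ 0) (hx : gx ≠ 0) (hy :
    gy ≠ 0) (hz : gz ≠ 0) (hB : B ≠ 0) (hC : C ≠ 0) (hD : D ≠ 0) (hE : E ≠ 0) (hε : ε = 1 ∨ ε = -1)
    {Tz Tx' Ty' Tz' Tdx' Ty'' : ℂ} (h : Tz * Ty'' - (Tz' * Ty' - Tdx' * Tx') = 0) : (Q * B ^ 2) ^ 2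
    * α2 ^ 4 * α0 ^ 2 * (((-(α0 ^ 8 * α2 ^ 4)⁻¹ * w' ^ 2 / w) * gy) * Ty'') * ((w * gz * (ε * E ^ 2
    / C ^ 6)) * Tz) = (Q * B ^ 2) ^ 3 * α2 ^ 6 * α0 ^ 3 * ((w' * gx * ((ε * -1) * (E * B ^ 2 * Q) ^
    4 / ((B * Q) ^ 6 * (D * α2) ^ 6))) * Tx') * ((w' * (-(Q ^ 3 / (α0 ^ 3 * α2 ^ 6)) * (gy * gz) /
    gx) * ((D * α2) ^ 6 / ((E * B ^ 2 * Q) ^ 2 * (C * α0) ^ 6))) * Tdx') + ((w' * gy) * Ty') * ((w'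
    * gz * ((ε * -1) * (E * B ^ 2 * Q) ^ 2 / (C * α0) ^ 6)) * Tz') := by
  refine sub_eq_zero.1 (Eq.trans ?_ (mul_eq_zero_of_right
    ((Q * B ^ 2) ^ 2 * α2 ^ 4 * α0 ^ 2 * ((-(α0 ^ 8 * α2 ^ 4)⁻¹ * w' ^ 2 / w) * gy) * (w * gz * (ε
    * E ^ 2 / C ^ 6))) h))
  rcases hε with rfl | rfl <;> field_simp <;> ring

end

end QP3

end

/-! ### From determinant identities to the relations on a triangle -/

noncomputable section

namespace QP3

theorem latticeToeplitz_zero (f : ℤ → ℤ → ℂ) (n m : ℤ) : latticeToeplitz f 0 n m = 1 := by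
  simp [latticeToeplitz, toeplitz]

/-- The determinant relations are used at `n = 0`, `m = -1`. There `y p^m = α2^(-12)`, so `h12` is
the condition under which the third rhombus relation can be solved. -/
theorem LocalTau.triangleRel {Q α0 α2 : ℂ} (hQ0 : Q ≠ 0) (h0 : α0 ≠ 0) (h2 : α2 ≠ 0)
    (h12 : α2 ^ 12 ≠ 1) {tx ty tz dx dy dz : ℤ → ℂ} (h : LocalTau Q α0 α2 tx ty tz dx dy dz) :
    TriangleRel Q α0 (alpha1 Q α0 α2) α2 tx ty tz dx dy dz := by
  obtain ⟨neg, w, gx, gy, gz, hx, hy, hz, f, hf, hw0, hw, hw2, nx, ny, nz, ex, ey, ez, H⟩ := h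
  replace ex := eq_div_of_mul_eq nx ((mul_comm _ _).trans ex)
  replace ey := eq_div_of_mul_eq ny ((mul_comm _ _).trans ey)
  replace ez := eq_div_of_mul_eq nz ((mul_comm _ _).trans ez)
  subst ex ey ez
  have hp0 : Q ^ 12 ≠ 0 := pow_ne_zero _ hQ0
  have hX : α0 ^ 12 ≠ 0 := pow_ne_zero _ h0
  have hY : Q ^ 12 / α2 ^ 12 * (Q ^ 12) ^ (-1 : ℤ) = 1 / α2 ^ 12 := by
    rw [zpow_neg_one]; field_simp
  have hY1 : Q ^ 12 / α2 ^ 12 * (Q ^ 12) ^ (-1 : ℤ) ≠ 1 := by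
    rw [hY, ne_eq, div_eq_one_iff_eq (pow_ne_zero _ h2)]
    exact h12.symm
  have hYk : ∀ k : ℕ, Q ^ 12 / α2 ^ 12 * (Q ^ 12) ^ (-1 + (k : ℤ)) =
      1 / α2 ^ 12 * (Q ^ k) ^ 12 := fun k => by
    rw [zpow_add₀ hp0, ← mul_assoc, hY, zpow_natCast, pow_right_comm]
  have hX1 : α0 ^ 12 * (Q ^ 12) ^ (-1 : ℤ) = α0 ^ 12 / Q ^ 12 := by
    rw [zpow_neg_one, div_eq_mul_inv]
  have hXk : ∀ k : ℕ, α0 ^ 12 * (Q ^ 12) ^ (k : ℤ) = α0 ^ 12 * (Q ^ k) ^ 12 := fun k => by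
    rw [zpow_natCast, pow_right_comm]
  have hpk : ∀ k : ℕ, (Q ^ 12) ^ k = (Q ^ k) ^ 12 := fun k => pow_right_comm _ _ _
  have hpk1 : ∀ k : ℕ, (Q ^ 12) ^ (k + 1) = (Q ^ k) ^ 12 * Q ^ 12 := fun k => by
    rw [pow_succ, hpk]
  have hε : ∀ k : ℕ, (-1 : ℂ) ^ k = 1 ∨ (-1 : ℂ) ^ k = -1 := neg_one_pow_eq_or ℂ
  have c1 : ∀ k : ℕ, Q ^ (k + 1) ^ 2 = Q ^ k ^ 2 * (Q ^ k) ^ 2 * Q := fun k => by ring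
  have c2 : ∀ k : ℕ, Q ^ (k + 2) ^ 2 = Q ^ k ^ 2 * (Q ^ k) ^ 4 * Q ^ 4 := fun k => by ring
  have c3 : ∀ (a : ℂ) (k : ℕ), a ^ (k + 1) = a ^ k * a := fun a k => pow_succ a k
  have c4 : ∀ (a : ℂ) (k : ℕ), a ^ (k + 2) = a ^ k * a ^ 2 := fun a k => pow_add a k 2
  have hwk : ∀ k : ℕ, w (k + 2) = -(α0 ^ 8 * α2 ^ 4)⁻¹ * w (k + 1) ^ 2 / w k := fun k =>
    eq_div_of_mul_eq (hw k) (hw2 k)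
  have nQ : ∀ k : ℕ, Q ^ k ≠ 0 := fun k => pow_ne_zero k hQ0
  have nQ2 : ∀ k : ℕ, Q ^ k ^ 2 ≠ 0 := fun k => pow_ne_zero _ hQ0
  have n0 : ∀ k : ℕ, α0 ^ k ≠ 0 := fun k => pow_ne_zero k h0
  have n2 : ∀ k : ℕ, α2 ^ k ≠ 0 := fun k => pow_ne_zero k h2
  have i4 : ∀ k : ℕ, (Q ^ (k + 1)) ^ 2 / Q = Q * (Q ^ k) ^ 2 := fun k => by
    field_simp; ring
  unfold alpha1
  refine ⟨fun N hN => ⟨(neg N hN).1, (neg N hN).2.1, (neg N hN).2.2.1⟩, fun k => ?_, fun k => ?_⟩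
  · obtain ⟨x0, y0, z0, dx0, dy0, dz0⟩ := H k
    obtain ⟨x1, y1, z1, dx1, dy1, dz1⟩ := H (k + 1)
    rw [Nat.cast_succ] at *
    rw [c1 k, c3 Q k, c3 α2 k, c3 (-1) k] at x1
    rw [c1 k, c3 α0 k, c3 (-1) k] at z1
    rw [c1 k, c3 α0 k, c3 α2 k] at dx1 dy1
    rw [c1 k, c3 Q k, c3 α0 k, c3 α2 k] at dz1
    rw [x0, y0, z0, dx0, dy0, dz0, x1, y1, z1, dx1, dy1, dz1]
    have r1 := hf.rhombus_zero k 0 (-1)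
    have r2 := hf.rhombus_zero' hp0 hX k 0 (-1)
    have r3 := hf.rhombus_one k 0 (-1)
    have r4 := hf.rhombus_one' hp0 hX k 0 (-1)
    have r5 := hf.rhombus_two hp0 hX k 0 (-1) hY1
    have r6 := hf.rhombus_two' hp0 hX k 0 (-1) hY1
    rw [hY] at r1 r3
    rw [hYk] at r5
    rw [hpk] at r2 r4 r6
    simp only [Int.reduceSub, Int.reduceNeg, zero_add, zero_sub, neg_add_cancel]
      at r1 r2 r3 r4 r5 r6
    rw [hXk] at r2
    rw [hX1] at r4 r6
    have a := hw k
    have b := hw (k + 1)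
    refine ⟨⟨tau_rhombus_zero_fst hQ0 h0 h2 a nx ny nz (nQ k) (n0 k) (n2 k) (nQ2 k) (hε k) ?_,
      tau_rhombus_zero_snd hQ0 h0 h2 a nx ny nz (nQ k) (n0 k) (n2 k) (nQ2 k) (hε k) ?_⟩,
      ⟨tau_rhombus_one_fst hQ0 h0 h2 a nx ny nz (nQ k) (n0 k) (n2 k) (nQ2 k) (hε k) ?_,
      tau_rhombus_one_snd hQ0 h0 h2 a nx ny nz (nQ k) (n0 k) (n2 k) (nQ2 k) (hε k) ?_⟩,
      tau_rhombus_two_fst hQ0 h0 h2 a nx ny nz (nQ k) (n0 k) (n2 k) (nQ2 k) (hε k) ?_,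
      tau_rhombus_two_snd hQ0 h2 a nx ny nz (nQ k) (n0 k) (n2 k) (nQ2 k) (hε k) ?_⟩
    · linear_combination r1
    · linear_combination r2
    · linear_combination r3
    · linear_combination r4
    · linear_combination r5
    · linear_combination r6
  · cases k with
    -- Size `-1` contributes zero and all determinants of size `0` are `1`, so these relations
    -- reduce to the gamma identities on the rhombi.
    | zero =>
      obtain ⟨x0, y0, z0, dx0, dy0, -⟩ := H 0
      obtain ⟨x1, y1, z1, -⟩ := neg (-1) (by norm_num)
      simp only [Nat.cast_zero, pow_zero, hw0, latticeToeplitz_zero] at x0 y0 z0 dx0 dy0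
      norm_num at x0 y0 z0 dx0 dy0
      simp only [Nat.cast_zero, zero_sub, x0, y0, z0, dx0, dy0, x1, y1, z1, pow_zero]
      refine ⟨?_, ?_, ?_, ?_⟩ <;> · field_simp; ring
    | succ k =>
      obtain ⟨x0, y0, z0, -, -, -⟩ := H k
      obtain ⟨x1, y1, z1, dx1, dy1, dz1⟩ := H (k + 1)
      obtain ⟨x2, y2, z2, -⟩ := H (k + 2)
      have r1 := hf.toda_zy hp0 hX k 0 (-1)
      have r2 := hf.toda_zx hp0 hX k 0 (-1)
      have r3 := hf.toda_xz k 0 (-1)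
      have r4 := hf.toda_yz k 0 (-1)
      simp only [Int.reduceNeg, zero_add, zero_sub, neg_add_cancel] at r1 r2 r3 r4
      rw [hpk, hpk1, hX1] at r1
      rw [hpk1, hX1] at r2
      rw [hY] at r3
      rw [c1 k, c3 Q k, c3 α2 k, c3 (-1) k] at x1
      rw [c1 k, c3 α0 k, c3 (-1) k] at z1
      rw [c1 k, c3 α0 k, c3 α2 k] at dx1 dy1
      rw [c2 k, c4 Q k, c4 α2 k, c4 (-1) k, neg_one_sq, mul_one, hwk] at x2
      rw [c2 k, c4 α0 k, c4 (-1) k, neg_one_sq, mul_one, hwk] at z2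
      rw [hwk] at y2
      have e1 : ((k + 1 : ℕ) : ℤ) + 1 = (k + 2 : ℕ) := rfl
      have e2 : ((k + 1 : ℕ) : ℤ) - 1 = k := by push_cast; ring
      rw [e1, e2, i4, x0, y0, z0, x1, y1, z1, dx1, dy1, x2, y2, z2]
      have a := hw k
      refine ⟨tau_toda_zy hQ0 h0 h2 a nx ny nz (nQ k) (n0 k) (n2 k) (nQ2 k) (hε k) ?_,
        tau_toda_zx hQ0 h0 h2 a nx ny nz (nQ k) (n0 k) (n2 k) (nQ2 k) (hε k) ?_,
        tau_toda_xz hQ0 h0 h2 a nx ny nz (nQ k) (n0 k) (n2 k) (nQ2 k) (hε k) ?_,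
        tau_toda_yz hQ0 h0 h2 a nx ny nz (nQ k) (n0 k) (n2 k) (nQ2 k) (hε k) ?_⟩
      · linear_combination r1
      · linear_combination r2
      · linear_combination r3
      · linear_combination r4

end QP3

end

noncomputable section

namespace QP3

/-! ## The birational action on the lattice -/

/-- This is the involutivity of a reflection: read from the opposite vertex, the rhombus has inverse
parameter, exchanged `y` and `z`, and exchanged halves of the relation. -/
theorem RhombusRel.symm {κ a x y z d x' y' z' d' : ℂ} (ha : a ≠ 0)
    (h : RhombusRel κ a x y z d x' y' z' d') : RhombusRel κ a⁻¹ d y z x d' y' z' x' := by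
  obtain ⟨hU, hV⟩ := h
  constructor
  · field_simp
    linear_combination hV
  · field_simp
    linear_combination hU

section

variable {Q γ a0 a1 a2 x y z x' y' z' : ℂ}

theorem rhombus_div_fst {κ a d : ℂ} (hκ : κ ≠ 0) (ha : a ≠ 0) (hx : x' ≠ 0)
    (h : κ * a ^ 3 * x' * d = a ^ 6 * y * z' + κ ^ 2 * y' * z) :
    (κ⁻¹ ^ 2 * a ^ 6 * y * z' + y' * z) / (κ⁻¹ * a ^ 3 * x') = d := by
  rw [div_eq_iff (by simp [hκ, ha, hx])]
  field_simp
  linear_combination -h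

theorem rhombus_div_snd {κ a d : ℂ} (hκ : κ ≠ 0) (ha : a ≠ 0) (hx : x ≠ 0)
    (h : κ * a ^ 3 * x * d = κ ^ 2 * a ^ 6 * y' * z + y * z') :
    (κ ^ 2 * a ^ 6 * y' * z + y * z') / (κ * a ^ 3 * x) = d := by
  rw [div_eq_iff (by simp [hκ, ha, hx])]
  linear_combination -h

theorem Point.u_eq (P : Point) (i : Fin 3) :
    P.u Q i = (Q * P.γ ^ 2)⁻¹ ^ 2 * P.α i ^ 6 := by
  unfold Point.u
  rw [zpow_neg, zpow_neg]
  norm_cast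
  rw [mul_inv, mul_pow, inv_pow, inv_pow, ← pow_mul]

theorem Point.v_eq (P : Point) (i : Fin 3) : P.v Q i = (Q * P.γ ^ 2) ^ 2 * P.α i ^ 6 := by
  unfold Point.v; ring

theorem Point.sqrtU_eq (P : Point) (i : Fin 3) : P.sqrtU Q i = (Q * P.γ ^ 2)⁻¹ * P.α i ^ 3 := by
  unfold Point.sqrtU
  rw [zpow_neg, mul_inv]
  norm_cast

theorem Point.sqrtV_eq (P : Point) (i : Fin 3) : P.sqrtV Q i = Q * P.γ ^ 2 * P.α i ^ 3 := rfl

theorem s_one (hQ : Q ≠ 0) (hγ : γ ≠ 0) (ha : a1 ≠ 0) (hy : y ≠ 0) (hy' : y' ≠ 0) {d d' : ℂ}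
    (h : RhombusRel (Q * γ ^ 2) a1 y z x d y' z' x' d') :
    s Q 1 ⟨![a0, a1, a2], γ, ![x, y, z], ![x', y', z']⟩ =
      ⟨![a0 * a1, a1⁻¹, a2 * a1], γ, ![x, d, z], ![x', d', z']⟩ := by
  have hκ : Q * γ ^ 2 ≠ 0 := mul_ne_zero hQ (pow_ne_zero _ hγ)
  have e : ∀ a b c e : ℂ, Function.update ![a, b, c] 1 e = ![a, e, c] := fun a b c e => by
    ext i; fin_cases i <;> rfl
  refine Point.ext ?_ rfl ?_ ?_
  · ext i
    fin_cases i
    · simp [s, cartan]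
    · simp only [s, cartan]
      simp only [Fin.mk_one, Matrix.of_apply, Matrix.cons_val', Matrix.cons_val_one,
        Matrix.cons_val_zero, zpow_neg, ← div_eq_mul_inv]
      rw [div_eq_iff (zpow_ne_zero _ ha)]
      field_simp
    · simp [s, cartan]
  · simp only [s, e, Point.u_eq, Point.sqrtU_eq]
    exact congrArg (fun e => ![x, e, z]) (rhombus_div_fst hκ ha hy' h.1)
  · simp only [s, e, Point.v_eq, Point.sqrtV_eq]
    exact congrArg (fun e => ![x', e, z']) (rhombus_div_snd hκ ha hy h.2)

theorem s_two (hQ : Q ≠ 0) (hγ : γ ≠ 0) (ha : a2 ≠ 0) (hz : z ≠ 0) (hz' : z' ≠ 0) {d d' : ℂ}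
    (h : RhombusRel (Q * γ ^ 2) a2 z x y d z' x' y' d') :
    s Q 2 ⟨![a0, a1, a2], γ, ![x, y, z], ![x', y', z']⟩ =
      ⟨![a0 * a2, a1 * a2, a2⁻¹], γ, ![x, y, d], ![x', y', d']⟩ := by
  have hκ : Q * γ ^ 2 ≠ 0 := mul_ne_zero hQ (pow_ne_zero _ hγ)
  have e : ∀ a b c e : ℂ, Function.update ![a, b, c] 2 e = ![a, b, e] := fun a b c e => by
    ext i; fin_cases i <;> rfl
  refine Point.ext ?_ rfl ?_ ?_
  · ext i
    fin_cases i
    · simp [s, cartan]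
    · simp [s, cartan]
    · simp [s, cartan]
      field_simp
  · simp only [s, e, Point.u_eq, Point.sqrtU_eq]
    exact congrArg (fun e => ![x, y, e]) (rhombus_div_fst hκ ha hz' h.1)
  · simp only [s, e, Point.v_eq, Point.sqrtV_eq]
    exact congrArg (fun e => ![x', y', e]) (rhombus_div_snd hκ ha hz h.2)

theorem rot_mk : rot ⟨![a0, a1, a2], γ, ![x, y, z], ![x', y', z']⟩ =
    ⟨![a1, a2, a0], γ, ![y, z, x], ![y', z', x']⟩ := by
  ext i <;> first | rfl | (fin_cases i <;> rfl)

theorem rotInv_mk : rotInv ⟨![a0, a1, a2], γ, ![x, y, z], ![x', y', z']⟩ =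
    ⟨![a2, a0, a1], γ, ![z, x, y], ![z', x', y']⟩ := by
  ext i <;> first | rfl | (fin_cases i <;> rfl)

theorem toda_div {a b κ t0 t1 t2 t0' t1' t2' t'' : ℂ} {c : ℂ} (hκ : κ ≠ 0) (ha : a ≠ 0)
    (hb : b ≠ 0) (h1 : t1 ≠ 0) (h2 : t2 ≠ 0)
    (h : κ ^ 2 * a ^ 4 * b ^ 2 * t'' * t1 * t2 = κ ^ 2 * a ^ 6 * t0 * t1' * t2' +
      κ ^ 2 * a ^ 6 * c * t0' * t1 * t2' + t0' * t1' * t2) :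
    a ^ 2 * (t0 * t1' * t2' + c * t0' * t1 * t2' + (κ ^ 2 * a ^ 6)⁻¹ * t0' * t1' * t2) /
      (b ^ 2 * t1 * t2) = t'' := by
  rw [div_eq_iff (by simp [hb, h1, h2])]
  field_simp
  linear_combination -h

theorem T4_mk (hQ : Q ≠ 0) (hγ : γ ≠ 0) (h0 : a0 ≠ 0) (h1 : a1 ≠ 0) (h2 : a2 ≠ 0) (hx : x ≠ 0)
    (hy : y ≠ 0) (hz : z ≠ 0) {κ x'' y'' z'' : ℂ} (hκ : κ = Q * γ ^ 2)
    (ex : κ ^ 2 * a1 ^ 4 * a2 ^ 2 * x'' * y * z = κ ^ 2 * a1 ^ 6 * x * y' * z' +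
      κ ^ 2 * a1 ^ 6 * (κ ^ 2 * a2 ^ 6) * x' * y * z' + x' * y' * z)
    (ey : κ ^ 2 * a2 ^ 4 * a0 ^ 2 * y'' * z * x = κ ^ 2 * a2 ^ 6 * y * z' * x' +
      κ ^ 2 * a2 ^ 6 * (κ ^ 2 * a0 ^ 6) * y' * z * x' + y' * z' * x)
    (ez : κ ^ 2 * a0 ^ 4 * a1 ^ 2 * z'' * x * y = κ ^ 2 * a0 ^ 6 * z * x' * y' +
      κ ^ 2 * a0 ^ 6 * (κ ^ 2 * a1 ^ 6) * z' * x * y' + z' * x' * y) :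
    T4 Q ⟨![a0, a1, a2], γ, ![x, y, z], ![x', y', z']⟩ =
      ⟨![a0, a1, a2], Q * γ, ![x', y', z'], ![x'', y'', z'']⟩ := by
  have nκ : κ ≠ 0 := by rw [hκ]; exact mul_ne_zero hQ (pow_ne_zero _ hγ)
  -- `r` acts before `w0`, so the coefficients `u_i` in `w0` are evaluated at `γ` replaced by `Q⁻¹
  -- γ⁻¹`.
  have e : (Q * (Q⁻¹ * γ⁻¹) ^ 2)⁻¹ = κ := by rw [hκ]; field_simp
  refine Point.ext rfl ?_ rfl ?_
  · simp [T4, w0, r, mul_comm]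
  · ext i
    simp only [T4, w0, r, Point.u_eq, e]
    fin_cases i
    · exact toda_div nκ h1 h2 hy hz ex
    · exact toda_div nκ h2 h0 hz hx ey
    · exact toda_div nκ h0 h1 hx hy ez

theorem T4Inv_mk (hQ : Q ≠ 0) (hγ : γ ≠ 0) (h0 : a0 ≠ 0) (h1 : a1 ≠ 0) (h2 : a2 ≠ 0)
    (hx : x' ≠ 0) (hy : y' ≠ 0) (hz : z' ≠ 0) {κ x'' y'' z'' : ℂ} (hκ : κ = (Q * γ ^ 2)⁻¹)
    (ex : κ ^ 2 * a1 ^ 4 * a2 ^ 2 * x'' * y' * z' = κ ^ 2 * a1 ^ 6 * x' * y * z +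
      κ ^ 2 * a1 ^ 6 * (κ ^ 2 * a2 ^ 6) * x * y' * z + x * y * z')
    (ey : κ ^ 2 * a2 ^ 4 * a0 ^ 2 * y'' * z' * x' = κ ^ 2 * a2 ^ 6 * y' * z * x +
      κ ^ 2 * a2 ^ 6 * (κ ^ 2 * a0 ^ 6) * y * z' * x + y * z * x')
    (ez : κ ^ 2 * a0 ^ 4 * a1 ^ 2 * z'' * x' * y' = κ ^ 2 * a0 ^ 6 * z' * x * y +
      κ ^ 2 * a0 ^ 6 * (κ ^ 2 * a1 ^ 6) * z * x' * y + z * x * y') :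
    T4Inv Q ⟨![a0, a1, a2], γ, ![x, y, z], ![x', y', z']⟩ =
      ⟨![a0, a1, a2], Q⁻¹ * γ, ![x'', y'', z''], ![x, y, z]⟩ := by
  have nκ : κ ≠ 0 := by rw [hκ]; exact inv_ne_zero (mul_ne_zero hQ (pow_ne_zero _ hγ))
  refine Point.ext rfl ?_ ?_ rfl
  · simp [T4Inv, w0, r]
  · ext i
    simp only [T4Inv, w0, r, Point.u_eq, ← hκ]
    fin_cases i
    · exact toda_div nκ h1 h2 hy hz ex
    · exact toda_div nκ h2 h0 hz hx ey
    · exact toda_div nκ h0 h1 hx hy ez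

end

end QP3

end

/-! ### The translations `T1`, `T2`, `T3` from the rhombus relations -/

noncomputable section

namespace QP3

section

/-- The bilinear relations on all triangles of the lattices in `Ω`. -/
def IsBilinearTau (Q : ℂ) (Ω : Set (ℂ × ℂ)) (t : ℤ → ℂ → ℂ → ℂ) : Prop :=
  ∀ α0 α2, (α0, α2) ∈ Ω → TriangleRel Q α0 (alpha1 Q α0 α2) α2 (fun N => t N (Q⁻¹ * α0) α2)
    (fun N => t N α0 α2) (fun N => t N α0 (Q⁻¹ * α2)) (fun N => t N (Q * α0) (Q⁻¹ * α2))
    (fun N => t N (Q⁻¹ * α0) (Q⁻¹ * α2)) (fun N => t N (Q⁻¹ * α0) (Q * α2))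

variable {Q : ℂ} {Ω : Set (ℂ × ℂ)} {t : ℤ → ℂ → ℂ → ℂ}

theorem tauPoint_eq (k : ℕ) (α0 α2 : ℂ) : tauPoint Q t k α0 α2 =
    ⟨![α0, alpha1 Q α0 α2, α2], Q ^ k, ![t k (Q⁻¹ * α0) α2, t k α0 α2, t k α0 (Q⁻¹ * α2)],
      ![t (k + 1) (Q⁻¹ * α0) α2, t (k + 1) α0 α2, t (k + 1) α0 (Q⁻¹ * α2)]⟩ := by
  rw [← zpow_natCast]; rfl

theorem IsParameterDomain.mul_zero_mem (hΩ : IsParameterDomain Q Ω) {α0 α2 : ℂ}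
    (h : (α0, α2) ∈ Ω) : (Q * α0, α2) ∈ Ω := by simpa using hΩ.shift_zero h 1

theorem IsParameterDomain.inv_mul_zero_mem (hΩ : IsParameterDomain Q Ω) {α0 α2 : ℂ}
    (h : (α0, α2) ∈ Ω) : (Q⁻¹ * α0, α2) ∈ Ω := by simpa using hΩ.shift_zero h (-1)

theorem IsParameterDomain.mul_two_mem (hΩ : IsParameterDomain Q Ω) {α0 α2 : ℂ}
    (h : (α0, α2) ∈ Ω) : (α0, Q * α2) ∈ Ω := by simpa using hΩ.shift_two h 1

theorem IsParameterDomain.inv_mul_two_mem (hΩ : IsParameterDomain Q Ω) {α0 α2 : ℂ}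
    (h : (α0, α2) ∈ Ω) : (α0, Q⁻¹ * α2) ∈ Ω := by simpa using hΩ.shift_two h (-1)

theorem IsGeneric.alpha1_ne_zero (hQ0 : Q ≠ 0) {α0 α2 : ℂ} (hg : IsGeneric Q α0 α2) :
    alpha1 Q α0 α2 ≠ 0 :=
  div_ne_zero hQ0 (mul_ne_zero hg.ne_zero0 hg.ne_zero2)

theorem IsBilinearTau.exists_natCast (hb : IsBilinearTau Q Ω t) {α0 α2 : ℂ} (h : (α0, α2) ∈ Ω)
    {N : ℤ} (hN : t N α0 α2 ≠ 0) : ∃ k : ℕ, N = k := by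
  refine Int.eq_ofNat_of_zero_le (not_lt.1 fun hlt => hN ?_)
  exact ((hb _ _ h).neg N hlt).2.1

/-- The six variables at a regular point do not vanish. -/
theorem regular_tauPoint {N : ℤ} {α0 α2 : ℂ} (hr : (tauPoint Q t N α0 α2).Regular) :
    (t N (Q⁻¹ * α0) α2 ≠ 0 ∧ t N α0 α2 ≠ 0 ∧ t N α0 (Q⁻¹ * α2) ≠ 0) ∧
      t (N + 1) (Q⁻¹ * α0) α2 ≠ 0 ∧ t (N + 1) α0 α2 ≠ 0 ∧ t (N + 1) α0 (Q⁻¹ * α2) ≠ 0 :=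
  ⟨⟨(hr 0).1, (hr 1).1, (hr 2).1⟩, (hr 0).2, (hr 1).2, (hr 2).2⟩

/-- Two reflections carry the triangle to its translate. The first is a rhombus relation of the
original triangle; the second is a rhombus relation of the target triangle, read backwards by
`RhombusRel.symm`. The five lemmas that follow work in the same way. -/
theorem IsBilinearTau.T1_eq (hQ0 : Q ≠ 0) (hΩ : IsParameterDomain Q Ω) (hb : IsBilinearTau Q Ω t)
    {α0 α2 : ℂ} (h : (α0, α2) ∈ Ω) {N : ℤ} (hr : (tauPoint Q t N α0 α2).Regular) :
    T1 Q (tauPoint Q t N α0 α2) = tauPoint Q t N (Q * α0) α2 := by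
  obtain ⟨⟨hx, hy, hz⟩, hx', hy', hz'⟩ := regular_tauPoint hr
  obtain ⟨k, rfl⟩ := hb.exists_natCast h hy
  have hg := hΩ.generic _ _ h
  have h0 := hg.ne_zero0
  have h1 := hg.alpha1_ne_zero hQ0
  have h2 := hg.ne_zero2
  have hγ := pow_ne_zero k hQ0
  have hm := hΩ.mul_zero_mem h
  have hg' := hΩ.generic _ _ hm
  have b := ((hb _ _ hm).rhombus k).2.1.symm (hg'.alpha1_ne_zero hQ0)
  simp only [inv_mul_cancel_left₀ hQ0] at b
  rw [show (alpha1 Q (Q * α0) α2)⁻¹ = α2 * α0 by simp only [alpha1]; field_simp] at b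
  rw [tauPoint_eq, tauPoint_eq, T1, rot_mk, s_two hQ0 hγ h0 hx hx' (hb _ _ h |>.rhombus k).1,
    s_one hQ0 hγ (mul_ne_zero h2 h0) hz hz' b]
  simp only [inv_mul_cancel_left₀ hQ0]
  refine Point.ext ?_ rfl rfl rfl
  ext i
  fin_cases i <;> simp [alpha1] <;> field_simp

theorem IsBilinearTau.T1Inv_eq (hQ0 : Q ≠ 0) (hΩ : IsParameterDomain Q Ω) (hb : IsBilinearTau Q Ω t)
    {α0 α2 : ℂ} (h : (α0, α2) ∈ Ω) {N : ℤ} (hr : (tauPoint Q t N α0 α2).Regular) :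
    T1Inv Q (tauPoint Q t N α0 α2) = tauPoint Q t N (Q⁻¹ * α0) α2 := by
  obtain ⟨⟨hx, hy, hz⟩, hx', hy', hz'⟩ := regular_tauPoint hr
  obtain ⟨k, rfl⟩ := hb.exists_natCast h hy
  have hg := hΩ.generic _ _ h
  have h0 := hg.ne_zero0
  have h1 := hg.alpha1_ne_zero hQ0
  have h2 := hg.ne_zero2
  have hγ := pow_ne_zero k hQ0
  have hm := hΩ.inv_mul_zero_mem h
  have hg' := hΩ.generic _ _ hm
  have b := ((hb _ _ hm).rhombus k).1.symm hg'.ne_zero0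
  simp only [mul_inv_cancel_left₀ hQ0] at b
  rw [show (Q⁻¹ * α0)⁻¹ = α2 * alpha1 Q α0 α2 by simp only [alpha1]; field_simp] at b
  rw [tauPoint_eq, tauPoint_eq, T1Inv, s_one hQ0 hγ h1 hy hy' (hb _ _ h |>.rhombus k).2.1,
    s_two hQ0 hγ (mul_ne_zero h2 h1) hz hz' b, rotInv_mk]
  refine Point.ext ?_ rfl rfl rfl
  ext i
  fin_cases i <;> simp [alpha1] <;> field_simp

theorem IsBilinearTau.T2_eq (hQ0 : Q ≠ 0) (hΩ : IsParameterDomain Q Ω) (hb : IsBilinearTau Q Ω t)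
    {α0 α2 : ℂ} (h : (α0, α2) ∈ Ω) {N : ℤ} (hr : (tauPoint Q t N α0 α2).Regular) :
    T2 Q (tauPoint Q t N α0 α2) = tauPoint Q t N α0 (Q⁻¹ * α2) := by
  obtain ⟨⟨hx, hy, hz⟩, hx', hy', hz'⟩ := regular_tauPoint hr
  obtain ⟨k, rfl⟩ := hb.exists_natCast h hy
  have hg := hΩ.generic _ _ h
  have h0 := hg.ne_zero0
  have h1 := hg.alpha1_ne_zero hQ0
  have h2 := hg.ne_zero2
  have hγ := pow_ne_zero k hQ0
  have hm := hΩ.inv_mul_two_mem h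
  have hg' := hΩ.generic _ _ hm
  have b := ((hb _ _ hm).rhombus k).2.2.symm hg'.ne_zero2
  simp only [mul_inv_cancel_left₀ hQ0] at b
  rw [show (Q⁻¹ * α2)⁻¹ = α0 * alpha1 Q α0 α2 by simp only [alpha1]; field_simp] at b
  rw [tauPoint_eq, tauPoint_eq, T2, s_one hQ0 hγ h1 hy hy' (hb _ _ h |>.rhombus k).2.1, rot_mk,
    s_two hQ0 hγ (mul_ne_zero h0 h1) hx hx' b]
  refine Point.ext ?_ rfl rfl rfl
  ext i
  fin_cases i <;> simp [alpha1] <;> field_simp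

theorem IsBilinearTau.T2Inv_eq (hQ0 : Q ≠ 0) (hΩ : IsParameterDomain Q Ω) (hb : IsBilinearTau Q Ω t)
    {α0 α2 : ℂ} (h : (α0, α2) ∈ Ω) {N : ℤ} (hr : (tauPoint Q t N α0 α2).Regular) :
    T2Inv Q (tauPoint Q t N α0 α2) = tauPoint Q t N α0 (Q * α2) := by
  obtain ⟨⟨hx, hy, hz⟩, hx', hy', hz'⟩ := regular_tauPoint hr
  obtain ⟨k, rfl⟩ := hb.exists_natCast h hy
  have hg := hΩ.generic _ _ h
  have h0 := hg.ne_zero0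
  have h1 := hg.alpha1_ne_zero hQ0
  have h2 := hg.ne_zero2
  have hγ := pow_ne_zero k hQ0
  have hm := hΩ.mul_two_mem h
  have hg' := hΩ.generic _ _ hm
  have b := ((hb _ _ hm).rhombus k).2.1.symm (hg'.alpha1_ne_zero hQ0)
  simp only [inv_mul_cancel_left₀ hQ0] at b
  rw [show (alpha1 Q α0 (Q * α2))⁻¹ = α0 * α2 by simp only [alpha1]; field_simp] at b
  rw [tauPoint_eq, tauPoint_eq, T2Inv, s_two hQ0 hγ h2 hz hz' (hb _ _ h |>.rhombus k).2.2, rotInv_mk,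
    s_one hQ0 hγ (mul_ne_zero h0 h2) hx hx' b]
  simp only [inv_mul_cancel_left₀ hQ0]
  refine Point.ext ?_ rfl rfl rfl
  ext i
  fin_cases i <;> simp [alpha1] <;> field_simp

theorem IsBilinearTau.T3_eq (hQ0 : Q ≠ 0) (hΩ : IsParameterDomain Q Ω) (hb : IsBilinearTau Q Ω t)
    {α0 α2 : ℂ} (h : (α0, α2) ∈ Ω) {N : ℤ} (hr : (tauPoint Q t N α0 α2).Regular) :
    T3 Q (tauPoint Q t N α0 α2) = tauPoint Q t N (Q⁻¹ * α0) (Q * α2) := by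
  obtain ⟨⟨hx, hy, hz⟩, hx', hy', hz'⟩ := regular_tauPoint hr
  obtain ⟨k, rfl⟩ := hb.exists_natCast h hy
  have hg := hΩ.generic _ _ h
  have h0 := hg.ne_zero0
  have h1 := hg.alpha1_ne_zero hQ0
  have h2 := hg.ne_zero2
  have hγ := pow_ne_zero k hQ0
  have hm := hΩ.mul_two_mem (hΩ.inv_mul_zero_mem h)
  have hg' := hΩ.generic _ _ hm
  have b := ((hb _ _ hm).rhombus k).1.symm hg'.ne_zero0
  simp only [inv_mul_cancel_left₀ hQ0, mul_inv_cancel_left₀ hQ0] at b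
  rw [show (Q⁻¹ * α0)⁻¹ = alpha1 Q α0 α2 * α2 by simp only [alpha1]; field_simp] at b
  rw [tauPoint_eq, tauPoint_eq, T3, s_two hQ0 hγ h2 hz hz' (hb _ _ h |>.rhombus k).2.2,
    s_one hQ0 hγ (mul_ne_zero h1 h2) hy hy' b, rot_mk]
  simp only [inv_mul_cancel_left₀ hQ0]
  refine Point.ext ?_ rfl rfl rfl
  ext i
  fin_cases i <;> simp [alpha1] <;> field_simp

theorem IsBilinearTau.T3Inv_eq (hQ0 : Q ≠ 0) (hΩ : IsParameterDomain Q Ω) (hb : IsBilinearTau Q Ω t)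
    {α0 α2 : ℂ} (h : (α0, α2) ∈ Ω) {N : ℤ} (hr : (tauPoint Q t N α0 α2).Regular) :
    T3Inv Q (tauPoint Q t N α0 α2) = tauPoint Q t N (Q * α0) (Q⁻¹ * α2) := by
  obtain ⟨⟨hx, hy, hz⟩, hx', hy', hz'⟩ := regular_tauPoint hr
  obtain ⟨k, rfl⟩ := hb.exists_natCast h hy
  have hg := hΩ.generic _ _ h
  have h0 := hg.ne_zero0
  have h1 := hg.alpha1_ne_zero hQ0
  have h2 := hg.ne_zero2
  have hγ := pow_ne_zero k hQ0
  have hm := hΩ.inv_mul_two_mem (hΩ.mul_zero_mem h)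
  have hg' := hΩ.generic _ _ hm
  have b := ((hb _ _ hm).rhombus k).2.2.symm hg'.ne_zero2
  simp only [inv_mul_cancel_left₀ hQ0, mul_inv_cancel_left₀ hQ0] at b
  rw [show (Q⁻¹ * α2)⁻¹ = alpha1 Q α0 α2 * α0 by simp only [alpha1]; field_simp] at b
  rw [tauPoint_eq, tauPoint_eq, T3Inv, rotInv_mk, s_one hQ0 hγ h0 hx hx' (hb _ _ h |>.rhombus k).1,
    s_two hQ0 hγ (mul_ne_zero h1 h0) hy hy' b]
  simp only [inv_mul_cancel_left₀ hQ0]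
  refine Point.ext ?_ rfl rfl rfl
  ext i
  fin_cases i <;> simp [alpha1] <;> field_simp

end

end QP3

end

/-! ### The translation `T4` and gauge invariance -/

noncomputable section

namespace QP3

section

variable {Q a0 a1 a2 : ℂ} {tx ty tz dx dy dz : ℤ → ℂ}

/-- The values at the reflected vertices are eliminated between a Toda relation at `k + 1` and the
second half of a rhombus relation at `k`; this yields the three-term numerators of `w0`. -/
theorem TriangleRel.raise (hQ0 : Q ≠ 0) (h : TriangleRel Q a0 a1 a2 tx ty tz dx dy dz) (k : ℕ)
    {κ : ℂ} (hκ : κ = Q * (Q ^ k) ^ 2) :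
    κ ^ 2 * a1 ^ 4 * a2 ^ 2 * tx (k + 1 + 1) * ty k * tz k =
        κ ^ 2 * a1 ^ 6 * tx k * ty (k + 1) * tz (k + 1) +
          κ ^ 2 * a1 ^ 6 * (κ ^ 2 * a2 ^ 6) * tx (k + 1) * ty k * tz (k + 1) +
          tx (k + 1) * ty (k + 1) * tz k ∧
      κ ^ 2 * a2 ^ 4 * a0 ^ 2 * ty (k + 1 + 1) * tz k * tx k =
        κ ^ 2 * a2 ^ 6 * ty k * tz (k + 1) * tx (k + 1) +
          κ ^ 2 * a2 ^ 6 * (κ ^ 2 * a0 ^ 6) * ty (k + 1) * tz k * tx (k + 1) +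
          ty (k + 1) * tz (k + 1) * tx k ∧
      κ ^ 2 * a0 ^ 4 * a1 ^ 2 * tz (k + 1 + 1) * tx k * ty k =
        κ ^ 2 * a0 ^ 6 * tz k * tx (k + 1) * ty (k + 1) +
          κ ^ 2 * a0 ^ 6 * (κ ^ 2 * a1 ^ 6) * tz (k + 1) * tx k * ty (k + 1) +
          tz (k + 1) * tx (k + 1) * ty k := by
  obtain ⟨⟨-, v0⟩, ⟨-, v1⟩, -⟩ := h.rhombus k
  obtain ⟨e1, -, e3, e4⟩ := h.toda (k + 1)
  have e : (Q ^ (k + 1)) ^ 2 / Q = κ := by rw [hκ]; field_simp; ring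
  have i : ((k + 1 : ℕ) : ℤ) - 1 = k := by push_cast; ring
  rw [e, i, Nat.cast_succ] at e1 e3 e4
  rw [← hκ] at v0 v1
  refine ⟨?_, ?_, ?_⟩
  · linear_combination ty k * e3 + ty (k + 1) * v1
  · linear_combination tx k * e4 + κ ^ 2 * a2 ^ 6 * tx (k + 1) * v0
  · linear_combination tx k * e1 + tx (k + 1) * v0

/-- The same elimination, now with the Toda relations at `k` and the first halves of the rhombus
relations. -/
theorem TriangleRel.lower (hQ0 : Q ≠ 0) (ha : a0 * a1 * a2 = Q)
    (h : TriangleRel Q a0 a1 a2 tx ty tz dx dy dz) (k : ℕ)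
    {κ : ℂ} (hκ : κ = (Q * (Q ^ k) ^ 2)⁻¹) :
    κ ^ 2 * a1 ^ 4 * a2 ^ 2 * tx (k - 1) * ty (k + 1) * tz (k + 1) =
        κ ^ 2 * a1 ^ 6 * tx (k + 1) * ty k * tz k +
          κ ^ 2 * a1 ^ 6 * (κ ^ 2 * a2 ^ 6) * tx k * ty (k + 1) * tz k +
          tx k * ty k * tz (k + 1) ∧
      κ ^ 2 * a2 ^ 4 * a0 ^ 2 * ty (k - 1) * tz (k + 1) * tx (k + 1) =
        κ ^ 2 * a2 ^ 6 * ty (k + 1) * tz k * tx k +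
          κ ^ 2 * a2 ^ 6 * (κ ^ 2 * a0 ^ 6) * ty k * tz (k + 1) * tx k +
          ty k * tz k * tx (k + 1) ∧
      κ ^ 2 * a0 ^ 4 * a1 ^ 2 * tz (k - 1) * tx (k + 1) * ty (k + 1) =
        κ ^ 2 * a0 ^ 6 * tz (k + 1) * tx k * ty k +
          κ ^ 2 * a0 ^ 6 * (κ ^ 2 * a1 ^ 6) * tz k * tx (k + 1) * ty k +
          tz k * tx k * ty (k + 1) := by
  obtain ⟨⟨u0, -⟩, ⟨u1, -⟩, -⟩ := h.rhombus k
  obtain ⟨e1, e2, e3, -⟩ := h.toda k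
  -- The Toda relations at `k` contain `c = Q^(2k-1)`, the target `κ⁻¹ = Q^(2k+1)`; writing `Q` as
  -- `a0 * a1 * a2` makes the two comparable.
  obtain ⟨c, hc⟩ : ∃ c, c = (Q ^ k) ^ 2 / Q := ⟨_, rfl⟩
  have nc : c ≠ 0 := by rw [hc]; exact div_ne_zero (pow_ne_zero _ (pow_ne_zero _ hQ0)) hQ0
  have eκ : Q * (Q ^ k) ^ 2 = c * (a0 * a1 * a2) ^ 2 := by rw [ha, hc]; field_simp
  rw [← hc] at e1 e2 e3
  rw [eκ] at u0 u1 hκ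
  have n : (a0 * a1 * a2) ≠ 0 := by rw [ha]; exact hQ0
  have inv_form : ∀ K A B C D : ℂ, K ≠ 0 → K ^ 2 * A = K ^ 2 * B + C + K ^ 4 * D →
      K⁻¹ ^ 2 * A = K⁻¹ ^ 2 * B + K⁻¹ ^ 4 * C + D := fun K A B C D hK h => by
    field_simp
    linear_combination h
  have nK : c * (a0 * a1 * a2) ^ 2 ≠ 0 := mul_ne_zero nc (pow_ne_zero _ n)
  rw [hκ]
  refine ⟨?_, ?_, ?_⟩
  · linear_combination inv_form _ (a1 ^ 4 * a2 ^ 2 * tx (k - 1) * ty (k + 1) * tz (k + 1))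
      (a1 ^ 6 * tx (k + 1) * ty k * tz k) (a1 ^ 6 * a2 ^ 6 * tx k * ty (k + 1) * tz k)
      (tx k * ty k * tz (k + 1)) nK (by
        linear_combination (a1 ^ 6 * a2 ^ 6 * ty (k + 1)) * e2 +
          c ^ 2 * (a0 * a1 * a2) ^ 4 * ty k * u1)
  · linear_combination inv_form _ (a2 ^ 4 * a0 ^ 2 * ty (k - 1) * tz (k + 1) * tx (k + 1))
      (a2 ^ 6 * ty (k + 1) * tz k * tx k) (a2 ^ 6 * a0 ^ 6 * ty k * tz (k + 1) * tx k)
      (ty k * tz k * tx (k + 1)) nK (by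
        linear_combination (a0 ^ 2 * a1 ^ 2 * a2 ^ 8 * tx (k + 1)) * e1 + a2 ^ 6 * tx k * u0)
  · linear_combination inv_form _ (a0 ^ 4 * a1 ^ 2 * tz (k - 1) * tx (k + 1) * ty (k + 1))
      (a0 ^ 6 * tz (k + 1) * tx k * ty k) (a0 ^ 6 * a1 ^ 6 * tz k * tx (k + 1) * ty k)
      (tz k * tx k * ty (k + 1)) nK (by
        linear_combination (a0 ^ 8 * a1 ^ 2 * a2 ^ 2 * ty (k + 1)) * e3 + a0 ^ 6 * ty k * u1)

end

section

variable {Q : ℂ} {Ω : Set (ℂ × ℂ)} {t : ℤ → ℂ → ℂ → ℂ}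

theorem alpha1_mul {α0 α2 : ℂ} (h0 : α0 ≠ 0) (h2 : α2 ≠ 0) : α0 * alpha1 Q α0 α2 * α2 = Q := by
  unfold alpha1; field_simp

theorem IsBilinearTau.T4_eq (hQ0 : Q ≠ 0) (hΩ : IsParameterDomain Q Ω) (hb : IsBilinearTau Q Ω t)
    {α0 α2 : ℂ} (h : (α0, α2) ∈ Ω) {N : ℤ} (hr : ∀ i, (tauPoint Q t N α0 α2).τ i ≠ 0) :
    T4 Q (tauPoint Q t N α0 α2) = tauPoint Q t (N + 1) α0 α2 := by
  have hx : t N (Q⁻¹ * α0) α2 ≠ 0 := hr 0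
  have hy : t N α0 α2 ≠ 0 := hr 1
  have hz : t N α0 (Q⁻¹ * α2) ≠ 0 := hr 2
  obtain ⟨k, rfl⟩ := hb.exists_natCast h hy
  have hg := hΩ.generic _ _ h
  obtain ⟨ex, ey, ez⟩ := (hb _ _ h).raise hQ0 k rfl
  rw [← Nat.cast_succ, tauPoint_eq, tauPoint_eq, T4_mk hQ0 (pow_ne_zero k hQ0) hg.ne_zero0
    (hg.alpha1_ne_zero hQ0) hg.ne_zero2 hx hy hz rfl ex ey ez, pow_succ, mul_comm Q]
  rfl

theorem IsBilinearTau.T4Inv_eq (hQ0 : Q ≠ 0) (hΩ : IsParameterDomain Q Ω)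
    (hb : IsBilinearTau Q Ω t) {α0 α2 : ℂ} (h : (α0, α2) ∈ Ω) {N : ℤ}
    (hr : ∀ i, (tauPoint Q t N α0 α2).τbar i ≠ 0) :
    T4Inv Q (tauPoint Q t N α0 α2) = tauPoint Q t (N - 1) α0 α2 := by
  have hx : t (N + 1) (Q⁻¹ * α0) α2 ≠ 0 := hr 0
  have hy : t (N + 1) α0 α2 ≠ 0 := hr 1
  have hz : t (N + 1) α0 (Q⁻¹ * α2) ≠ 0 := hr 2
  obtain ⟨k, hk⟩ := hb.exists_natCast h hy
  have hg := hΩ.generic _ _ h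
  have key : ∀ κ, κ = (Q * (Q ^ N) ^ 2)⁻¹ → _ := fun κ hκ =>
    T4Inv_mk (x'' := t (N - 1) (Q⁻¹ * α0) α2) (y'' := t (N - 1) α0 α2)
      (z'' := t (N - 1) α0 (Q⁻¹ * α2)) (x := t N (Q⁻¹ * α0) α2) (y := t N α0 α2)
      (z := t N α0 (Q⁻¹ * α2)) hQ0 (zpow_ne_zero N hQ0) hg.ne_zero0
      (hg.alpha1_ne_zero hQ0) hg.ne_zero2 hx hy hz hκ
  have e : tauPoint Q t (N - 1) α0 α2 = ⟨![α0, alpha1 Q α0 α2, α2], Q⁻¹ * Q ^ N,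
      ![t (N - 1) (Q⁻¹ * α0) α2, t (N - 1) α0 α2, t (N - 1) α0 (Q⁻¹ * α2)],
      ![t N (Q⁻¹ * α0) α2, t N α0 α2, t N α0 (Q⁻¹ * α2)]⟩ := by
    unfold tauPoint
    rw [sub_add_cancel, zpow_sub_one₀ hQ0, mul_comm]
  rw [e]
  cases k with
  -- At `N = -1` only the barred variables, which are values of `τ_0`, survive; all terms contain a
  -- vanishing factor.
  | zero =>
    obtain rfl : N = -1 := by push_cast at hk; linarith
    obtain ⟨x1, y1, z1⟩ := (hb _ _ h).neg (-1) (by norm_num)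
    obtain ⟨x2, y2, z2⟩ := (hb _ _ h).neg (-1 - 1) (by norm_num)
    exact key _ rfl (by simp only [x1, y1, z1, x2]; ring) (by simp only [x1, y1, z1, y2]; ring)
      (by simp only [x1, y1, z1, z2]; ring)
  | succ k =>
    obtain rfl : N = k := by push_cast at hk; linarith
    obtain ⟨ex, ey, ez⟩ := (hb _ _ h).lower hQ0 (alpha1_mul hg.ne_zero0 hg.ne_zero2) k rfl
    exact key _ (by rw [zpow_natCast]) ex ey ez

theorem IsBilinearTau.isHypergeometricTau (hQ0 : Q ≠ 0) (hΩ : IsParameterDomain Q Ω)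
    (hb : IsBilinearTau Q Ω t) : IsHypergeometricTau Q Ω t where
  boundary N hN _ _ h := ((hb _ _ h).neg N hN).2.1
  t1 _ _ _ h := hb.T1_eq hQ0 hΩ h
  t1Inv _ _ _ h := hb.T1Inv_eq hQ0 hΩ h
  t2 _ _ _ h := hb.T2_eq hQ0 hΩ h
  t2Inv _ _ _ h := hb.T2Inv_eq hQ0 hΩ h
  t3 _ _ _ h := hb.T3_eq hQ0 hΩ h
  t3Inv _ _ _ h := hb.T3Inv_eq hQ0 hΩ h
  t4 _ _ _ h := hb.T4_eq hQ0 hΩ h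
  t4Inv _ _ _ h := hb.T4Inv_eq hQ0 hΩ h

/-- In every relation all terms have the same sum of lattice positions, since the two diagonals of a
rhombus share their midpoint. A geometric factor is therefore common to all terms. -/
theorem TriangleRel.gauge {a0 a1 a2 K X Y : ℂ} {tx ty tz dx dy dz sx sy sz ex ey ez : ℤ → ℂ}
    (h : TriangleRel Q a0 a1 a2 tx ty tz dx dy dz) (hK : K ≠ 0) (hX : X ≠ 0) (hY : Y ≠ 0)
    (hx : ∀ N, sx N = K * X⁻¹ * tx N) (hy : ∀ N, sy N = K * ty N) (hz : ∀ N, sz N = K * Y * tz N)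
    (hdx : ∀ N, ex N = K * X * Y * dx N) (hdy : ∀ N, ey N = K * X⁻¹ * Y * dy N)
    (hdz : ∀ N, ez N = K * X⁻¹ * Y⁻¹ * dz N) : TriangleRel Q a0 a1 a2 sx sy sz ex ey ez := by
  refine ⟨fun N hN => ?_, fun k => ?_, fun k => ?_⟩
  · obtain ⟨h1, h2, h3⟩ := h.neg N hN
    simp only [hx, hy, hz, h1, h2, h3, mul_zero, and_self]
  · simp only [RhombusRel, hx, hy, hz, hdx, hdy, hdz]
    obtain ⟨⟨e1, e2⟩, ⟨e3, e4⟩, e5, e6⟩ := h.rhombus k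
    generalize Q * (Q ^ k) ^ 2 = κ at *
    refine ⟨⟨?_, ?_⟩, ⟨?_, ?_⟩, ?_, ?_⟩ <;> field_simp
    · linear_combination e1
    · linear_combination e2
    · linear_combination e3
    · linear_combination e4
    · linear_combination e5
    · linear_combination e6
  · simp only [hx, hy, hz, hdx, hdy]
    obtain ⟨e1, e2, e3, e4⟩ := h.toda k
    generalize (Q ^ k) ^ 2 / Q = κ at *
    refine ⟨?_, ?_, ?_, ?_⟩ <;> field_simp
    · linear_combination e1
    · linear_combination e2
    · linear_combination e3
    · linear_combination e4

/-- The bilinear relations do not change when the family is multiplied by a gauge factor. -/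
theorem IsBilinearTau.gauge (hΩ : IsParameterDomain Q Ω) (hb : IsBilinearTau Q Ω t)
    {C : ℂ → ℂ → ℂ} (hC : IsGauge Q Ω C) {τ : ℤ → ℂ → ℂ → ℂ}
    (hτ : ∀ N α0 α2, (α0, α2) ∈ Ω → τ N α0 α2 = C α0 α2 * t N α0 α2) : IsBilinearTau Q Ω τ := by
  intro α0 α2 h
  obtain ⟨X, Y, hXY⟩ := hC.geometric _ _ h
  have mx := hΩ.inv_mul_zero_mem h
  have mz := hΩ.inv_mul_two_mem h
  have mdx := hΩ.inv_mul_two_mem (hΩ.mul_zero_mem h)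
  have mdy := hΩ.inv_mul_two_mem mx
  have mdz := hΩ.mul_two_mem mx
  have cx := hXY (-1) 0
  have cz := hXY 0 1
  have cdx := hXY 1 1
  have cdy := hXY (-1) 1
  have cdz := hXY (-1) (-1)
  simp only [zpow_neg_one, zpow_one, zpow_zero, neg_zero, neg_neg, one_mul, mul_one]
    at cx cz cdx cdy cdz
  -- The ratios are nonzero because the gauge factor does not vanish at the neighbouring points.
  have nX : X ≠ 0 := fun e => hC.ne_zero _ _ mdx (by rw [cdx, e, mul_zero, zero_mul])
  have nY : Y ≠ 0 := fun e => hC.ne_zero _ _ mz (by rw [cz, e, mul_zero])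
  refine (hb _ _ h).gauge (hC.ne_zero _ _ h) nX nY
    (fun N => ?_) (fun N => ?_) (fun N => ?_) (fun N => ?_) (fun N => ?_) (fun N => ?_)
  · rw [hτ _ _ _ mx, cx]
  · rw [hτ _ _ _ h]
  · rw [hτ _ _ _ mz, cz]
  · rw [hτ _ _ _ mdx, cdx]
  · rw [hτ _ _ _ mdy, cdy]
  · rw [hτ _ _ _ mdz, cdz]

/-- The explicit `τ` functions satisfy the bilinear relations. -/
theorem isBilinearTau_hyperTau (hQ0 : Q ≠ 0) (hQ1 : ‖Q‖ < 1) (hΩ : IsParameterDomain Q Ω)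
    {A B : ℂ → ℂ → ℂ} (hA : IsPeriodic Q Ω A) (hB : IsPeriodic Q Ω B) :
    IsBilinearTau Q Ω fun N α0 α2 => hyperTau Q A B α0 α2 N 0 0 := fun α0 α2 h =>
  (localTau_hyperTau hQ0 hQ1 hΩ hA hB h).triangleRel hQ0 (hΩ.generic _ _ h).ne_zero0
    (hΩ.generic _ _ h).ne_zero2 (by simpa using (hΩ.generic _ _ h).pow2 0)

end

end QP3

end

noncomputable section

namespace QP3

/-! ## Hypergeometric `τ` functions at `N = 0` -/

/-- `hy` makes the horizontal ratio independent of `m`, and then `hx` makes it independent of `n`.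
Given this, `hz` makes the vertical ratio constant on the column `n = 0`. -/
theorem exists_geometric_of_rhombus {c : ℤ → ℤ → ℂ} (h0 : ∀ n m, c n m ≠ 0)
    (hx : ∀ n m, c (n - 1) m * c (n + 1) (m + 1) = c n m * c n (m + 1))
    (hy : ∀ n m, c n m * c (n - 1) (m + 1) = c (n - 1) m * c n (m + 1))
    (hz : ∀ n m, c n (m + 1) * c (n - 1) (m - 1) = c (n - 1) m * c n m) :
    ∃ x y : ℂ, ∀ n m : ℤ, c n m = c 0 0 * x ^ n * y ^ m := by
  have step : ∀ g : ℤ → ℂ, (∀ n, g (n + 1) = g n) → ∀ n, g n = g 0 := fun g hg n => by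
    induction n with
    | zero => rfl
    | succ i ih => rw [hg, ih]
    | pred i ih => rw [← ih, ← hg, sub_add_cancel]
  have geom : ∀ (g : ℤ → ℂ) (x : ℂ), x ≠ 0 → (∀ n, g (n + 1) = g n * x) →
      ∀ n, g n = g 0 * x ^ n := fun g x hx hg n => by
    have := step (fun n => g n / x ^ n) (fun n => by
      simp only [hg, zpow_add_one₀ hx]
      have := zpow_ne_zero n hx
      field_simp) n
    simpa [div_eq_iff (zpow_ne_zero n hx)] using this
  have hor : ∀ n m, c (n + 1) m / c n m = c 1 0 / c 0 0 := fun n m => by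
    rw [step (fun m => c (n + 1) m / c n m) (fun m => by
      rw [div_eq_div_iff (h0 _ _) (h0 _ _)]
      have h1 := hy (n + 1) m
      rw [add_sub_cancel_right] at h1
      linear_combination -h1) m]
    simpa using step (fun n => c (n + 1) 0 / c n 0) (fun n => by
      have h1 := hx (n + 1) 0
      have h2 := hy (n + 1 + 1) 0
      simp only [add_sub_cancel_right] at h1 h2
      rw [div_eq_div_iff (h0 _ _) (h0 _ _)]
      refine mul_right_cancel₀ (h0 (n + 1) (0 + 1)) ?_
      linear_combination c n 0 * h2 + c (n + 1) 0 * h1) n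
  have ver : ∀ m, c 0 (m + 1) / c 0 m = c 0 1 / c 0 0 := fun m => by
    simpa using step (fun m => c 0 (m + 1) / c 0 m) (fun m => by
      have h1 := hz 1 (m + 1)
      have h2 : ∀ j, c 1 j = c 1 0 / c 0 0 * c 0 j := fun j => by
        rw [← hor 0 j, div_mul_cancel₀ _ (h0 _ _), zero_add]
      rw [sub_self, add_sub_cancel_right, h2 (m + 1 + 1), h2 (m + 1)] at h1
      rw [div_eq_div_iff (h0 _ _) (h0 _ _)]
      refine mul_left_cancel₀ (div_ne_zero (h0 1 0) (h0 0 0)) ?_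
      linear_combination h1) m
  refine ⟨c 1 0 / c 0 0, c 0 1 / c 0 0, fun n m => ?_⟩
  rw [geom (fun n => c n m) _ (div_ne_zero (h0 _ _) (h0 _ _)) (fun n => by
    rw [← hor n m, mul_div_cancel₀ _ (h0 _ _)]) n,
    geom (fun m => c 0 m) _ (div_ne_zero (h0 _ _) (h0 _ _)) (fun m => by
    rw [← ver m, mul_div_cancel₀ _ (h0 _ _)]) m]
  ring

section

variable {Q : ℂ}

/-- Each of these components is touched by only one of the two reflections, so its formula is a
rhombus relation for the original variables. -/
theorem T1_τ_two (P : Point) : (T1 Q P).τ 2 = (P.u Q 0 * P.τ 1 * P.τbar 2 + P.τbar 1 * P.τ 2) /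
    (P.sqrtU Q 0 * P.τbar 0) := rfl

theorem T1_τbar_two (P : Point) : (T1 Q P).τbar 2 =
    (P.v Q 0 * P.τbar 1 * P.τ 2 + P.τ 1 * P.τbar 2) / (P.sqrtV Q 0 * P.τ 0) := rfl

theorem T2_τ_zero (P : Point) : (T2 Q P).τ 0 = (P.u Q 1 * P.τ 2 * P.τbar 0 + P.τbar 2 * P.τ 0) /
    (P.sqrtU Q 1 * P.τbar 1) := rfl

theorem T3_τ_one (P : Point) : (T3 Q P).τ 1 = (P.u Q 2 * P.τ 0 * P.τbar 1 + P.τbar 0 * P.τ 1) /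
    (P.sqrtU Q 2 * P.τbar 2) := rfl

theorem T4Inv_τ_zero (P : Point) : (T4Inv Q P).τ 0 =
    P.α 1 ^ 2 * (P.τbar 0 * P.τ 1 * P.τ 2 + P.u Q 2 * P.τ 0 * P.τbar 1 * P.τ 2 +
        (P.u Q 1)⁻¹ * P.τ 0 * P.τ 1 * P.τbar 2) / (P.α 2 ^ 2 * P.τbar 1 * P.τbar 2) := rfl

theorem rhombus_of_div {κ a x y z d x' y' z' d' : ℂ} (hκ : κ ≠ 0) (ha : a ≠ 0) (hx : x ≠ 0)
    (hx' : x' ≠ 0) (h : (κ⁻¹ ^ 2 * a ^ 6 * y * z' + y' * z) / (κ⁻¹ * a ^ 3 * x') = d)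
    (h' : (κ ^ 2 * a ^ 6 * y' * z + y * z') / (κ * a ^ 3 * x) = d') :
    RhombusRel κ a x y z d x' y' z' d' := by
  rw [div_eq_iff (by simp [hκ, ha, hx'])] at h
  rw [div_eq_iff (by simp [hκ, ha, hx])] at h'
  refine ⟨?_, by linear_combination -h'⟩
  field_simp at h
  linear_combination -h

end

section

variable {Q : ℂ} {Ω : Set (ℂ × ℂ)} {τ : ℤ → ℂ → ℂ → ℂ}

theorem tauPoint_zero (α0 α2 : ℂ) : tauPoint Q τ 0 α0 α2 =
    ⟨![α0, alpha1 Q α0 α2, α2], 1, ![τ 0 (Q⁻¹ * α0) α2, τ 0 α0 α2, τ 0 α0 (Q⁻¹ * α2)],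
      ![τ 1 (Q⁻¹ * α0) α2, τ 1 α0 α2, τ 1 α0 (Q⁻¹ * α2)]⟩ := by
  unfold tauPoint
  rw [zpow_zero, zero_add]

/-- The relations for `τ₀` and `τ₁` that follow from the consistency with the translations. -/
theorem IsHypergeometricTau.base_rel (hQ0 : Q ≠ 0) (hΩ : IsParameterDomain Q Ω)
    (h0 : ∀ N : ℤ, 0 ≤ N → ∀ α0 α2, (α0, α2) ∈ Ω → τ N α0 α2 ≠ 0)
    (H : IsHypergeometricTau Q Ω τ) {α0 α2 : ℂ} (h : (α0, α2) ∈ Ω) :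
    RhombusRel Q α0 (τ 0 (Q⁻¹ * α0) α2) (τ 0 α0 α2) (τ 0 α0 (Q⁻¹ * α2)) (τ 0 (Q * α0) (Q⁻¹ * α2))
      (τ 1 (Q⁻¹ * α0) α2) (τ 1 α0 α2) (τ 1 α0 (Q⁻¹ * α2)) (τ 1 (Q * α0) (Q⁻¹ * α2)) ∧
    Q * alpha1 Q α0 α2 ^ 3 * τ 1 α0 α2 * τ 0 (Q⁻¹ * α0) (Q⁻¹ * α2) =
      alpha1 Q α0 α2 ^ 6 * τ 0 α0 (Q⁻¹ * α2) * τ 1 (Q⁻¹ * α0) α2 +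
        Q ^ 2 * τ 1 α0 (Q⁻¹ * α2) * τ 0 (Q⁻¹ * α0) α2 ∧
    Q * α2 ^ 3 * τ 1 α0 (Q⁻¹ * α2) * τ 0 (Q⁻¹ * α0) (Q * α2) =
      α2 ^ 6 * τ 0 (Q⁻¹ * α0) α2 * τ 1 α0 α2 + Q ^ 2 * τ 1 (Q⁻¹ * α0) α2 * τ 0 α0 α2 ∧
    τ 1 (Q⁻¹ * α0) α2 * τ 0 α0 α2 * τ 0 α0 (Q⁻¹ * α2) +
      Q⁻¹ ^ 2 * α2 ^ 6 * τ 0 (Q⁻¹ * α0) α2 * τ 1 α0 α2 * τ 0 α0 (Q⁻¹ * α2) +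
      (Q⁻¹ ^ 2 * alpha1 Q α0 α2 ^ 6)⁻¹ * τ 0 (Q⁻¹ * α0) α2 * τ 0 α0 α2 * τ 1 α0 (Q⁻¹ * α2) =
        0 := by
  have mx := hΩ.inv_mul_zero_mem h
  have mz := hΩ.inv_mul_two_mem h
  have hg := hΩ.generic _ _ h
  have n0 := hg.ne_zero0
  have n1 := hg.alpha1_ne_zero hQ0
  have n2 := hg.ne_zero2
  have x0 := h0 0 le_rfl _ _ mx
  have y0 := h0 0 le_rfl _ _ h
  have z0 := h0 0 le_rfl _ _ mz
  have x1 := h0 1 zero_le_one _ _ mx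
  have y1 := h0 1 zero_le_one _ _ h
  have z1 := h0 1 zero_le_one _ _ mz
  have hr : (tauPoint Q τ 0 α0 α2).Regular := fun i => by
    rw [tauPoint_zero]
    fin_cases i
    exacts [⟨x0, x1⟩, ⟨y0, y1⟩, ⟨z0, z1⟩]
  have e1 := congrFun (congrArg Point.τ (H.t1 0 α0 α2 h hr)) 2
  have e1' := congrFun (congrArg Point.τbar (H.t1 0 α0 α2 h hr)) 2
  have e2 := congrFun (congrArg Point.τ (H.t2 0 α0 α2 h hr)) 0
  have e3 := congrFun (congrArg Point.τ (H.t3 0 α0 α2 h hr)) 1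
  have e4 := congrFun (congrArg Point.τ (H.t4Inv 0 α0 α2 h fun i => (hr i).2)) 0
  rw [T1_τ_two, Point.u_eq, Point.sqrtU_eq, tauPoint_zero, tauPoint_zero] at e1
  rw [T1_τbar_two, Point.v_eq, Point.sqrtV_eq, tauPoint_zero, tauPoint_zero] at e1'
  rw [T2_τ_zero, Point.u_eq, Point.sqrtU_eq, tauPoint_zero, tauPoint_zero] at e2
  rw [T3_τ_one, Point.u_eq, Point.sqrtU_eq, tauPoint_zero, tauPoint_zero] at e3
  rw [T4Inv_τ_zero, Point.u_eq, Point.u_eq, tauPoint_zero] at e4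
  simp only [one_pow, mul_one] at e1 e1' e2 e3 e4
  -- Only the first half is wanted; the second is filled in trivially, with `x = 1` and `d'` equal
  -- to its own quotient.
  have hU : ∀ {a x' y z' y' z d : ℂ}, a ≠ 0 → x' ≠ 0 →
      (Q⁻¹ ^ 2 * a ^ 6 * y * z' + y' * z) / (Q⁻¹ * a ^ 3 * x') = d →
      Q * a ^ 3 * x' * d = a ^ 6 * y * z' + Q ^ 2 * y' * z := fun ha hx' h =>
    (rhombus_of_div (d' := _) hQ0 ha one_ne_zero hx' h rfl).1
  refine ⟨rhombus_of_div hQ0 n0 x0 x1 e1 e1', hU n1 y1 e2, hU n2 z1 e3, ?_⟩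
  -- `T4⁻¹` at `N = 0` must produce `τ_{-1} = 0`, so the numerator in `w0` vanishes.
  have e5 : tauPoint Q τ (0 - 1) α0 α2 = ⟨![α0, alpha1 Q α0 α2, α2], Q ^ (0 - 1 : ℤ), 0,
      (tauPoint Q τ (0 - 1) α0 α2).τbar⟩ := by
    refine Point.ext rfl rfl ?_ rfl
    have hb := H.boundary (0 - 1) (by norm_num)
    ext i
    fin_cases i
    exacts [hb _ _ mx, hb _ _ h, hb _ _ mz]
  rw [e5] at e4
  refine (mul_eq_zero_iff_left (pow_ne_zero 2 n1)).1 ((div_eq_zero_iff.1 e4).resolve_right ?_)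
  exact mul_ne_zero (mul_ne_zero (pow_ne_zero 2 n2) y1) z1

end

end QP3

end

noncomputable section

namespace QP3

/-! ## Uniqueness of the hypergeometric `τ` functions -/

section

variable {Q : ℂ} {Ω : Set (ℂ × ℂ)} {τ : ℤ → ℂ → ℂ → ℂ}

/-- The bilinear relations of `τ₀`. -/
theorem IsHypergeometricTau.zero_rhombus (hQ0 : Q ≠ 0) (hΩ : IsParameterDomain Q Ω)
    (h0 : ∀ N : ℤ, 0 ≤ N → ∀ α0 α2, (α0, α2) ∈ Ω → τ N α0 α2 ≠ 0)
    (H : IsHypergeometricTau Q Ω τ) {α0 α2 : ℂ} (h : (α0, α2) ∈ Ω) :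
    τ 0 (Q⁻¹ * α0) α2 * τ 0 (Q * α0) (Q⁻¹ * α2) =
      -(Q ^ 3 / (α0 ^ 3 * α2 ^ 6)) * (τ 0 α0 α2 * τ 0 α0 (Q⁻¹ * α2)) ∧
    τ 0 α0 α2 * τ 0 (Q⁻¹ * α0) (Q⁻¹ * α2) =
      -(α2 ^ 3 / α0 ^ 3) * (τ 0 (Q⁻¹ * α0) α2 * τ 0 α0 (Q⁻¹ * α2)) ∧
    τ 0 α0 (Q⁻¹ * α2) * τ 0 (Q⁻¹ * α0) (Q * α2) =
      -(α0 ^ 6 * α2 ^ 3 / Q ^ 3) * (τ 0 (Q⁻¹ * α0) α2 * τ 0 α0 α2) := by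
  obtain ⟨⟨u0, -⟩, u1, u2, l⟩ := H.base_rel hQ0 hΩ h0 h
  have hg := hΩ.generic _ _ h
  have n0 := hg.ne_zero0
  have n2 := hg.ne_zero2
  have x1 := h0 1 zero_le_one _ _ (hΩ.inv_mul_zero_mem h)
  have y1 := h0 1 zero_le_one _ _ h
  have z1 := h0 1 zero_le_one _ _ (hΩ.inv_mul_two_mem h)
  generalize τ 0 (Q⁻¹ * α0) α2 = x at *
  generalize τ 0 α0 α2 = y at *
  generalize τ 0 α0 (Q⁻¹ * α2) = z at *
  generalize τ 0 (Q * α0) (Q⁻¹ * α2) = dx at *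
  generalize τ 0 (Q⁻¹ * α0) (Q⁻¹ * α2) = dy at *
  generalize τ 0 (Q⁻¹ * α0) (Q * α2) = dz at *
  generalize τ 1 (Q⁻¹ * α0) α2 = x' at *
  generalize τ 1 α0 α2 = y' at *
  generalize τ 1 α0 (Q⁻¹ * α2) = z' at *
  unfold alpha1 at u1 l
  -- In each case `l` eliminates two of the three values of `τ_1`, and the third remains as a common
  -- nonzero factor.
  refine ⟨?_, ?_, ?_⟩
  · field_simp
    field_simp at l
    refine mul_left_cancel₀ (mul_ne_zero hQ0 x1) ?_
    linear_combination α2 ^ 6 * x * u0 + l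
  · field_simp
    field_simp at u1 l
    refine mul_left_cancel₀ (mul_ne_zero (mul_ne_zero (pow_ne_zero 2 hQ0) (pow_ne_zero 3 n2)) y1) ?_
    linear_combination y * u1 + l
  · field_simp
    field_simp at l
    refine mul_left_cancel₀ (mul_ne_zero (pow_ne_zero 3 n2) z1) ?_
    linear_combination Q ^ 2 * z * u2 + l

/-- `τ_0` and the gamma factor satisfy the same three rhombus relations, so their quotient satisfies
them with all coefficients equal to `1`, and such a function is geometric. -/
theorem IsHypergeometricTau.isGauge (hQ0 : Q ≠ 0) (hQ1 : ‖Q‖ < 1) (hΩ : IsParameterDomain Q Ω)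
    (h0 : ∀ N : ℤ, 0 ≤ N → ∀ α0 α2, (α0, α2) ∈ Ω → τ N α0 α2 ≠ 0)
    (H : IsHypergeometricTau Q Ω τ) :
    IsGauge Q Ω fun α0 α2 => τ 0 α0 α2 / gammaBase Q α0 α2 := by
  have hG : ∀ {α0 α2}, (α0, α2) ∈ Ω → gammaBase Q α0 α2 ≠ 0 := fun h =>
    gammaBase_ne_zero hQ0 hQ1 (hΩ.generic _ _ h)
  have nz : ∀ α0 α2, (α0, α2) ∈ Ω → τ 0 α0 α2 / gammaBase Q α0 α2 ≠ 0 := fun α0 α2 h =>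
    div_ne_zero (h0 0 le_rfl _ _ h) (hG h)
  refine ⟨nz, fun α0 α2 h => ?_⟩
  obtain ⟨C, hC⟩ : ∃ C : ℂ → ℂ → ℂ, C = fun α0 α2 => τ 0 α0 α2 / gammaBase Q α0 α2 := ⟨_, rfl⟩
  have key : ∀ β0 β2, (β0, β2) ∈ Ω →
      C (Q⁻¹ * β0) β2 * C (Q * β0) (Q⁻¹ * β2) = C β0 β2 * C β0 (Q⁻¹ * β2) ∧
      C β0 β2 * C (Q⁻¹ * β0) (Q⁻¹ * β2) = C (Q⁻¹ * β0) β2 * C β0 (Q⁻¹ * β2) ∧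
      C β0 (Q⁻¹ * β2) * C (Q⁻¹ * β0) (Q * β2) = C (Q⁻¹ * β0) β2 * C β0 β2 := by
    intro β0 β2 m0
    obtain ⟨t1, t2, t3⟩ := H.zero_rhombus hQ0 hΩ h0 m0
    have hg := hΩ.generic _ _ m0
    have n0 := hg.ne_zero0
    have n2 := hg.ne_zero2
    simp only [hC, div_mul_div_comm]
    refine ⟨?_, ?_, ?_⟩
    · rw [t1, gammaBase_rhombus_zero hQ0 hQ1 hg, mul_div_mul_left]
      simp [hQ0, n0, n2]
    · rw [t2, gammaBase_rhombus_one hQ0 hQ1 hg, mul_div_mul_left]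
      simp [n0, n2]
    · rw [t3, gammaBase_rhombus_two hQ0 hQ1 hg, mul_div_mul_left]
      simp [hQ0, n0, n2]
  have eL : ∀ n : ℤ, Q ^ (n - 1) * α0 = Q⁻¹ * (Q ^ n * α0) := fun n => by
    rw [zpow_sub_one₀ hQ0]; ring
  have eR : ∀ n : ℤ, Q ^ (n + 1) * α0 = Q * (Q ^ n * α0) := fun n => by
    rw [zpow_add_one₀ hQ0]; ring
  have eU : ∀ m : ℤ, Q ^ (-(m + 1)) * α2 = Q⁻¹ * (Q ^ (-m) * α2) := fun m => by
    rw [neg_add, ← sub_eq_add_neg, zpow_sub_one₀ hQ0]; ring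
  have eD : ∀ m : ℤ, Q ^ (-(m - 1)) * α2 = Q * (Q ^ (-m) * α2) := fun m => by
    rw [neg_sub, sub_eq_add_neg, add_comm, zpow_add_one₀ hQ0]; ring
  obtain ⟨x, y, hxy⟩ := exists_geometric_of_rhombus
    (c := fun n m : ℤ => C (Q ^ n * α0) (Q ^ (-m) * α2))
    (fun n m => by rw [hC]; exact nz _ _ (hΩ.shift _ _ h n m))
    (fun n m => by simpa only [eL, eR, eU] using (key _ _ (hΩ.shift _ _ h n m)).1)
    (fun n m => by simpa only [eL, eU] using (key _ _ (hΩ.shift _ _ h n m)).2.1)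
    (fun n m => by simpa only [eL, eU, eD] using (key _ _ (hΩ.shift _ _ h n m)).2.2)
  exact ⟨x, y, fun n m => by simpa [hC] using hxy n m⟩

/-- The function whose values are the entries of the Toeplitz determinants. -/
def entry (Q : ℂ) (τ : ℤ → ℂ → ℂ → ℂ) (α0 α2 : ℂ) : ℂ :=
  τ 1 α0 (Q⁻¹ * α2) / (τ 0 α0 (Q⁻¹ * α2) * prefactor Q 1 α0 (Q⁻¹ * α2))

/-- Divided by the product of the three values of `τ_0`, the relation `l` is linear in the quotients
`τ_1 / τ_0`; this is the second relation. The first comes from the rhombus relation `v0`, with `t1`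
removing the values of `τ_0`. -/
theorem IsHypergeometricTau.entry_rel (hQ0 : Q ≠ 0) (hQ1 : ‖Q‖ < 1) (hΩ : IsParameterDomain Q Ω)
    (h0 : ∀ N : ℤ, 0 ≤ N → ∀ α0 α2, (α0, α2) ∈ Ω → τ N α0 α2 ≠ 0)
    (H : IsHypergeometricTau Q Ω τ) {α0 α2 : ℂ} (h : (α0, α2) ∈ Ω) :
    entry Q τ (Q * α0) α2 = entry Q τ α0 α2 - α0 ^ 12 * entry Q τ α0 (Q * α2) ∧
    entry Q τ α0 α2 = entry Q τ α0 (Q * α2) - 1 / α2 ^ 12 * entry Q τ (Q⁻¹ * α0) (Q * α2) := by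
  obtain ⟨⟨-, v0⟩, -, -, l⟩ := H.base_rel hQ0 hΩ h0 h
  obtain ⟨t1, -, -⟩ := H.zero_rhombus hQ0 hΩ h0 h
  have hg := hΩ.generic _ _ h
  have n0 := hg.ne_zero0
  have n2 := hg.ne_zero2
  have hp := prefactor_ne_zero hQ0 hQ1 hg 1
  have x0 := h0 0 le_rfl _ _ (hΩ.inv_mul_zero_mem h)
  have y0 := h0 0 le_rfl _ _ h
  have z0 := h0 0 le_rfl _ _ (hΩ.inv_mul_two_mem h)
  have d0 := h0 0 le_rfl _ _ (hΩ.inv_mul_two_mem (hΩ.mul_zero_mem h))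
  have pl := prefactor_left hQ0 hQ1 n0 n2 1
  have pu := prefactor_up hQ0 hQ1 n0 n2 1
  have pr := prefactor_right hQ0 hQ1 n0 (mul_ne_zero (inv_ne_zero hQ0) n2) 1
  simp only [entry, inv_mul_cancel_left₀ hQ0]
  rw [pr, pu, pl]
  generalize prefactor Q 1 α0 α2 = p at *
  generalize τ 0 (Q⁻¹ * α0) α2 = x at *
  generalize τ 0 α0 α2 = y at *
  generalize τ 0 α0 (Q⁻¹ * α2) = z at *
  generalize τ 0 (Q * α0) (Q⁻¹ * α2) = d at *
  generalize τ 1 (Q⁻¹ * α0) α2 = x' at *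
  generalize τ 1 α0 α2 = y' at *
  generalize τ 1 α0 (Q⁻¹ * α2) = z' at *
  generalize τ 1 (Q * α0) (Q⁻¹ * α2) = d' at *
  simp only [one_pow, pow_one]
  unfold alpha1 at l
  constructor
  · field_simp at t1 ⊢
    refine mul_left_cancel₀ (mul_ne_zero (mul_ne_zero hQ0 x0) (pow_ne_zero 3 n0)) ?_
    linear_combination Q ^ 4 * y * z * v0 - Q * (-(y * z') - Q ^ 2 * α0 ^ 6 * z * y') * t1
  · field_simp at l ⊢
    linear_combination -l

theorem IsHypergeometricTau.isContiguous_entry (hQ0 : Q ≠ 0) (hQ1 : ‖Q‖ < 1)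
    (hΩ : IsParameterDomain Q Ω)
    (h0 : ∀ N : ℤ, 0 ≤ N → ∀ α0 α2, (α0, α2) ∈ Ω → τ N α0 α2 ≠ 0)
    (H : IsHypergeometricTau Q Ω τ) : IsContiguous Q Ω (entry Q τ) := by
  rw [isContiguous_iff hQ0]
  intro α0 α2 h
  have e : ∀ (a : ℂ) (j : ℤ), (Q ^ j * a) ^ 12 = (Q ^ 12) ^ j * a ^ 12 := fun a j => by
    rw [mul_pow, ← zpow_natCast (Q ^ j), ← zpow_mul, mul_comm j, zpow_mul]
    norm_cast
  refine ⟨fun n m => ?_, fun n m => ?_⟩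
  · have h1 := (H.entry_rel hQ0 hQ1 hΩ h0 (hΩ.shift _ _ h n m)).1
    rw [e, ← mul_assoc, ← mul_assoc, ← zpow_one_add₀ hQ0, ← zpow_one_add₀ hQ0, add_comm 1 n] at h1
    rw [h1, show 1 + -m = -(m - 1) by ring]
    ring
  · have h1 := (H.entry_rel hQ0 hQ1 hΩ h0 (hΩ.shift _ _ h n (m + 1))).2
    rw [e, ← mul_assoc, ← mul_assoc, ← zpow_one_add₀ hQ0, ← zpow_neg_one, ← zpow_add₀ hQ0,
      show 1 + -(m + 1) = -m by ring, show -1 + n = n - 1 by ring] at h1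
    rw [h1, zpow_neg (Q ^ 12), zpow_add_one₀ (pow_ne_zero _ hQ0)]
    have := zpow_ne_zero m (pow_ne_zero 12 hQ0)
    have := (hΩ.generic _ _ h).ne_zero2
    field_simp

/-- Families that agree up to a factor for `N = 0` and `N = 1` agree for all `N`. -/
theorem IsHypergeometricTau.eq_of_eq_zero_one (hΩ : IsParameterDomain Q Ω)
    {σ : ℤ → ℂ → ℂ → ℂ} (h0 : ∀ N : ℤ, 0 ≤ N → ∀ α0 α2, (α0, α2) ∈ Ω → τ N α0 α2 ≠ 0)
    (H : IsHypergeometricTau Q Ω τ) (H' : IsHypergeometricTau Q Ω σ)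
    (e0 : ∀ α0 α2, (α0, α2) ∈ Ω → τ 0 α0 α2 = σ 0 α0 α2)
    (e1 : ∀ α0 α2, (α0, α2) ∈ Ω → τ 1 α0 α2 = σ 1 α0 α2) (N : ℤ) :
    ∀ α0 α2, (α0, α2) ∈ Ω → τ N α0 α2 = σ N α0 α2 := by
  rcases lt_or_ge N 0 with hN | hN
  · intro α0 α2 h
    rw [H.boundary N hN _ _ h, H'.boundary N hN _ _ h]
  obtain ⟨k, rfl⟩ := Int.eq_ofNat_of_zero_le hN
  suffices ∀ k : ℕ, (∀ α0 α2, (α0, α2) ∈ Ω → τ k α0 α2 = σ k α0 α2) ∧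
      ∀ α0 α2, (α0, α2) ∈ Ω → τ (k + 1) α0 α2 = σ (k + 1) α0 α2 from (this k).1
  intro k
  induction k with
  | zero => exact ⟨by simpa using e0, by simpa using e1⟩
  | succ k ih =>
    obtain ⟨i0, i1⟩ := ih
    refine ⟨by simpa using i1, fun α0 α2 h => ?_⟩
    have mx := hΩ.inv_mul_zero_mem h
    have mz := hΩ.inv_mul_two_mem h
    have ep : tauPoint Q τ k α0 α2 = tauPoint Q σ k α0 α2 := by
      unfold tauPoint
      rw [i0 _ _ mx, i0 _ _ h, i0 _ _ mz, i1 _ _ mx, i1 _ _ h, i1 _ _ mz]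
    have hr : ∀ i, (tauPoint Q τ k α0 α2).τ i ≠ 0 := fun i => by
      fin_cases i
      exacts [h0 k k.cast_nonneg _ _ mx, h0 k k.cast_nonneg _ _ h, h0 k k.cast_nonneg _ _ mz]
    -- `T4` expresses level `k + 2` through levels `k` and `k + 1`, on which the families agree.
    have := (H.t4 k α0 α2 h hr).symm.trans ((congrArg _ ep).trans (H'.t4 k α0 α2 h (ep ▸ hr)))
    rw [Nat.cast_succ]
    exact congrFun (congrArg Point.τbar this) 1

/-- Level `0` fixes `C` and level `1` fixes `A` and `B`. Since the gauged explicit family is again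
consistent, two levels suffice. -/
theorem IsHypergeometricTau.exists_eq (hQ0 : Q ≠ 0) (hQ1 : ‖Q‖ < 1) (hΩ : IsParameterDomain Q Ω)
    (h0 : ∀ N : ℤ, 0 ≤ N → ∀ α0 α2, (α0, α2) ∈ Ω → τ N α0 α2 ≠ 0)
    (H : IsHypergeometricTau Q Ω τ) :
    ∃ C A B : ℂ → ℂ → ℂ, IsGauge Q Ω C ∧ IsPeriodic Q Ω A ∧ IsPeriodic Q Ω B ∧
      ∀ N α0 α2, (α0, α2) ∈ Ω → τ N α0 α2 = C α0 α2 * hyperTau Q A B α0 α2 N 0 0 := by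
  obtain ⟨A, B, hA, hB, hf⟩ := (isContiguous_iff_exists hQ0 hQ1 hΩ _).1
    (H.isContiguous_entry hQ0 hQ1 hΩ h0)
  have hC := H.isGauge hQ0 hQ1 hΩ h0
  refine ⟨_, A, B, hC, hA, hB, H.eq_of_eq_zero_one hΩ h0
    ((isBilinearTau_hyperTau hQ0 hQ1 hΩ hA hB).gauge hΩ hC
      (fun N α0 α2 _ => rfl) |>.isHypergeometricTau hQ0 hΩ) (fun α0 α2 h => ?_)
    fun α0 α2 h => ?_⟩
  · have hG := gammaBase_ne_zero hQ0 hQ1 (hΩ.generic _ _ h)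
    have := hyperTau_natCast (A := A) (B := B) hQ0 hΩ h 0
    rw [Nat.cast_zero, latticeToeplitz_zero, prefactor_zero] at this
    rw [this]
    field_simp
  · have hG := gammaBase_ne_zero hQ0 hQ1 (hΩ.generic _ _ h)
    have hp := prefactor_ne_zero hQ0 hQ1 (hΩ.generic _ _ h) 1
    have z0 := h0 0 le_rfl _ _ h
    have := hyperTau_natCast (A := A) (B := B) hQ0 hΩ h 1
    rw [Nat.cast_one, latticeToeplitz, toeplitz_one, ← hf _ _ h] at this
    rw [this, entry]
    -- The value needed is at `m = -1`, where the argument `Q * α2` undoes the shift built into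
    -- `entry`.
    simp only [zpow_zero, one_mul, neg_neg, zpow_one, inv_mul_cancel_left₀ hQ0]
    field_simp

end

end QP3

end

/-! ### The main theorem -/

theorem mainTheorem1 (Q : ℂ) (hQ0 : Q ≠ 0) (hQ1 : ‖Q‖ < 1)
    (Ω : Set (ℂ × ℂ)) (hΩ : QP3.IsParameterDomain Q Ω) :
    -- the explicit expressions are hypergeometric `τ` functions
    (∀ A B : ℂ → ℂ → ℂ, QP3.IsPeriodic Q Ω A → QP3.IsPeriodic Q Ω B →
      QP3.IsHypergeometricTau Q Ω (fun N α0 α2 => QP3.hyperTau Q A B α0 α2 N 0 0) ∧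
      ∀ α0 α2, (α0, α2) ∈ Ω → ∀ N n m : ℤ,
        QP3.hyperTau Q A B (Q ^ n * α0) (Q ^ (-m) * α2) N 0 0 =
          QP3.hyperTau Q A B α0 α2 N n m) ∧
    -- the entries are the general solution of the contiguity relations
    (∀ f : ℂ → ℂ → ℂ, QP3.IsContiguous Q Ω f ↔
      ∃ A B : ℂ → ℂ → ℂ, QP3.IsPeriodic Q Ω A ∧ QP3.IsPeriodic Q Ω B ∧
        ∀ α0 α2, (α0, α2) ∈ Ω → ∀ n m : ℤ,
          f (Q ^ n * α0) (Q ^ (-m) * α2) = QP3.F Q A B α0 α2 n m) ∧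
    -- all hypergeometric `τ` functions are of this form, up to a gauge factor
    (∀ τ : ℤ → ℂ → ℂ → ℂ,
      (∀ N : ℤ, 0 ≤ N → ∀ α0 α2, (α0, α2) ∈ Ω → τ N α0 α2 ≠ 0) →
      (QP3.IsHypergeometricTau Q Ω τ ↔
        ∃ C A B : ℂ → ℂ → ℂ,
          QP3.IsGauge Q Ω C ∧ QP3.IsPeriodic Q Ω A ∧ QP3.IsPeriodic Q Ω B ∧
          ∀ α0 α2, (α0, α2) ∈ Ω → ∀ N n m : ℤ,
            τ N (Q ^ n * α0) (Q ^ (-m) * α2) =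
              C (Q ^ n * α0) (Q ^ (-m) * α2) * QP3.hyperTau Q A B α0 α2 N n m)) ∧
    -- and exactly of this form if the gauge is fixed by the value of `τ_0`
    (∀ τ : ℤ → ℂ → ℂ → ℂ,
      (∀ N : ℤ, 0 ≤ N → ∀ α0 α2, (α0, α2) ∈ Ω → τ N α0 α2 ≠ 0) →
      QP3.IsHypergeometricTau Q Ω τ →
      (∀ α0 α2, (α0, α2) ∈ Ω → ∀ n m : ℤ,
        τ 0 (Q ^ n * α0) (Q ^ (-m) * α2) = QP3.gammaFactor Q α0 α2 n m) →
      ∃ A B : ℂ → ℂ → ℂ, QP3.IsPeriodic Q Ω A ∧ QP3.IsPeriodic Q Ω B ∧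
        ∀ α0 α2, (α0, α2) ∈ Ω → ∀ N n m : ℤ,
          τ N (Q ^ n * α0) (Q ^ (-m) * α2) = QP3.hyperTau Q A B α0 α2 N n m) := by
  have e0 : ∀ a : ℂ, Q ^ (0 : ℤ) * a = a := fun a => by rw [zpow_zero, one_mul]
  have e2 : ∀ a : ℂ, Q ^ (-0 : ℤ) * a = a := fun a => by rw [neg_zero, e0]
  have part3 : ∀ τ : ℤ → ℂ → ℂ → ℂ,
      (∀ N : ℤ, 0 ≤ N → ∀ α0 α2, (α0, α2) ∈ Ω → τ N α0 α2 ≠ 0) →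
      QP3.IsHypergeometricTau Q Ω τ → ∃ C A B : ℂ → ℂ → ℂ,
        QP3.IsGauge Q Ω C ∧ QP3.IsPeriodic Q Ω A ∧ QP3.IsPeriodic Q Ω B ∧
        ∀ α0 α2, (α0, α2) ∈ Ω → ∀ N n m : ℤ,
          τ N (Q ^ n * α0) (Q ^ (-m) * α2) =
            C (Q ^ n * α0) (Q ^ (-m) * α2) * QP3.hyperTau Q A B α0 α2 N n m := by
    intro τ h0 H
    obtain ⟨C, A, B, hC, hA, hB, hτ⟩ := H.exists_eq hQ0 hQ1 hΩ h0
    refine ⟨C, A, B, hC, hA, hB, fun α0 α2 h N n m => ?_⟩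
    rw [hτ _ _ _ (hΩ.shift _ _ h n m), QP3.hyperTau_shift hQ0 hΩ hA hB h]
  refine ⟨fun A B hA hB => ⟨(QP3.isBilinearTau_hyperTau hQ0 hQ1 hΩ hA hB).isHypergeometricTau hQ0 hΩ,
    fun α0 α2 h N n m => QP3.hyperTau_shift hQ0 hΩ hA hB h N n m⟩,
    QP3.isContiguous_iff_exists hQ0 hQ1 hΩ, fun τ h0 => ⟨part3 τ h0, ?_⟩, fun τ h0 H hG => ?_⟩
  · rintro ⟨C, A, B, hC, hA, hB, hτ⟩
    refine ((QP3.isBilinearTau_hyperTau hQ0 hQ1 hΩ hA hB).gauge hΩ hC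
      fun N α0 α2 h => ?_).isHypergeometricTau hQ0 hΩ
    simpa only [e0, e2] using hτ α0 α2 h N 0 0
  · obtain ⟨C, A, B, hC, hA, hB, hτ⟩ := part3 τ h0 H
    refine ⟨A, B, hA, hB, fun α0 α2 h N n m => ?_⟩
    have hs := hΩ.shift _ _ h n m
    have h1 := hτ α0 α2 h 0 n m
    -- At `N = 0` the explicit function is the gamma factor itself, so the normalization forces `C =
    -- 1` at every lattice point.
    have e : QP3.hyperTau Q A B α0 α2 0 n m = QP3.gammaFactor Q α0 α2 n m := by
      simp [QP3.hyperTau, QP3.psi]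
    rw [e, ← hG α0 α2 h n m] at h1
    rw [hτ α0 α2 h N n m, (mul_eq_right₀ (h0 0 le_rfl _ _ hs)).1 h1.symm, one_mul]
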